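/- Let $q\in\mathbb C$ be nonzero and not a root of unity, fix a square root of every complex number, and put $t=\mathbf i\sqrt q$ (so $t^2=-q$). Let $\mathcal A=\mathbb C_q[osp(1,2)]$ be the $\mathbb Z_2$-graded $\mathbb C$-algebra with generators $a,b,c,d,\sigma$ ($a,d,\sigma$ even; $b,c$ odd) and relations $$ab=tba,\quad ac=tca,\quad bc=-cb,\quad bd=-tdb,\quad cd=-tdc,\quad ad-da=(t^{-1}-t)bc,\quad ad+tbc=\sigma,\quad \sigma^2=1,$$ with comultiplication $\Delta:\mathcal A\to\mathcal A\otimes\mathcal A$ the algebra map into the graded tensor product given by $\Delta(a)=a\otimes a+b\otimes c$, $\Delta(b)=a\otimes b+b\otimes d$, $\Delta(c)=c\otimes a+d\otimes c$, $\Delta(d)=c\otimes b+d\otimes d$, $\Delta(\sigma)=\sigma\otimes\sigma$, and counit $\varepsilon(a)=\varepsilon(d)=\varepsilon(\sigma)=1$, $\varepsilon(b)=\varepsilon(c)=0$. Let $\mathcal U=U_q(osp(1,2))$ be the $\mathbb C$-algebra generated by $e,f,k^{\pm1}$ with $kk^{-1}=k^{-1}k=1$, $kek^{-1}=qe$, $kfk^{-1}=q^{-1}f$,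 $ef+fe=(k-k^{-1})/(q-q^{-1})$, and counit $\varepsilon(k^{\pm1})=1$, $\varepsilon(e)=\varepsilon(f)=0$. Elements of $\mathcal U$ are viewed as linear functions on $\mathcal A$, with $(xy)(u)=\sum x(u_1)y(u_2)$ where $\Delta(u)=\sum u_1\otimes u_2$: the $k^{\pm1}$ are algebra maps with $k^{\pm1}(a)=t^{\pm1}$, $k^{\pm1}(d)=-t^{\mp1}$, $k^{\pm1}(\sigma)=-1$, $k^{\pm1}(b)=k^{\pm1}(c)=0$; the only nonzero values of $e$ and $f$ on the generators are $e(b)=\frac{t-t^{-1}}{q-q^{-1}}$ and $f(c)=1$; and $e(uv)=e(u)\varepsilon(v)+k(u)e(v)$, $f(uv)=f(u)k^{-1}(v)+\varepsilon(u)f(v)$ for all $u,v\in\mathcal A$, $e(1)=f(1)=0$. The right action of $x\in\mathcal U$ on $\mathcal A$ is $R_x(u)=\sum x(u_1)u_2$, and the right invariants of $x$ are $\{u\in\mathcal A: R_x(u)=\varepsilon(x)u\}$. For $\ell\in\mathbb Z_+=\{0,1,2,\dots\}$ let $I_\ell=\{-\ell,\dots,\ell\}$ and, for $i\in I_\ell$,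 $$\xi^{(\ell)}_i=\mathbf i^{\lfloor(\ell+i)/2\rfloor}\binom{2\ell}{\ell+i}^{1/2}_{t^{-2}}a^{\ell-i}c^{\ell+i},\qquad \binom mn_v=\frac{(v;v)_m}{(v;v)_n(v;v)_{m-n}},\quad (u;v)_m=\prod_{k=0}^{m-1}(1-uv^k),$$ with $\xi^{(\ell)}_{-\ell-1}=\xi^{(\ell)}_{\ell+1}=0$. The matrix elements $m^{(\ell)}_{ij}\in\mathcal A$ are defined by $\Delta(\xi^{(\ell)}_i)=\sum_{j\in I_\ell}m^{(\ell)}_{ij}\otimes\xi^{(\ell)}_j$, and for $s\in\{0,1\}$ the scalars $a_i,b_i,c_i$ (depending on $\ell,s$) are defined by $$R_{k-1}(\xi^{(\ell)}_i\sigma^s)=a_i\,\xi^{(\ell)}_i\sigma^s,\qquad R_e(\xi^{(\ell)}_i\sigma^s)=b_i\,\xi^{(\ell)}_{i+1}\sigma^s,\qquad R_{fk}(\xi^{(\ell)}_i\sigma^s)=c_i\,\xi^{(\ell)}_{i-1}\sigma^s .$$ **Theorem.** Let $\alpha,\beta,\gamma$ be nonzero complex numbers. (1) The right invariants of $x_{\alpha\beta}=\alpha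 e+\beta fk$ form a subalgebra of $\mathcal A$, which is spanned by the elements $$\sum_{i\in I_\ell}x_i\,m^{(\ell)}_{ij}\sigma^s,\qquad \ell\in\mathbb Z_+,\ j\in I_\ell,\ s=0,1,$$ where $x_{-\ell}=1$, $x_{-\ell+2k+1}=0$ for $0\le k\le\ell-1$, and $x_{-\ell+2k}=(-\alpha\beta^{-1})^k\,\dfrac{\prod_{j=0}^{k-1}b_{-\ell+2j}}{\prod_{j=1}^{k}c_{-\ell+2j}}$ for $1\le k\le\ell$. (2) The space of right invariants of $x_{\alpha\gamma}=\alpha e+\gamma(k-1)$ is spanned by the elements $$\sum_{i\in I_\ell}x_i\,m^{(\ell)}_{ij}\sigma^s,\qquad \ell\in\mathbb Z_+,\ j\in I_\ell,\ s=0,1,\ \ell+s\text{ even},$$ where $x_i=0$ for $-\ell\le i\le-1$, $x_0=1$, and $x_i=(-\alpha\gamma^{-1})^i\,\dfrac{\prod_{j=0}^{i-1}b_j}{\prod_{j=1}^{i}a_j}$ for $1\le i\le\ell$. (3) The space of right invariants of $x_{\beta\gamma}=\beta fk+\gamma(k-1)$ is spanned by the elements $$\sum_{i\in I_\ell}x_i\,m^{(\ell)}_{ij}\sigma^s,\qquad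 \ell\in\mathbb Z_+,\ j\in I_\ell,\ s=0,1,\ \ell+s\text{ even},$$ where $x_0=1$, $x_i=0$ for $1\le i\le\ell$, and $x_i=(-\beta\gamma^{-1})^{-i}\,\dfrac{\prod_{j=i+1}^{0}c_j}{\prod_{j=i}^{-1}a_j}$ for $-\ell\le i\le-1$. -/

import Mathlib

open scoped TensorProduct

/-- The standing data: a nonzero complex number `q`, not a root of unity, and a choice
`sqrt` of a square root of every complex number (used for `√q` and for the square roots in
the normalisation of the bases). -/
structure QParam where
  q : ℂ
  sqrt : ℂ → ℂ
  q_ne_zero : q ≠ 0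
  q_not_root : ∀ n : ℕ, 0 < n → q ^ n ≠ 1
  sqrt_sq : ∀ z, sqrt z ^ 2 = z

namespace QParam

/-- `t = i √q`. -/
noncomputable def t (P : QParam) : ℂ := Complex.I * P.sqrt P.q

theorem t_sq (P : QParam) : P.t ^ 2 = -P.q := by
  simp [t, mul_pow, P.sqrt_sq]

theorem q_eq (P : QParam) : P.q = -P.t ^ 2 := by
  rw [P.t_sq, neg_neg]

theorem t_ne_zero (P : QParam) : P.t ≠ 0 := by
  intro h
  have h2 := P.t_sq
  rw [h] at h2
  exact P.q_ne_zero (by simpa using h2.symm)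

end QParam

namespace QOsp

/-- Generators of the quantum supergroup `𝒜 = ℂ_q[osp(1,2)]`. -/
inductive AGen
  | a | b | c | d | σ

/-- Defining relations of `𝒜`. -/
inductive ARel (P : QParam) : FreeAlgebra ℂ AGen → FreeAlgebra ℂ AGen → Prop
  | ab : ARel P (FreeAlgebra.ι ℂ AGen.a * FreeAlgebra.ι ℂ AGen.b)
      (P.t • (FreeAlgebra.ι ℂ AGen.b * FreeAlgebra.ι ℂ AGen.a))
  | ac : ARel P (FreeAlgebra.ι ℂ AGen.a * FreeAlgebra.ι ℂ AGen.c)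
      (P.t • (FreeAlgebra.ι ℂ AGen.c * FreeAlgebra.ι ℂ AGen.a))
  | bc : ARel P (FreeAlgebra.ι ℂ AGen.b * FreeAlgebra.ι ℂ AGen.c)
      (-(FreeAlgebra.ι ℂ AGen.c * FreeAlgebra.ι ℂ AGen.b))
  | bd : ARel P (FreeAlgebra.ι ℂ AGen.b * FreeAlgebra.ι ℂ AGen.d)
      (-(P.t • (FreeAlgebra.ι ℂ AGen.d * FreeAlgebra.ι ℂ AGen.b)))
  | cd : ARel P (FreeAlgebra.ι ℂ AGen.c * FreeAlgebra.ι ℂ AGen.d)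
      (-(P.t • (FreeAlgebra.ι ℂ AGen.d * FreeAlgebra.ι ℂ AGen.c)))
  | ad : ARel P (FreeAlgebra.ι ℂ AGen.a * FreeAlgebra.ι ℂ AGen.d
        - FreeAlgebra.ι ℂ AGen.d * FreeAlgebra.ι ℂ AGen.a)
      ((P.t⁻¹ - P.t) • (FreeAlgebra.ι ℂ AGen.b * FreeAlgebra.ι ℂ AGen.c))
  | det : ARel P (FreeAlgebra.ι ℂ AGen.a * FreeAlgebra.ι ℂ AGen.d
        + P.t • (FreeAlgebra.ι ℂ AGen.b * FreeAlgebra.ι ℂ AGen.c))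
      (FreeAlgebra.ι ℂ AGen.σ)
  | sq : ARel P (FreeAlgebra.ι ℂ AGen.σ * FreeAlgebra.ι ℂ AGen.σ) 1

/-- The algebra `𝒜 = ℂ_q[osp(1,2)]`, by generators and relations. -/
def A (P : QParam) : Type := RingQuot (ARel P)

noncomputable instance (P : QParam) : Ring (A P) := inferInstanceAs (Ring (RingQuot (ARel P)))

noncomputable instance (P : QParam) : Algebra ℂ (A P) :=
  inferInstanceAs (Algebra ℂ (RingQuot (ARel P)))

/-- The quotient map from the free algebra. -/
noncomputable def projA (P : QParam) : FreeAlgebra ℂ AGen →ₐ[ℂ] A P :=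
  RingQuot.mkAlgHom ℂ (ARel P)

theorem projA_rel (P : QParam) {x y : FreeAlgebra ℂ AGen} (h : ARel P x y) :
    projA P x = projA P y :=
  RingQuot.mkAlgHom_rel ℂ h

/-- The class in `𝒜` of a generator. -/
noncomputable def gen (P : QParam) (g : AGen) : A P :=
  projA P (FreeAlgebra.ι ℂ g)

section relations
variable (P : QParam)

theorem gen_ab : gen P .a * gen P .b = P.t • (gen P .b * gen P .a) := by
  simpa [gen] using projA_rel P ARel.ab
theorem gen_ac : gen P .a * gen P .c = P.t • (gen P .c * gen P .a) := by
  simpa [gen] using projA_rel P ARel.ac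
theorem gen_bc : gen P .b * gen P .c = -(gen P .c * gen P .b) := by
  simpa [gen] using projA_rel P ARel.bc
theorem gen_bd : gen P .b * gen P .d = -(P.t • (gen P .d * gen P .b)) := by
  simpa [gen] using projA_rel P ARel.bd
theorem gen_cd : gen P .c * gen P .d = -(P.t • (gen P .d * gen P .c)) := by
  simpa [gen] using projA_rel P ARel.cd
theorem gen_ad : gen P .a * gen P .d - gen P .d * gen P .a
    = (P.t⁻¹ - P.t) • (gen P .b * gen P .c) := by
  have h := projA_rel P ARel.ad
  rw [map_sub, map_smul, map_mul, map_mul, map_mul] at h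
  exact h
theorem gen_det : gen P .a * gen P .d + P.t • (gen P .b * gen P .c) = gen P .σ := by
  simpa [gen] using projA_rel P ARel.det
theorem gen_sq : gen P .σ * gen P .σ = 1 := by
  simpa [gen] using projA_rel P ARel.sq

theorem gen_ba : gen P .b * gen P .a = P.t⁻¹ • (gen P .a * gen P .b) := by
  rw [gen_ab, smul_smul, inv_mul_cancel₀ P.t_ne_zero, one_smul]
theorem gen_ca : gen P .c * gen P .a = P.t⁻¹ • (gen P .a * gen P .c) := by
  rw [gen_ac, smul_smul, inv_mul_cancel₀ P.t_ne_zero, one_smul]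
theorem gen_cb : gen P .c * gen P .b = -(gen P .b * gen P .c) := by
  rw [gen_bc, neg_neg]
theorem gen_db : gen P .d * gen P .b = -(P.t⁻¹ • (gen P .b * gen P .d)) := by
  rw [gen_bd, smul_neg, neg_neg, smul_smul, inv_mul_cancel₀ P.t_ne_zero, one_smul]
theorem gen_dc : gen P .d * gen P .c = -(P.t⁻¹ • (gen P .c * gen P .d)) := by
  rw [gen_cd, smul_neg, neg_neg, smul_smul, inv_mul_cancel₀ P.t_ne_zero, one_smul]
theorem gen_da : gen P .d * gen P .a
    = gen P .a * gen P .d - (P.t⁻¹ - P.t) • (gen P .b * gen P .c) := by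
  rw [← gen_ad]; abel

end relations

/-- Universal property of `𝒜`: an algebra map out of `𝒜` is a choice of images of the
generators that satisfies the defining relations. -/
noncomputable def liftA (P : QParam) {B : Type} [Ring B] [Algebra ℂ B] (φ : AGen → B)
    (hab : φ .a * φ .b = P.t • (φ .b * φ .a))
    (hac : φ .a * φ .c = P.t • (φ .c * φ .a))
    (hbc : φ .b * φ .c = -(φ .c * φ .b))
    (hbd : φ .b * φ .d = -(P.t • (φ .d * φ .b)))
    (hcd : φ .c * φ .d = -(P.t • (φ .d * φ .c)))
    (had : φ .a * φ .d - φ .d * φ .a = (P.t⁻¹ - P.t) • (φ .b * φ .c))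
    (hdet : φ .a * φ .d + P.t • (φ .b * φ .c) = φ .σ)
    (hsq : φ .σ * φ .σ = 1) : A P →ₐ[ℂ] B :=
  RingQuot.liftAlgHom ℂ ⟨FreeAlgebra.lift ℂ φ, by
    intro x y h
    cases h
    · simpa using hab
    · simpa using hac
    · simpa using hbc
    · simpa using hbd
    · simpa using hcd
    · rw [map_sub, map_smul, map_mul, map_mul, map_mul]
      simpa only [FreeAlgebra.lift_ι_apply] using had
    · simpa using hdet
    · simpa using hsq⟩

theorem liftA_gen (P : QParam) {B : Type} [Ring B] [Algebra ℂ B] (φ : AGen → B)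
    (h1 h2 h3 h4 h5 h6 h7 h8) (g : AGen) :
    liftA P φ h1 h2 h3 h4 h5 h6 h7 h8 (gen P g) = φ g := by
  unfold liftA gen projA
  erw [RingQuot.liftAlgHom_mkAlgHom_apply]
  simp

/-- Induction by multiplying with generators from the left. -/
theorem A_induction (P : QParam) {Q : A P → Prop} (one : Q 1)
    (add : ∀ u v, Q u → Q v → Q (u + v)) (smul : ∀ (z : ℂ) u, Q u → Q (z • u))
    (gen_mul : ∀ g u, Q u → Q (gen P g * u)) (u : A P) : Q u := by
  have key : ∀ w : FreeAlgebra ℂ AGen, ∀ v : A P, Q v → Q (projA P w * v) := by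
    intro w
    induction w using FreeAlgebra.induction with
    | grade0 z =>
      intro v hv
      have : projA P (algebraMap ℂ _ z) = algebraMap ℂ (A P) z :=
        AlgHom.commutes _ _
      rw [this, ← Algebra.smul_def]
      exact smul z v hv
    | grade1 g => exact fun v hv => gen_mul g v hv
    | mul x y hx hy =>
      intro v hv
      have : projA P (x * y)
        = projA P x * projA P y :=
        map_mul _ _ _
      rw [this, mul_assoc]
      exact hx _ (hy _ hv)
    | add x y hx hy =>
      intro v hv
      have : projA P (x + y)
        = projA P x + projA P y :=
        map_add _ _ _
      rw [this, add_mul]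
      exact add _ _ (hx _ hv) (hy _ hv)
  obtain ⟨w, hw⟩ := RingQuot.mkAlgHom_surjective ℂ (ARel P) u
  have := key w 1 one
  rw [mul_one] at this
  exact hw ▸ this

/-- The parity automorphism of `𝒜`, `u ↦ (-1)^{p(u)} u`, where `p(a) = p(d) = p(σ) = 0` and
`p(b) = p(c) = 1`. -/
noncomputable def par (P : QParam) : A P →ₐ[ℂ] A P :=
  liftA P (fun g => match g with
      | .a => gen P .a
      | .b => -gen P .b
      | .c => -gen P .c
      | .d => gen P .d
      | .σ => gen P .σ)
    (by simp [gen_ab]) (by simp [gen_ac]) (by simp [gen_bc]) (by simp [gen_bd])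
    (by simp [gen_cd]) (by simpa using gen_ad P) (by simpa using gen_det P) (gen_sq P)

section par
variable (P : QParam)
@[simp] theorem par_a : par P (gen P .a) = gen P .a := liftA_gen ..
@[simp] theorem par_b : par P (gen P .b) = -gen P .b := liftA_gen ..
@[simp] theorem par_c : par P (gen P .c) = -gen P .c := liftA_gen ..
@[simp] theorem par_d : par P (gen P .d) = gen P .d := liftA_gen ..
@[simp] theorem par_σ : par P (gen P .σ) = gen P .σ := liftA_gen ..

@[simp] theorem par_par (u : A P) : par P (par P u) = u := by
  induction u using A_induction P with
  | one => simp
  | add u v hu hv => simp [hu, hv]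
  | smul z u hu => simp [hu]
  | gen_mul g u hu => cases g <;> simp [hu]
end par

/-- The `ℤ/2`-grading of `𝒜`: the even part `{u | par u = u}` and the odd part
`{u | par u = -u}`. -/
noncomputable def grading (P : QParam) (i : ZMod 2) : Submodule ℂ (A P) :=
  LinearMap.ker ((par P).toLinearMap - (if i = 0 then (1 : ℂ) else -1) • LinearMap.id)

theorem mem_grading_zero (P : QParam) (u : A P) : u ∈ grading P 0 ↔ par P u = u := by
  simp [grading, sub_eq_zero]

theorem mem_grading_one (P : QParam) (u : A P) : u ∈ grading P 1 ↔ par P u = -u := by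
  simp [grading, add_eq_zero_iff_eq_neg]

theorem half_even (P : QParam) (u : A P) : (1 / 2 : ℂ) • (u + par P u) ∈ grading P 0 := by
  rw [mem_grading_zero]; simp [add_comm]

theorem half_odd (P : QParam) (u : A P) : (1 / 2 : ℂ) • (u - par P u) ∈ grading P 1 := by
  rw [mem_grading_one, map_smul, map_sub, par_par, ← smul_neg, neg_sub]

noncomputable instance (P : QParam) : GradedAlgebra (grading P) where
  one_mem := by rw [mem_grading_zero]; simp
  mul_mem := by
    intro i j u v hu hv
    fin_cases i <;> fin_cases j
    · have hu' := (mem_grading_zero P u).1 hu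
      have hv' := (mem_grading_zero P v).1 hv
      exact (mem_grading_zero P _).2 (by simp [hu', hv'])
    · have hu' := (mem_grading_zero P u).1 hu
      have hv' := (mem_grading_one P v).1 hv
      exact (mem_grading_one P _).2 (by simp [hu', hv'])
    · have hu' := (mem_grading_one P u).1 hu
      have hv' := (mem_grading_zero P v).1 hv
      exact (mem_grading_one P _).2 (by simp [hu', hv'])
    · have hu' := (mem_grading_one P u).1 hu
      have hv' := (mem_grading_one P v).1 hv
      exact (mem_grading_zero P _).2 (by simp [hu', hv'])
  decompose' u :=
    DirectSum.of (fun i => grading P i) 0 ⟨_, half_even P u⟩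
      + DirectSum.of (fun i => grading P i) 1 ⟨_, half_odd P u⟩
  left_inv u := by
    rw [map_add, DirectSum.coeAddMonoidHom_of, DirectSum.coeAddMonoidHom_of]
    change (1 / 2 : ℂ) • (u + par P u) + (1 / 2 : ℂ) • (u - par P u) = u
    module
  right_inv x := by
    induction x using DirectSum.induction_on with
    | zero =>
      have h0 : (⟨_, half_even P 0⟩ : grading P 0) = 0 := Subtype.ext (by simp)
      have h1 : (⟨_, half_odd P 0⟩ : grading P 1) = 0 := Subtype.ext (by simp)
      simp only
      rw [map_zero (DirectSum.coeAddMonoidHom _), h0, h1]; simp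
    | of i x =>
      obtain ⟨x, hx⟩ := x
      rw [DirectSum.coeAddMonoidHom_of]
      fin_cases i
      · have hx' := (mem_grading_zero P x).1 hx
        have h0 : (⟨_, half_even P x⟩ : grading P 0) = ⟨x, hx⟩ :=
          Subtype.ext (by simp only [hx']; module)
        have h1 : (⟨_, half_odd P x⟩ : grading P 1) = 0 := Subtype.ext (by simp [hx'])
        simp only
        rw [h0, h1]; simp; rfl
      · have hx' := (mem_grading_one P x).1 hx
        have h0 : (⟨_, half_even P x⟩ : grading P 0) = 0 := Subtype.ext (by simp [hx'])
        have h1 : (⟨_, half_odd P x⟩ : grading P 1) = ⟨x, hx⟩ :=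
          Subtype.ext (by simp only [hx']; module)
        simp only
        rw [h0, h1]; simp; rfl
    | add x y hx hy =>
      have h0 (u v : A P) : (⟨_, half_even P (u + v)⟩ : grading P 0)
          = ⟨_, half_even P u⟩ + ⟨_, half_even P v⟩ :=
        Subtype.ext (by simp only [map_add, Submodule.coe_add]; module)
      have h1 (u v : A P) : (⟨_, half_odd P (u + v)⟩ : grading P 1)
          = ⟨_, half_odd P u⟩ + ⟨_, half_odd P v⟩ :=
        Subtype.ext (by simp only [map_add, Submodule.coe_add]; module)
      conv_rhs => rw [← hx, ← hy]
      simp only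
      rw [map_add, h0, h1, map_add, map_add]
      abel

section comultiplication
variable (P : QParam)

open GradedTensorProduct in
theorem gtmul_even (x y z w : A P) (hy : par P y = y) :
    ((x ᵍ⊗ₜ[ℂ] y : (grading P) ᵍ⊗[ℂ] (grading P)) * (z ᵍ⊗ₜ[ℂ] w))
      = (x * z) ᵍ⊗ₜ[ℂ] (y * w) := by
  have hy' := (mem_grading_zero P y).2 hy
  have hz : z = (1 / 2 : ℂ) • (z + par P z) + (1 / 2 : ℂ) • (z - par P z) := by module
  have e0 := tmul_zero_coe_mul_coe_tmul (R := ℂ) (grading P) (grading P) x ⟨y, hy'⟩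
    ⟨_, half_even P z⟩ w
  have e1 := tmul_zero_coe_mul_coe_tmul (R := ℂ) (grading P) (grading P) x ⟨y, hy'⟩
    ⟨_, half_odd P z⟩ w
  simp only at e0 e1
  conv_lhs => rw [hz]
  conv_rhs => rw [hz]
  simp only [tmul] at e0 e1 ⊢
  rw [TensorProduct.add_tmul, map_add, mul_add, e0, e1, ← map_add, ← TensorProduct.add_tmul,
    ← mul_add]

open GradedTensorProduct in
theorem gtmul_odd (x y z w : A P) (hy : par P y = -y) :
    ((x ᵍ⊗ₜ[ℂ] y : (grading P) ᵍ⊗[ℂ] (grading P)) * (z ᵍ⊗ₜ[ℂ] w))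
      = (x * par P z) ᵍ⊗ₜ[ℂ] (y * w) := by
  have hy' := (mem_grading_one P y).2 hy
  have hz : z = (1 / 2 : ℂ) • (z + par P z) + (1 / 2 : ℂ) • (z - par P z) := by module
  have hz2 : par P z = (1 / 2 : ℂ) • (z + par P z) + -((1 / 2 : ℂ) • (z - par P z)) := by module
  have e0 := tmul_coe_mul_zero_coe_tmul (R := ℂ) (grading P) (grading P) x ⟨y, hy'⟩
    ⟨_, half_even P z⟩ w
  have e1 := tmul_coe_mul_coe_tmul (R := ℂ) (grading P) (grading P) x ⟨y, hy'⟩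
    ⟨_, half_odd P z⟩ w
  have h11 : (-1 : ℤˣ) ^ ((1 : ZMod 2) * 1) = -1 := by rw [mul_one, uzpow_one]
  rw [h11] at e1
  simp only at e0 e1
  conv_lhs => rw [hz]
  conv_rhs => rw [hz2]
  simp only [tmul] at e0 e1 ⊢
  rw [TensorProduct.add_tmul, map_add, mul_add, e0, e1, mul_add, TensorProduct.add_tmul, map_add,
    mul_neg, TensorProduct.neg_tmul, map_neg, Units.neg_smul, one_smul]

end comultiplication

section
open GradedTensorProduct

set_option linter.unusedSimpArgs false in
/-- The comultiplication `Δ` of `𝒜`, an algebra map into the graded (super) tensor product: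
`Δ(x_{ij}) = ∑ x_{ik} ⊗ x_{kj}` for the matrix with rows `(a, b, 0)`, `(c, d, 0)`,
`(0, 0, σ)`. -/
noncomputable def comulHom (P : QParam) : A P →ₐ[ℂ] (grading P) ᵍ⊗[ℂ] (grading P) :=
  liftA P (fun g => match g with
      | .a => gen P .a ᵍ⊗ₜ[ℂ] gen P .a + gen P .b ᵍ⊗ₜ[ℂ] gen P .c
      | .b => gen P .a ᵍ⊗ₜ[ℂ] gen P .b + gen P .b ᵍ⊗ₜ[ℂ] gen P .d
      | .c => gen P .c ᵍ⊗ₜ[ℂ] gen P .a + gen P .d ᵍ⊗ₜ[ℂ] gen P .c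
      | .d => gen P .c ᵍ⊗ₜ[ℂ] gen P .b + gen P .d ᵍ⊗ₜ[ℂ] gen P .d
      | .σ => gen P .σ ᵍ⊗ₜ[ℂ] gen P .σ)
    (by
      have ht := P.t_ne_zero
      simp only [mul_add, add_mul, gtmul_even, gtmul_odd, par_a, par_b, par_c, par_d, gen_ba,
        gen_ca, gen_cb, gen_db, gen_dc, gen_da, ← gen_det, tmul, TensorProduct.tmul_add,
        TensorProduct.add_tmul, TensorProduct.tmul_neg, TensorProduct.neg_tmul,
        TensorProduct.tmul_smul, ← TensorProduct.smul_tmul', TensorProduct.tmul_sub,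
        TensorProduct.sub_tmul, map_add, map_neg, map_smul, map_sub, mul_neg, smul_add, smul_neg,
        smul_sub, smul_smul]
      match_scalars <;> field_simp <;> ring)
    (by
      have ht := P.t_ne_zero
      simp only [mul_add, add_mul, gtmul_even, gtmul_odd, par_a, par_b, par_c, par_d, gen_ba,
        gen_ca, gen_cb, gen_db, gen_dc, gen_da, ← gen_det, tmul, TensorProduct.tmul_add,
        TensorProduct.add_tmul, TensorProduct.tmul_neg, TensorProduct.neg_tmul,
        TensorProduct.tmul_smul, ← TensorProduct.smul_tmul', TensorProduct.tmul_sub,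
        TensorProduct.sub_tmul, map_add, map_neg, map_smul, map_sub, mul_neg, smul_add, smul_neg,
        smul_sub, smul_smul]
      match_scalars <;> field_simp <;> ring)
    (by
      have ht := P.t_ne_zero
      simp only [mul_add, add_mul, gtmul_even, gtmul_odd, par_a, par_b, par_c, par_d, gen_ba,
        gen_ca, gen_cb, gen_db, gen_dc, gen_da, ← gen_det, tmul, TensorProduct.tmul_add,
        TensorProduct.add_tmul, TensorProduct.tmul_neg, TensorProduct.neg_tmul,
        TensorProduct.tmul_smul, ← TensorProduct.smul_tmul', TensorProduct.tmul_sub,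
        TensorProduct.sub_tmul, map_add, map_neg, map_smul, map_sub, mul_neg, smul_add, smul_neg,
        smul_sub, smul_smul]
      match_scalars <;> field_simp <;> ring)
    (by
      have ht := P.t_ne_zero
      simp only [mul_add, add_mul, gtmul_even, gtmul_odd, par_a, par_b, par_c, par_d, gen_ba,
        gen_ca, gen_cb, gen_db, gen_dc, gen_da, ← gen_det, tmul, TensorProduct.tmul_add,
        TensorProduct.add_tmul, TensorProduct.tmul_neg, TensorProduct.neg_tmul,
        TensorProduct.tmul_smul, ← TensorProduct.smul_tmul', TensorProduct.tmul_sub,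
        TensorProduct.sub_tmul, map_add, map_neg, map_smul, map_sub, mul_neg, smul_add, smul_neg,
        smul_sub, smul_smul]
      match_scalars <;> field_simp <;> ring)
    (by
      have ht := P.t_ne_zero
      simp only [mul_add, add_mul, gtmul_even, gtmul_odd, par_a, par_b, par_c, par_d, gen_ba,
        gen_ca, gen_cb, gen_db, gen_dc, gen_da, ← gen_det, tmul, TensorProduct.tmul_add,
        TensorProduct.add_tmul, TensorProduct.tmul_neg, TensorProduct.neg_tmul,
        TensorProduct.tmul_smul, ← TensorProduct.smul_tmul', TensorProduct.tmul_sub,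
        TensorProduct.sub_tmul, map_add, map_neg, map_smul, map_sub, mul_neg, smul_add, smul_neg,
        smul_sub, smul_smul]
      match_scalars <;> field_simp <;> ring)
    (by
      have ht := P.t_ne_zero
      simp only [mul_add, add_mul, gtmul_even, gtmul_odd, par_a, par_b, par_c, par_d, gen_ba,
        gen_ca, gen_cb, gen_db, gen_dc, gen_da, ← gen_det, tmul, TensorProduct.tmul_add,
        TensorProduct.add_tmul, TensorProduct.tmul_neg, TensorProduct.neg_tmul,
        TensorProduct.tmul_smul, ← TensorProduct.smul_tmul', TensorProduct.tmul_sub,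
        TensorProduct.sub_tmul, map_add, map_neg, map_smul, map_sub, mul_neg, smul_add, smul_neg,
        smul_sub, smul_smul]
      match_scalars <;> field_simp <;> ring)
    (by
      have ht := P.t_ne_zero
      simp only [mul_add, add_mul, gtmul_even, gtmul_odd, par_a, par_b, par_c, par_d, gen_ba,
        gen_ca, gen_cb, gen_db, gen_dc, gen_da, ← gen_det, tmul, TensorProduct.tmul_add,
        TensorProduct.add_tmul, TensorProduct.tmul_neg, TensorProduct.neg_tmul,
        TensorProduct.tmul_smul, ← TensorProduct.smul_tmul', TensorProduct.tmul_sub,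
        TensorProduct.sub_tmul, map_add, map_neg, map_smul, map_sub, mul_neg, smul_add, smul_neg,
        smul_sub, smul_smul]
      match_scalars <;> field_simp <;> ring)
    (by rw [gtmul_even P _ _ _ _ (par_σ P), gen_sq]; rfl)

end

section coalgebra
variable (P : QParam)

open GradedTensorProduct LinearMap TensorProduct

/-- The comultiplication as a linear map into the ordinary tensor product of vector spaces. -/
noncomputable def comulLin : A P →ₗ[ℂ] A P ⊗[ℂ] A P :=
  (of ℂ (grading P) (grading P)).symm.toLinearMap ∘ₗ (comulHom P).toLinearMap

/-- The counit `ε` of `𝒜`. -/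
noncomputable def counitHom : A P →ₐ[ℂ] ℂ :=
  liftA P (fun g => match g with
      | .a => 1
      | .b => 0
      | .c => 0
      | .d => 1
      | .σ => 1)
    (by simp) (by simp) (by simp) (by simp) (by simp) (by simp) (by simp) (by simp)

@[simp] theorem counit_a : counitHom P (gen P .a) = 1 := liftA_gen ..
@[simp] theorem counit_b : counitHom P (gen P .b) = 0 := liftA_gen ..
@[simp] theorem counit_c : counitHom P (gen P .c) = 0 := liftA_gen ..
@[simp] theorem counit_d : counitHom P (gen P .d) = 1 := liftA_gen ..
@[simp] theorem counit_σ : counitHom P (gen P .σ) = 1 := liftA_gen ..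

@[simp] theorem counit_par (u : A P) : counitHom P (par P u) = counitHom P u := by
  induction u using A_induction P with
  | one => simp
  | add u v hu hv => simp [hu, hv]
  | smul z u hu => simp [hu]
  | gen_mul g u hu => cases g <;> simp [hu]

theorem even_mul (x y : A P) (hy : par P y = y) (T : (grading P) ᵍ⊗[ℂ] (grading P)) :
    (of ℂ (grading P) (grading P)).symm ((x ᵍ⊗ₜ[ℂ] y) * T)
      = TensorProduct.map (mulLeft ℂ x) (mulLeft ℂ y)
        ((of ℂ (grading P) (grading P)).symm T) := by
  obtain ⟨T, rfl⟩ := (of ℂ (grading P) (grading P)).surjective T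
  induction T with
  | zero => simp
  | add S T hS hT => rw [map_add, mul_add, map_add, hS, hT, map_add, map_add]
  | tmul z w =>
    have h := gtmul_even P x y z w hy
    simp only [GradedTensorProduct.tmul] at h ⊢
    rw [h]; simp

theorem odd_mul (x y : A P) (hy : par P y = -y) (T : (grading P) ᵍ⊗[ℂ] (grading P)) :
    (of ℂ (grading P) (grading P)).symm ((x ᵍ⊗ₜ[ℂ] y) * T)
      = TensorProduct.map (mulLeft ℂ x ∘ₗ (par P).toLinearMap) (mulLeft ℂ y)
        ((of ℂ (grading P) (grading P)).symm T) := by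
  obtain ⟨T, rfl⟩ := (of ℂ (grading P) (grading P)).surjective T
  induction T with
  | zero => simp
  | add S T hS hT => rw [map_add, mul_add, map_add, hS, hT, map_add, map_add]
  | tmul z w =>
    have h := gtmul_odd P x y z w hy
    simp only [GradedTensorProduct.tmul] at h ⊢
    rw [h]; simp

theorem comulLin_one : comulLin P 1 = 1 ⊗ₜ 1 := by
  simp [comulLin, Algebra.TensorProduct.one_def]

/-- Left multiplication by `Δ(g)` for a generator `g`, with the sign rule. -/
noncomputable def comulOp (g : AGen) : A P ⊗[ℂ] A P →ₗ[ℂ] A P ⊗[ℂ] A P :=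
  match g with
  | .a => TensorProduct.map (mulLeft ℂ (gen P .a)) (mulLeft ℂ (gen P .a))
      + TensorProduct.map (mulLeft ℂ (gen P .b) ∘ₗ (par P).toLinearMap) (mulLeft ℂ (gen P .c))
  | .b => TensorProduct.map (mulLeft ℂ (gen P .a) ∘ₗ (par P).toLinearMap) (mulLeft ℂ (gen P .b))
      + TensorProduct.map (mulLeft ℂ (gen P .b)) (mulLeft ℂ (gen P .d))
  | .c => TensorProduct.map (mulLeft ℂ (gen P .c)) (mulLeft ℂ (gen P .a))
      + TensorProduct.map (mulLeft ℂ (gen P .d) ∘ₗ (par P).toLinearMap) (mulLeft ℂ (gen P .c))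
  | .d => TensorProduct.map (mulLeft ℂ (gen P .c) ∘ₗ (par P).toLinearMap) (mulLeft ℂ (gen P .b))
      + TensorProduct.map (mulLeft ℂ (gen P .d)) (mulLeft ℂ (gen P .d))
  | .σ => TensorProduct.map (mulLeft ℂ (gen P .σ)) (mulLeft ℂ (gen P .σ))

theorem comulLin_gen_mul (g : AGen) (u : A P) :
    comulLin P (gen P g * u) = comulOp P g (comulLin P u) := by
  have hg : comulHom P (gen P g) = _ := liftA_gen P _ _ _ _ _ _ _ _ _ g
  simp only [comulLin, coe_comp, LinearEquiv.coe_coe, AlgHom.toLinearMap_apply,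
    Function.comp_apply, map_mul]
  rw [hg]
  cases g
  · simp only [comulOp, add_mul, map_add, LinearMap.add_apply]
    rw [even_mul P _ _ (par_a P), odd_mul P _ _ (par_c P)]
  · simp only [comulOp, add_mul, map_add, LinearMap.add_apply]
    rw [even_mul P _ _ (par_d P), odd_mul P _ _ (par_b P)]
  · simp only [comulOp, add_mul, map_add, LinearMap.add_apply]
    rw [even_mul P _ _ (par_a P), odd_mul P _ _ (par_c P)]
  · simp only [comulOp, add_mul, map_add, LinearMap.add_apply]
    rw [even_mul P _ _ (par_d P), odd_mul P _ _ (par_b P)]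
  · simp only [comulOp]
    rw [even_mul P _ _ (par_σ P)]

theorem comulOp_par (g : AGen) (T : A P ⊗[ℂ] A P) :
    TensorProduct.map (par P).toLinearMap (par P).toLinearMap (comulOp P g T)
      = (match g with | .b => -1 | .c => -1 | _ => 1 : ℂ) •
        comulOp P g (TensorProduct.map (par P).toLinearMap (par P).toLinearMap T) := by
  induction T with
  | zero => simp
  | add S T hS hT => simp only [map_add, hS, hT, smul_add]
  | tmul z w => cases g <;> simp [comulOp, neg_tmul, tmul_neg]

theorem comulLin_par (u : A P) : comulLin P (par P u)
    = TensorProduct.map (par P).toLinearMap (par P).toLinearMap (comulLin P u) := by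
  induction u using A_induction P with
  | one => simp [comulLin_one]
  | add u v hu hv => simp [hu, hv]
  | smul z u hu => simp [hu]
  | gen_mul g u hu =>
    rw [comulLin_gen_mul, comulOp_par, ← hu, ← comulLin_gen_mul, map_mul]
    cases g <;> simp

/-- The threefold analogue of `comulOp`, used for coassociativity. -/
noncomputable def comulOp₃ (g : AGen) :
    A P ⊗[ℂ] (A P ⊗[ℂ] A P) →ₗ[ℂ] A P ⊗[ℂ] (A P ⊗[ℂ] A P) :=
  match g with
  | .a => TensorProduct.map (mulLeft ℂ (gen P .a)) (comulOp P .a)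
      + TensorProduct.map (mulLeft ℂ (gen P .b) ∘ₗ (par P).toLinearMap) (comulOp P .c)
  | .b => TensorProduct.map (mulLeft ℂ (gen P .a) ∘ₗ (par P).toLinearMap) (comulOp P .b)
      + TensorProduct.map (mulLeft ℂ (gen P .b)) (comulOp P .d)
  | .c => TensorProduct.map (mulLeft ℂ (gen P .c)) (comulOp P .a)
      + TensorProduct.map (mulLeft ℂ (gen P .d) ∘ₗ (par P).toLinearMap) (comulOp P .c)
  | .d => TensorProduct.map (mulLeft ℂ (gen P .c) ∘ₗ (par P).toLinearMap) (comulOp P .b)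
      + TensorProduct.map (mulLeft ℂ (gen P .d)) (comulOp P .d)
  | .σ => TensorProduct.map (mulLeft ℂ (gen P .σ)) (comulOp P .σ)

theorem lTensor_comulOp (g : AGen) (T : A P ⊗[ℂ] A P) :
    lTensor (A P) (comulLin P) (comulOp P g T)
      = comulOp₃ P g (lTensor (A P) (comulLin P) T) := by
  induction T with
  | zero => simp
  | add S T hS hT => simp only [map_add, hS, hT]
  | tmul z w => cases g <;> simp [comulOp₃, comulOp.eq_def P .a, comulOp.eq_def P .b,
      comulOp.eq_def P .c, comulOp.eq_def P .d, comulOp.eq_def P .σ, comulLin_gen_mul]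

theorem rTensor_comulOp (g : AGen) (T : A P ⊗[ℂ] A P) :
    TensorProduct.assoc ℂ _ _ _ (rTensor (A P) (comulLin P) (comulOp P g T))
      = comulOp₃ P g (TensorProduct.assoc ℂ _ _ _ (rTensor (A P) (comulLin P) T)) := by
  induction T with
  | zero => simp
  | add S T hS hT => simp only [map_add, hS, hT]
  | tmul z w =>
    cases g
    all_goals
      simp only [comulOp, LinearMap.add_apply, map_tmul, coe_comp, Function.comp_apply,
        mulLeft_apply, map_add, rTensor_tmul, AlgHom.toLinearMap_apply, comulLin_gen_mul,
        comulLin_par]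
      generalize comulLin P z = S
      induction S with
      | zero => simp
      | add S T hS hT =>
        simp only [map_add, add_tmul] at hS hT ⊢
        rw [← hS, ← hT]
        try abel
      | tmul x y => simp [comulOp₃, comulOp, add_tmul, tmul_add] <;> abel

noncomputable instance : Coalgebra ℂ (A P) where
  comul := comulLin P
  counit := (counitHom P).toLinearMap
  coassoc := by
    ext u
    simp only [coe_comp, Function.comp_apply, LinearEquiv.coe_coe]
    induction u using A_induction P with
    | one => simp [comulLin_one]
    | add u v hu hv => simp only [map_add, hu, hv]
    | smul z u hu => simp only [map_smul, hu]
    | gen_mul g u hu =>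
      rw [comulLin_gen_mul, rTensor_comulOp, hu, lTensor_comulOp]
  rTensor_counit_comp_comul := by
    ext u
    have key : ∀ g, ∀ T : A P ⊗[ℂ] A P, rTensor (A P) (counitHom P).toLinearMap (comulOp P g T)
        = lTensor ℂ (mulLeft ℂ (gen P g)) (rTensor (A P) (counitHom P).toLinearMap T) := by
      intro g T
      induction T with
      | zero => simp
      | add S T hS hT => simp only [map_add, hS, hT]
      | tmul z w => cases g <;> simp [comulOp]
    simp only [coe_comp, Function.comp_apply]
    induction u using A_induction P with
    | one => simp [comulLin_one]
    | add u v hu hv => simp only [map_add, hu, hv]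
    | smul z u hu => simp only [map_smul, hu]
    | gen_mul g u hu => rw [comulLin_gen_mul, key, hu]; simp
  lTensor_counit_comp_comul := by
    ext u
    have key : ∀ g, ∀ T : A P ⊗[ℂ] A P, lTensor (A P) (counitHom P).toLinearMap (comulOp P g T)
        = rTensor ℂ (mulLeft ℂ (gen P g)) (lTensor (A P) (counitHom P).toLinearMap T) := by
      intro g T
      induction T with
      | zero => simp
      | add S T hS hT => simp only [map_add, hS, hT]
      | tmul z w => cases g <;> simp [comulOp]
    simp only [coe_comp, Function.comp_apply, LinearMap.flip_apply]
    induction u using A_induction P with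
    | one => simp [comulLin_one]
    | add u v hu hv => simp only [map_add, hu, hv, LinearMap.add_apply]
    | smul z u hu => simp only [map_smul, hu, LinearMap.smul_apply]
    | gen_mul g u hu => rw [comulLin_gen_mul, key, hu]; simp

end coalgebra

/-- Generators of the quantized enveloping algebra `𝒰 = U_q(osp(1,2))`. -/
inductive UGen
  | e | f | k | kinv

/-- Defining relations of `𝒰`. -/
inductive URel (P : QParam) : FreeAlgebra ℂ UGen → FreeAlgebra ℂ UGen → Prop
  | k_kinv : URel P (FreeAlgebra.ι ℂ UGen.k * FreeAlgebra.ι ℂ UGen.kinv) 1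
  | kinv_k : URel P (FreeAlgebra.ι ℂ UGen.kinv * FreeAlgebra.ι ℂ UGen.k) 1
  | kek : URel P (FreeAlgebra.ι ℂ UGen.k * FreeAlgebra.ι ℂ UGen.e * FreeAlgebra.ι ℂ UGen.kinv)
      (P.q • FreeAlgebra.ι ℂ UGen.e)
  | kfk : URel P (FreeAlgebra.ι ℂ UGen.k * FreeAlgebra.ι ℂ UGen.f * FreeAlgebra.ι ℂ UGen.kinv)
      (P.q⁻¹ • FreeAlgebra.ι ℂ UGen.f)
  | ef : URel P (FreeAlgebra.ι ℂ UGen.e * FreeAlgebra.ι ℂ UGen.f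
        + FreeAlgebra.ι ℂ UGen.f * FreeAlgebra.ι ℂ UGen.e)
      ((P.q - P.q⁻¹)⁻¹ • (FreeAlgebra.ι ℂ UGen.k - FreeAlgebra.ι ℂ UGen.kinv))

/-- The algebra `𝒰 = U_q(osp(1,2))`, by generators and relations. -/
def U (P : QParam) : Type := RingQuot (URel P)

noncomputable instance (P : QParam) : Ring (U P) := inferInstanceAs (Ring (RingQuot (URel P)))

noncomputable instance (P : QParam) : Algebra ℂ (U P) :=
  inferInstanceAs (Algebra ℂ (RingQuot (URel P)))

/-- The class in `𝒰` of a generator. -/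
noncomputable def ugen (P : QParam) (g : UGen) : U P :=
  RingQuot.mkAlgHom ℂ (URel P) (FreeAlgebra.ι ℂ g)

/-- Universal property of `𝒰`. -/
noncomputable def liftU (P : QParam) {B : Type} [Ring B] [Algebra ℂ B] (φ : UGen → B)
    (h1 : φ .k * φ .kinv = 1) (h2 : φ .kinv * φ .k = 1)
    (h3 : φ .k * φ .e * φ .kinv = P.q • φ .e)
    (h4 : φ .k * φ .f * φ .kinv = P.q⁻¹ • φ .f)
    (h5 : φ .e * φ .f + φ .f * φ .e = (P.q - P.q⁻¹)⁻¹ • (φ .k - φ .kinv)) : U P →ₐ[ℂ] B :=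
  RingQuot.liftAlgHom ℂ ⟨FreeAlgebra.lift ℂ φ, by
    intro x y h
    cases h
    · simpa using h1
    · simpa using h2
    · simpa using h3
    · simpa using h4
    · rw [map_add, map_smul, map_mul, map_mul, map_sub]
      simpa only [FreeAlgebra.lift_ι_apply] using h5⟩

theorem liftU_ugen (P : QParam) {B : Type} [Ring B] [Algebra ℂ B] (φ : UGen → B)
    (h1 h2 h3 h4 h5) (g : UGen) : liftU P φ h1 h2 h3 h4 h5 (ugen P g) = φ g := by
  unfold liftU ugen
  erw [RingQuot.liftAlgHom_mkAlgHom_apply]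
  simp

/-- The counit `ε` of `𝒰`: `ε(k^{±1}) = 1`, `ε(e) = ε(f) = 0`. -/
noncomputable def counitU (P : QParam) : U P →ₐ[ℂ] ℂ :=
  liftU P (fun g => match g with
      | .e => 0
      | .f => 0
      | .k => 1
      | .kinv => 1)
    (by simp) (by simp) (by simp) (by simp) (by simp)

section functionals
variable (P : QParam)

open LinearMap

/-- `k` as a function on `𝒜` (an algebra map). -/
noncomputable def kHom : A P →ₐ[ℂ] ℂ :=
  liftA P (fun g => match g with
      | .a => P.t
      | .b => 0
      | .c => 0
      | .d => -P.t⁻¹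
      | .σ => -1)
    (by simp) (by simp) (by simp) (by simp) (by simp) (by simp [mul_comm])
    (by simp [P.t_ne_zero]) (by simp)

/-- `k⁻¹` as a function on `𝒜` (an algebra map). -/
noncomputable def kinvHom : A P →ₐ[ℂ] ℂ :=
  liftA P (fun g => match g with
      | .a => P.t⁻¹
      | .b => 0
      | .c => 0
      | .d => -P.t
      | .σ => -1)
    (by simp) (by simp) (by simp) (by simp) (by simp) (by simp [mul_comm])
    (by simp [P.t_ne_zero]) (by simp)

/-- The value `e(b) = (t - t⁻¹)/(q - q⁻¹)`. -/
noncomputable def eb : ℂ := (P.t - P.t⁻¹) / (P.q - P.q⁻¹)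

/-- The matrix representation `u ↦ (k(u), e(u); 0, ε(u))` of `𝒜` that encodes the rule
`e(xy) = e(x) ε(y) + k(x) e(y)`. -/
noncomputable def eMat : A P →ₐ[ℂ] Matrix (Fin 2) (Fin 2) ℂ :=
  liftA P (fun g => match g with
      | .a => !![P.t, 0; 0, 1]
      | .b => !![0, eb P; 0, 0]
      | .c => !![0, 0; 0, 0]
      | .d => !![-P.t⁻¹, 0; 0, 1]
      | .σ => !![-1, 0; 0, 1])
    (by ext i j; fin_cases i <;> fin_cases j <;> simp)
    (by ext i j; fin_cases i <;> fin_cases j <;> simp)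
    (by ext i j; fin_cases i <;> fin_cases j <;> simp)
    (by ext i j; fin_cases i <;> fin_cases j <;> simp [P.t_ne_zero])
    (by ext i j; fin_cases i <;> fin_cases j <;> simp)
    (by ext i j; fin_cases i <;> fin_cases j <;> simp [mul_comm])
    (by ext i j; fin_cases i <;> fin_cases j <;> simp [P.t_ne_zero])
    (by ext i j; fin_cases i <;> fin_cases j <;> simp)

/-- The matrix representation `u ↦ (ε(u), f(u); 0, k⁻¹(u))` of `𝒜` that encodes the rule
`f(xy) = f(x) k⁻¹(y) + ε(x) f(y)`. -/
noncomputable def fMat : A P →ₐ[ℂ] Matrix (Fin 2) (Fin 2) ℂ :=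
  liftA P (fun g => match g with
      | .a => !![1, 0; 0, P.t⁻¹]
      | .b => !![0, 0; 0, 0]
      | .c => !![0, 1; 0, 0]
      | .d => !![1, 0; 0, -P.t]
      | .σ => !![1, 0; 0, -1])
    (by ext i j; fin_cases i <;> fin_cases j <;> simp)
    (by ext i j; fin_cases i <;> fin_cases j <;> simp [P.t_ne_zero])
    (by ext i j; fin_cases i <;> fin_cases j <;> simp)
    (by ext i j; fin_cases i <;> fin_cases j <;> simp)
    (by ext i j; fin_cases i <;> fin_cases j <;> simp)
    (by ext i j; fin_cases i <;> fin_cases j <;> simp [mul_comm])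
    (by ext i j; fin_cases i <;> fin_cases j <;> simp [P.t_ne_zero])
    (by ext i j; fin_cases i <;> fin_cases j <;> simp)

/-- `e` as a function on `𝒜`. -/
noncomputable def eFun : A P →ₗ[ℂ] ℂ :=
  Matrix.entryLinearMap ℂ ℂ (0 : Fin 2) (1 : Fin 2) ∘ₗ (eMat P).toLinearMap

/-- `f` as a function on `𝒜`. -/
noncomputable def fFun : A P →ₗ[ℂ] ℂ :=
  Matrix.entryLinearMap ℂ ℂ (0 : Fin 2) (1 : Fin 2) ∘ₗ (fMat P).toLinearMap

@[simp] theorem kHom_a : kHom P (gen P .a) = P.t := liftA_gen ..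
@[simp] theorem kHom_b : kHom P (gen P .b) = 0 := liftA_gen ..
@[simp] theorem kHom_c : kHom P (gen P .c) = 0 := liftA_gen ..
@[simp] theorem kHom_d : kHom P (gen P .d) = -P.t⁻¹ := liftA_gen ..
@[simp] theorem kHom_σ : kHom P (gen P .σ) = -1 := liftA_gen ..
@[simp] theorem kinvHom_a : kinvHom P (gen P .a) = P.t⁻¹ := liftA_gen ..
@[simp] theorem kinvHom_b : kinvHom P (gen P .b) = 0 := liftA_gen ..
@[simp] theorem kinvHom_c : kinvHom P (gen P .c) = 0 := liftA_gen ..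
@[simp] theorem kinvHom_d : kinvHom P (gen P .d) = -P.t := liftA_gen ..
@[simp] theorem kinvHom_σ : kinvHom P (gen P .σ) = -1 := liftA_gen ..

theorem eMat_eq (u : A P) :
    eMat P u = !![kHom P u, eFun P u; 0, counitHom P u] := by
  have h : eMat P u 0 0 = kHom P u ∧ eMat P u 1 0 = 0 ∧ eMat P u 1 1 = counitHom P u := by
    induction u using A_induction P with
    | one => simp
    | add u v hu hv => simp [hu, hv]
    | smul z u hu => simp [hu]
    | gen_mul g u hu =>
      have hg : eMat P (gen P g) = _ := liftA_gen P _ _ _ _ _ _ _ _ _ g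
      rw [map_mul, hg]
      cases g <;> simp [hu, Matrix.mul_apply]
  ext i j
  fin_cases i <;> fin_cases j <;> simp [h, eFun]

theorem fMat_eq (u : A P) :
    fMat P u = !![counitHom P u, fFun P u; 0, kinvHom P u] := by
  have h : fMat P u 0 0 = counitHom P u ∧ fMat P u 1 0 = 0 ∧ fMat P u 1 1 = kinvHom P u := by
    induction u using A_induction P with
    | one => simp
    | add u v hu hv => simp [hu, hv]
    | smul z u hu => simp [hu]
    | gen_mul g u hu =>
      have hg : fMat P (gen P g) = _ := liftA_gen P _ _ _ _ _ _ _ _ _ g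
      rw [map_mul, hg]
      cases g <;> simp [hu, Matrix.mul_apply]
  ext i j
  fin_cases i <;> fin_cases j <;> simp [h, fFun]

theorem eFun_mul (x y : A P) :
    eFun P (x * y) = eFun P x * counitHom P y + kHom P x * eFun P y := by
  have h := eMat_eq P (x * y)
  rw [map_mul, eMat_eq, eMat_eq] at h
  have h' := congrFun (congrFun h 0) 1
  simp [Matrix.mul_apply] at h'
  rw [← h', add_comm]

theorem fFun_mul (x y : A P) :
    fFun P (x * y) = fFun P x * kinvHom P y + counitHom P x * fFun P y := by
  have h := fMat_eq P (x * y)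
  rw [map_mul, fMat_eq, fMat_eq] at h
  have h' := congrFun (congrFun h 0) 1
  simp [Matrix.mul_apply] at h'
  rw [← h', add_comm]

theorem eFun_gen (g : AGen) : eFun P (gen P g) = match g with | .b => eb P | _ => 0 := by
  have hg : eMat P (gen P g) = _ := liftA_gen P _ _ _ _ _ _ _ _ _ g
  simp only [eFun, coe_comp, AlgHom.toLinearMap_apply, Function.comp_apply, hg]
  cases g <;> simp

theorem fFun_gen (g : AGen) : fFun P (gen P g) = match g with | .c => 1 | _ => 0 := by
  have hg : fMat P (gen P g) = _ := liftA_gen P _ _ _ _ _ _ _ _ _ g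
  simp only [fFun, coe_comp, AlgHom.toLinearMap_apply, Function.comp_apply, hg]
  cases g <;> simp

theorem eFun_one : eFun P 1 = 0 := by simp [eFun]

theorem fFun_one : fFun P 1 = 0 := by simp [fFun]

theorem kHom_par (u : A P) : kHom P (par P u) = kHom P u := by
  induction u using A_induction P with
  | one => simp
  | add u v hu hv => simp [hu, hv]
  | smul z u hu => simp [hu]
  | gen_mul g u hu => cases g <;> simp [hu]

theorem kinvHom_par (u : A P) : kinvHom P (par P u) = kinvHom P u := by
  induction u using A_induction P with
  | one => simp
  | add u v hu hv => simp [hu, hv]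
  | smul z u hu => simp [hu]
  | gen_mul g u hu => cases g <;> simp [hu]

theorem eFun_par (u : A P) : eFun P (par P u) = -eFun P u := by
  induction u using A_induction P with
  | one => simp [eFun_one]
  | add u v hu hv => rw [map_add, map_add, hu, hv, map_add, neg_add]
  | smul z u hu => simp [hu]
  | gen_mul g u hu => cases g <;> simp [hu, eFun_mul, eFun_gen]

theorem fFun_par (u : A P) : fFun P (par P u) = -fFun P u := by
  induction u using A_induction P with
  | one => simp [fFun_one]
  | add u v hu hv => rw [map_add, map_add, hu, hv, map_add, neg_add]
  | smul z u hu => simp [hu]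
  | gen_mul g u hu => cases g <;> simp [hu, fFun_mul, fFun_gen, kinvHom_par]

end functionals

section pairing
variable (P : QParam)

open LinearMap WithConv

/-- `(φ * ψ)(u) = ∑ φ(u₁) ψ(u₂)`, in the expanded form. -/
noncomputable def conv (φ ψ : A P →ₗ[ℂ] ℂ) : A P →ₗ[ℂ] ℂ :=
  mul' ℂ ℂ ∘ₗ TensorProduct.map φ ψ ∘ₗ comulLin P

theorem toConv_mul (φ ψ : A P →ₗ[ℂ] ℂ) : toConv φ * toConv ψ = toConv (conv P φ ψ) := rfl

/-- `φ` composed with left multiplication by a generator. -/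
noncomputable def pre (φ : A P →ₗ[ℂ] ℂ) (g : AGen) : A P →ₗ[ℂ] ℂ := φ ∘ₗ mulLeft ℂ (gen P g)

/-- `φ` composed with left multiplication by a generator and the parity map. -/
noncomputable def prePar (φ : A P →ₗ[ℂ] ℂ) (g : AGen) : A P →ₗ[ℂ] ℂ :=
  φ ∘ₗ mulLeft ℂ (gen P g) ∘ₗ (par P).toLinearMap

theorem conv_gen_mul (φ ψ : A P →ₗ[ℂ] ℂ) (g : AGen) (u : A P) :
    conv P φ ψ (gen P g * u) = match g with
      | .a => conv P (pre P φ .a) (pre P ψ .a) u + conv P (prePar P φ .b) (pre P ψ .c) u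
      | .b => conv P (prePar P φ .a) (pre P ψ .b) u + conv P (pre P φ .b) (pre P ψ .d) u
      | .c => conv P (pre P φ .c) (pre P ψ .a) u + conv P (prePar P φ .d) (pre P ψ .c) u
      | .d => conv P (prePar P φ .c) (pre P ψ .b) u + conv P (pre P φ .d) (pre P ψ .d) u
      | .σ => conv P (pre P φ .σ) (pre P ψ .σ) u := by
  simp only [conv, coe_comp, Function.comp_apply, comulLin_gen_mul]
  generalize comulLin P u = T
  induction T with
  | zero => cases g <;> simp
  | add S T hS hT =>
    simp only [map_add, hS, hT]
    cases g <;> simp only <;> abel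
  | tmul z w => cases g <;> simp [comulOp, pre, prePar]

theorem conv_one (φ ψ : A P →ₗ[ℂ] ℂ) : conv P φ ψ 1 = φ 1 * ψ 1 := by
  simp [conv, comulLin_one]

@[simp] theorem conv_smul_left (z : ℂ) (φ ψ : A P →ₗ[ℂ] ℂ) :
    conv P (z • φ) ψ = z • conv P φ ψ := by
  simp [conv, TensorProduct.map_smul_left, LinearMap.comp_smul, LinearMap.smul_comp]
@[simp] theorem conv_smul_right (z : ℂ) (φ ψ : A P →ₗ[ℂ] ℂ) :
    conv P φ (z • ψ) = z • conv P φ ψ := by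
  simp [conv, TensorProduct.map_smul_right, LinearMap.comp_smul, LinearMap.smul_comp]
@[simp] theorem conv_zero_left (ψ : A P →ₗ[ℂ] ℂ) : conv P 0 ψ = 0 := by
  simp [conv]
@[simp] theorem conv_zero_right (φ : A P →ₗ[ℂ] ℂ) : conv P φ 0 = 0 := by
  simp [conv]

@[simp] theorem conv_neg_left (φ ψ : A P →ₗ[ℂ] ℂ) : conv P (-φ) ψ = -conv P φ ψ := by
  rw [← neg_one_smul ℂ φ, conv_smul_left, neg_one_smul]
@[simp] theorem conv_neg_right (φ ψ : A P →ₗ[ℂ] ℂ) : conv P φ (-ψ) = -conv P φ ψ := by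
  rw [← neg_one_smul ℂ ψ, conv_smul_right, neg_one_smul]

theorem conv_counit_left (ψ : A P →ₗ[ℂ] ℂ) : conv P (counitHom P).toLinearMap ψ = ψ := by
  have h : (1 : WithConv (A P →ₗ[ℂ] ℂ)) * toConv ψ = toConv ψ := one_mul _
  exact congrArg ofConv h
theorem conv_counit_right (φ : A P →ₗ[ℂ] ℂ) : conv P φ (counitHom P).toLinearMap = φ := by
  have h : toConv φ * (1 : WithConv (A P →ₗ[ℂ] ℂ)) = toConv φ := mul_one _
  exact congrArg ofConv h

theorem pre_ε (g : AGen) : pre P (counitHom P).toLinearMap g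
    = (match g with | .a => 1 | .b => 0 | .c => 0 | .d => 1 | .σ => 1 : ℂ) •
      (counitHom P).toLinearMap := by
  ext u; cases g <;> simp [pre]
theorem prePar_ε (g : AGen) : prePar P (counitHom P).toLinearMap g
    = (match g with | .a => 1 | .b => 0 | .c => 0 | .d => 1 | .σ => 1 : ℂ) •
      (counitHom P).toLinearMap := by
  ext u; cases g <;> simp [prePar]
theorem pre_k (g : AGen) : pre P (kHom P).toLinearMap g
    = (match g with | .a => P.t | .b => 0 | .c => 0 | .d => -P.t⁻¹ | .σ => -1 : ℂ) •
      (kHom P).toLinearMap := by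
  ext u; cases g <;> simp [pre]
theorem prePar_k (g : AGen) : prePar P (kHom P).toLinearMap g
    = (match g with | .a => P.t | .b => 0 | .c => 0 | .d => -P.t⁻¹ | .σ => -1 : ℂ) •
      (kHom P).toLinearMap := by
  ext u; cases g <;> simp [prePar, kHom_par]
theorem pre_kinv (g : AGen) : pre P (kinvHom P).toLinearMap g
    = (match g with | .a => P.t⁻¹ | .b => 0 | .c => 0 | .d => -P.t | .σ => -1 : ℂ) •
      (kinvHom P).toLinearMap := by
  ext u; cases g <;> simp [pre]
theorem prePar_kinv (g : AGen) : prePar P (kinvHom P).toLinearMap g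
    = (match g with | .a => P.t⁻¹ | .b => 0 | .c => 0 | .d => -P.t | .σ => -1 : ℂ) •
      (kinvHom P).toLinearMap := by
  ext u; cases g <;> simp [prePar, kinvHom_par]
theorem pre_e (g : AGen) : pre P (eFun P) g = match g with
    | .a => P.t • eFun P
    | .b => eb P • (counitHom P).toLinearMap
    | .c => 0
    | .d => (-P.t⁻¹) • eFun P
    | .σ => (-1 : ℂ) • eFun P := by
  ext u; cases g <;> simp [pre, eFun_mul, eFun_gen]
theorem prePar_e (g : AGen) : prePar P (eFun P) g = match g with
    | .a => (-P.t) • eFun P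
    | .b => eb P • (counitHom P).toLinearMap
    | .c => 0
    | .d => P.t⁻¹ • eFun P
    | .σ => (1 : ℂ) • eFun P := by
  ext u; cases g <;> simp [prePar, eFun_mul, eFun_gen, eFun_par]
theorem pre_f (g : AGen) : pre P (fFun P) g = match g with
    | .a => (1 : ℂ) • fFun P
    | .b => 0
    | .c => (kinvHom P).toLinearMap
    | .d => (1 : ℂ) • fFun P
    | .σ => (1 : ℂ) • fFun P := by
  ext u; cases g <;> simp [pre, fFun_mul, fFun_gen]
theorem prePar_f (g : AGen) : prePar P (fFun P) g = match g with
    | .a => (-1 : ℂ) • fFun P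
    | .b => 0
    | .c => (kinvHom P).toLinearMap
    | .d => (-1 : ℂ) • fFun P
    | .σ => (-1 : ℂ) • fFun P := by
  ext u; cases g <;> simp [prePar, fFun_mul, fFun_gen, fFun_par, kinvHom_par]

theorem conv_k_kinv : conv P (kHom P).toLinearMap (kinvHom P).toLinearMap
    = (counitHom P).toLinearMap := by
  ext u
  have ht := P.t_ne_zero
  induction u using A_induction P with
  | one => simp [conv_one]
  | add u v hu hv => simp only [map_add, hu, hv]
  | smul z u hu => simp only [map_smul, hu]
  | gen_mul g u hu =>
    rw [conv_gen_mul]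
    cases g <;> simp [pre_k, prePar_k, pre_kinv, hu, ht]

theorem conv_kinv_k : conv P (kinvHom P).toLinearMap (kHom P).toLinearMap
    = (counitHom P).toLinearMap := by
  ext u
  have ht := P.t_ne_zero
  induction u using A_induction P with
  | one => simp [conv_one]
  | add u v hu hv => simp only [map_add, hu, hv]
  | smul z u hu => simp only [map_smul, hu]
  | gen_mul g u hu =>
    rw [conv_gen_mul]
    cases g <;> simp [pre_k, prePar_kinv, pre_kinv, hu, ht]

theorem conv_k_e : conv P (kHom P).toLinearMap (eFun P)
    = P.q • conv P (eFun P) (kHom P).toLinearMap := by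
  ext u
  have ht := P.t_ne_zero
  induction u using A_induction P with
  | one => simp [conv_one, eFun_one]
  | add u v hu hv => simp only [map_add, hu, hv]
  | smul z u hu => simp only [map_smul, hu]
  | gen_mul g u hu =>
    simp only [LinearMap.smul_apply, smul_eq_mul] at hu ⊢
    rw [conv_gen_mul, conv_gen_mul]
    cases g <;> simp [pre_k, prePar_k, pre_e, prePar_e, hu, conv_counit_left, conv_counit_right,
      P.q_eq] <;> field_simp

theorem conv_kinv_e : conv P (kinvHom P).toLinearMap (eFun P)
    = P.q⁻¹ • conv P (eFun P) (kinvHom P).toLinearMap := by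
  ext u
  have ht := P.t_ne_zero
  induction u using A_induction P with
  | one => simp [conv_one, eFun_one]
  | add u v hu hv => simp only [map_add, hu, hv]
  | smul z u hu => simp only [map_smul, hu]
  | gen_mul g u hu =>
    simp only [LinearMap.smul_apply, smul_eq_mul] at hu ⊢
    rw [conv_gen_mul, conv_gen_mul]
    cases g <;> simp [pre_kinv, prePar_kinv, pre_e, prePar_e, hu, conv_counit_left, conv_counit_right,
      P.q_eq] <;> field_simp

theorem conv_k_f : conv P (kHom P).toLinearMap (fFun P)
    = P.q⁻¹ • conv P (fFun P) (kHom P).toLinearMap := by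
  ext u
  have ht := P.t_ne_zero
  induction u using A_induction P with
  | one => simp [conv_one, fFun_one]
  | add u v hu hv => simp only [map_add, hu, hv]
  | smul z u hu => simp only [map_smul, hu]
  | gen_mul g u hu =>
    simp only [LinearMap.smul_apply, smul_eq_mul] at hu ⊢
    rw [conv_gen_mul, conv_gen_mul]
    cases g <;> simp [pre_k, prePar_k, pre_f, prePar_f, hu, conv_k_kinv, conv_kinv_k,
      P.q_eq] <;> field_simp

theorem conv_e_f (u : A P) : conv P (eFun P) (fFun P) u + conv P (fFun P) (eFun P) u
    = (P.q - P.q⁻¹)⁻¹ * (kHom P u - kinvHom P u) := by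
  have ht := P.t_ne_zero
  induction u using A_induction P with
  | one => simp [conv_one, fFun_one]
  | add u v hu hv => simp only [map_add]; linear_combination hu + hv
  | smul z u hu => simp only [map_smul, smul_eq_mul]; linear_combination z * hu
  | gen_mul g u hu =>
    rw [conv_gen_mul, conv_gen_mul]
    have hb : eb P = (P.q - P.q⁻¹)⁻¹ * (P.t - P.t⁻¹) := by rw [eb]; ring
    cases g <;> simp [pre_e, prePar_e, pre_f, prePar_f, conv_counit_left, conv_counit_right]
    · rw [hb]; linear_combination P.t * hu
    · have h := congrArg (fun φ : A P →ₗ[ℂ] ℂ => φ u) (conv_kinv_e P)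
      simp only [LinearMap.smul_apply, smul_eq_mul] at h
      rw [h, P.q_eq]; field_simp; ring
    · rw [hb]; linear_combination (-P.t⁻¹) * hu
    · linear_combination (-1) * hu

end pairing

section actions
variable (P : QParam)

open LinearMap WithConv

/-- The dual pairing of `𝒰` and `𝒜`, as the algebra map from `𝒰` to the linear functions on `𝒜`
with the convolution product `(xy)(u) = ∑ x(u₁) y(u₂)`; it sends `k^{±1}`, `e`, `f` to the
functions with
`k^{±1}(a) = t^{±1}`, `k^{±1}(d) = -t^{∓1}`, `k^{±1}(σ) = -1`, `k^{±1}(b) = k^{±1}(c) = 0`,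
`e(b) = (t - t⁻¹)/(q - q⁻¹)`, `f(c) = 1` and zero on the other generators, where `k^{±1}` are
multiplicative, `e(xy) = e(x) ε(y) + k(x) e(y)` and `f(xy) = f(x) k⁻¹(y) + ε(x) f(y)`.
(The sign `(-1)^{p(x)}` in front of the second terms is `1` where it matters, since `k` and `ε`
vanish on odd elements.) -/
noncomputable def pairing : U P →ₐ[ℂ] WithConv (A P →ₗ[ℂ] ℂ) :=
  liftU P (fun g => match g with
      | .e => toConv (eFun P)
      | .f => toConv (fFun P)
      | .k => toConv (kHom P).toLinearMap
      | .kinv => toConv (kinvHom P).toLinearMap)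
    (by simp only [toConv_mul, conv_k_kinv]; rfl)
    (by simp only [toConv_mul, conv_kinv_k]; rfl)
    (by
      simp only
      have h : toConv (kHom P).toLinearMap * toConv (eFun P) = _ :=
        (toConv_mul P _ _).trans (congrArg toConv (conv_k_e P))
      rw [h, toConv_smul, smul_mul_assoc, ← toConv_mul, mul_assoc,
        toConv_mul P (kHom P).toLinearMap, conv_k_kinv]
      exact congrArg _ (mul_one _))
    (by
      simp only
      have h : toConv (kHom P).toLinearMap * toConv (fFun P) = _ :=
        (toConv_mul P _ _).trans (congrArg toConv (conv_k_f P))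
      rw [h, toConv_smul, smul_mul_assoc, ← toConv_mul, mul_assoc,
        toConv_mul P (kHom P).toLinearMap, conv_k_kinv]
      exact congrArg _ (mul_one _))
    (by
      simp only [toConv_mul]
      apply ofConv_injective
      ext u
      simpa using conv_e_f P u)

/-- The right action `R_x(u) = ∑ x(u₁) u₂` of `x ∈ 𝒰` on `𝒜`, where `Δ(u) = ∑ u₁ ⊗ u₂`. -/
noncomputable def rightAct (x : U P) : A P →ₗ[ℂ] A P :=
  (TensorProduct.lid ℂ (A P)).toLinearMap ∘ₗ rTensor (A P) (pairing P x).ofConv ∘ₗ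
    Coalgebra.comul

/-- The right invariants `{u ∈ 𝒜 | R_x(u) = ε(x) u}` of `x ∈ 𝒰`. -/
noncomputable def rightInvariants (x : U P) : Submodule ℂ (A P) :=
  LinearMap.ker (rightAct P x - counitU P x • LinearMap.id)

/-- `x_{αβγ} = α e + β f k + γ (k - 1)`. -/
noncomputable def xElem (α β γ : ℂ) : U P :=
  α • ugen P .e + β • (ugen P .f * ugen P .k) + γ • (ugen P .k - 1)

end actions

section bases
variable (P : QParam)

/-- `(u; v)_m = ∏_{k=0}^{m-1} (1 - u v^k)`. -/
noncomputable def qPoch (u v : ℂ) (m : ℕ) : ℂ := ∏ k ∈ Finset.range m, (1 - u * v ^ k)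

/-- The Gauss binomial coefficient `(m choose n)_v`. -/
noncomputable def gaussBinom (m n : ℕ) (v : ℂ) : ℂ :=
  qPoch v v m / (qPoch v v n * qPoch v v (m - n))

/-- The index set `I_ℓ = {-ℓ, …, ℓ}`. -/
noncomputable def idx (ℓ : ℕ) : Finset ℤ := Finset.Icc (-(ℓ : ℤ)) ℓ

/-- The normalising factor of `ξ^{(ℓ)}_i`, with `n = ℓ + i`. -/
noncomputable def xiNorm (ℓ n : ℕ) : ℂ :=
  Complex.I ^ (n / 2) * P.sqrt (gaussBinom (2 * ℓ) n (P.t ^ (-2 : ℤ)))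

/-- `ξ^{(ℓ)}_i = i^{⌊(ℓ+i)/2⌋} (2ℓ choose ℓ+i)_{t⁻²}^{1/2} a^{ℓ-i} c^{ℓ+i}` for `i ∈ I_ℓ`, and
zero for `i ∉ I_ℓ`. -/
noncomputable def xi (ℓ : ℕ) (i : ℤ) : A P :=
  if i ∈ idx ℓ then
    xiNorm P ℓ (ℓ + i).toNat • (gen P .a ^ (ℓ - i).toNat * gen P .c ^ (ℓ + i).toNat)
  else 0

theorem t_zpow_pow_ne (k : ℕ) (hk : 0 < k) : (P.t ^ (-2 : ℤ)) ^ k ≠ 1 := by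
  intro h
  apply P.q_not_root (2 * k) (by omega)
  have h1 : P.t ^ (-2 : ℤ) = (-P.q)⁻¹ := by
    rw [← P.t_sq, zpow_neg]; rfl
  rw [h1, inv_pow, inv_eq_one] at h
  rw [mul_comm, pow_mul]
  have h2 : ((-P.q) ^ k) ^ 2 = 1 := by rw [h, one_pow]
  rw [← pow_mul, mul_comm, pow_mul, neg_sq, ← pow_mul, mul_comm, pow_mul] at h2
  exact h2

theorem qPoch_ne (m : ℕ) : qPoch (P.t ^ (-2 : ℤ)) (P.t ^ (-2 : ℤ)) m ≠ 0 := by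
  rw [qPoch, Finset.prod_ne_zero_iff]
  intro k _ h
  rw [sub_eq_zero, ← pow_succ'] at h
  exact t_zpow_pow_ne P (k + 1) (by omega) h.symm

theorem xiNorm_ne (ℓ n : ℕ) : xiNorm P ℓ n ≠ 0 := by
  have h : gaussBinom (2 * ℓ) n (P.t ^ (-2 : ℤ)) ≠ 0 :=
    div_ne_zero (qPoch_ne P _) (mul_ne_zero (qPoch_ne P _) (qPoch_ne P _))
  refine mul_ne_zero (pow_ne_zero _ Complex.I_ne_zero) ?_
  intro h0
  apply h
  rw [← P.sqrt_sq (gaussBinom _ _ _), h0]; simp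

theorem c_mul_a_pow (k : ℕ) :
    gen P .c * gen P .a ^ k = (P.t⁻¹) ^ k • (gen P .a ^ k * gen P .c) := by
  induction k with
  | zero => simp
  | succ k ih =>
    rw [pow_succ, ← mul_assoc, ih, smul_mul_assoc, mul_assoc, gen_ca, mul_smul_comm, smul_smul,
      ← mul_assoc, pow_succ]

end bases

section matrixElements
variable (P : QParam)

open LinearMap

/-- Elements of `𝒜 ⊗ W_N`, where `W_N` is spanned by the `a^{N-j} c^j`, `0 ≤ j ≤ N`. -/
def HasForm (N : ℕ) (T : A P ⊗[ℂ] A P) : Prop :=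
  ∃ μ : ℕ → A P, T = ∑ j ∈ Finset.range (N + 1), μ j ⊗ₜ (gen P .a ^ (N - j) * gen P .c ^ j)

theorem HasForm.add {N : ℕ} {S T : A P ⊗[ℂ] A P} (hS : HasForm P N S) (hT : HasForm P N T) :
    HasForm P N (S + T) := by
  obtain ⟨μ, rfl⟩ := hS
  obtain ⟨ν, rfl⟩ := hT
  exact ⟨fun j => μ j + ν j, by simp only [TensorProduct.add_tmul, Finset.sum_add_distrib]⟩

theorem HasForm.map_a {N : ℕ} {T : A P ⊗[ℂ] A P} (X : A P →ₗ[ℂ] A P) (hT : HasForm P N T) :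
    HasForm P (N + 1) (TensorProduct.map X (mulLeft ℂ (gen P .a)) T) := by
  obtain ⟨μ, rfl⟩ := hT
  refine ⟨fun j => if j ≤ N then X (μ j) else 0, ?_⟩
  rw [Finset.sum_range_succ _ (N + 1)]
  simp only
  rw [if_neg (show ¬ N + 1 ≤ N by omega), TensorProduct.zero_tmul, add_zero, map_sum]
  refine Finset.sum_congr rfl fun j hj => ?_
  have hj' : j ≤ N := by have := Finset.mem_range.1 hj; omega
  rw [if_pos hj', TensorProduct.map_tmul, mulLeft_apply, ← mul_assoc, ← pow_succ',
    show N - j + 1 = N + 1 - j by omega]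

theorem HasForm.map_c {N : ℕ} {T : A P ⊗[ℂ] A P} (X : A P →ₗ[ℂ] A P) (hT : HasForm P N T) :
    HasForm P (N + 1) (TensorProduct.map X (mulLeft ℂ (gen P .c)) T) := by
  obtain ⟨μ, rfl⟩ := hT
  refine ⟨fun j => match j with | 0 => 0 | j + 1 => (P.t⁻¹) ^ (N - j) • X (μ j), ?_⟩
  rw [Finset.sum_range_succ' _ (N + 1), TensorProduct.zero_tmul, add_zero, map_sum]
  refine Finset.sum_congr rfl fun j hj => ?_
  rw [TensorProduct.map_tmul, mulLeft_apply, ← mul_assoc, c_mul_a_pow, smul_mul_assoc, mul_assoc,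
    ← pow_succ', TensorProduct.tmul_smul, TensorProduct.smul_tmul',
    show N + 1 - (j + 1) = N - j by omega]

theorem hasForm_comul (m n : ℕ) :
    HasForm P (m + n) (comulLin P (gen P .a ^ m * gen P .c ^ n)) := by
  induction m with
  | zero =>
    simp only [pow_zero, one_mul, zero_add]
    induction n with
    | zero => exact ⟨fun _ => 1, by simp [comulLin_one]⟩
    | succ n ih =>
      rw [pow_succ', comulLin_gen_mul]
      exact HasForm.add P (HasForm.map_a P _ ih) (HasForm.map_c P _ ih)
  | succ m ih =>
    rw [pow_succ', mul_assoc, comulLin_gen_mul, show m + 1 + n = m + n + 1 by omega]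
    exact HasForm.add P (HasForm.map_a P _ ih) (HasForm.map_c P _ ih)

/-- Existence of the matrix elements of the left subcomodule spanned by the `ξ^{(ℓ)}_i`. -/
theorem exists_matrixElement (ℓ : ℕ) (i : ℤ) :
    ∃ μ : ℤ → A P, Coalgebra.comul (R := ℂ) (xi P ℓ i) = ∑ j ∈ idx ℓ, μ j ⊗ₜ[ℂ] xi P ℓ j := by
  by_cases hi : i ∈ idx ℓ
  · have hi' := Finset.mem_Icc.1 hi
    obtain ⟨μ, hμ⟩ := hasForm_comul P (ℓ - i).toNat (ℓ + i).toNat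
    have hN : (ℓ - i).toNat + (ℓ + i).toNat = 2 * ℓ := by omega
    rw [hN] at hμ
    refine ⟨fun j => (xiNorm P ℓ (ℓ + i).toNat / xiNorm P ℓ (ℓ + j).toNat) • μ (ℓ + j).toNat, ?_⟩
    change comulLin P _ = _
    rw [xi, if_pos hi, map_smul, hμ, Finset.smul_sum]
    refine Finset.sum_bij' (fun n _ => (n : ℤ) - ℓ) (fun j _ => (ℓ + j).toNat) ?_ ?_ ?_ ?_ ?_
    · intro n hn
      have := Finset.mem_range.1 hn
      exact Finset.mem_Icc.2 (by omega)
    · intro j hj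
      have := Finset.mem_Icc.1 hj
      exact Finset.mem_range.2 (by omega)
    · intro n hn; simp
    · intro j hj
      have := Finset.mem_Icc.1 hj
      omega
    · intro n hn
      have hn' := Finset.mem_range.1 hn
      have h1 : ((ℓ : ℤ) + ((n : ℤ) - ℓ)).toNat = n := by omega
      have h2 : ((ℓ : ℤ) - ((n : ℤ) - ℓ)).toNat = 2 * ℓ - n := by omega
      have hmem : (n : ℤ) - ℓ ∈ idx ℓ := Finset.mem_Icc.2 (by omega)
      rw [xi, if_pos hmem, h1, h2, TensorProduct.tmul_smul, ← TensorProduct.smul_tmul', smul_smul,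
        h1, mul_div_cancel₀ _ (xiNorm_ne P ℓ n)]
  · refine ⟨fun _ => 0, ?_⟩
    rw [xi, if_neg hi]; simp

/-- The matrix elements `m^{(ℓ)}_{ij}`, determined for `i, j ∈ I_ℓ` by
`Δ(ξ^{(ℓ)}_i) = ∑_{j ∈ I_ℓ} m^{(ℓ)}_{ij} ⊗ ξ^{(ℓ)}_j`. -/
noncomputable def matrixElement (ℓ : ℕ) (i j : ℤ) : A P := (exists_matrixElement P ℓ i).choose j

end matrixElements

section coefficients
variable (P : QParam)

open LinearMap WithConv

/-- `∑ φ(u₁) u₂` for a linear function `φ` on `𝒜`. -/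
noncomputable def slice (φ : A P →ₗ[ℂ] ℂ) : A P →ₗ[ℂ] A P :=
  (TensorProduct.lid ℂ (A P)).toLinearMap ∘ₗ rTensor (A P) φ ∘ₗ comulLin P

theorem rightAct_eq (x : U P) : rightAct P x = slice P (pairing P x).ofConv := rfl

theorem slice_gen_mul (φ : A P →ₗ[ℂ] ℂ) (g : AGen) (u : A P) :
    slice P φ (gen P g * u) = match g with
      | .a => gen P .a * slice P (pre P φ .a) u + gen P .c * slice P (prePar P φ .b) u
      | .b => gen P .b * slice P (prePar P φ .a) u + gen P .d * slice P (pre P φ .b) u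
      | .c => gen P .a * slice P (pre P φ .c) u + gen P .c * slice P (prePar P φ .d) u
      | .d => gen P .b * slice P (prePar P φ .c) u + gen P .d * slice P (pre P φ .d) u
      | .σ => gen P .σ * slice P (pre P φ .σ) u := by
  simp only [slice, coe_comp, Function.comp_apply, comulLin_gen_mul]
  generalize comulLin P u = T
  induction T with
  | zero => cases g <;> simp
  | add S T hS hT =>
    simp only [map_add, hS, hT]
    cases g <;> simp only [mul_add] <;> abel
  | tmul z w => cases g <;> simp [comulOp, pre, prePar]

theorem slice_one (φ : A P →ₗ[ℂ] ℂ) : slice P φ 1 = φ 1 • 1 := by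
  simp [slice, comulLin_one]

@[simp] theorem slice_smul (z : ℂ) (φ : A P →ₗ[ℂ] ℂ) (u : A P) :
    slice P (z • φ) u = z • slice P φ u := by
  simp [slice, rTensor_smul]

@[simp] theorem slice_sub (φ ψ : A P →ₗ[ℂ] ℂ) (u : A P) :
    slice P (φ - ψ) u = slice P φ u - slice P ψ u := by
  simp [slice, rTensor_sub]

@[simp] theorem slice_zero (u : A P) : slice P 0 u = 0 := by
  simp [slice]

@[simp] theorem slice_counit (u : A P) : slice P (counitHom P).toLinearMap u = u := by
  have h := Coalgebra.rTensor_counit_comul (R := ℂ) u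
  change rTensor (A P) (counitHom P).toLinearMap (comulLin P u) = _ at h
  simp [slice, h]

theorem slice_sigma (φ : A P →ₗ[ℂ] ℂ) (s : ℕ) :
    slice P φ (gen P .σ ^ s) = φ (gen P .σ ^ s) • gen P .σ ^ s := by
  induction s generalizing φ with
  | zero => simp [slice_one]
  | succ s ih => rw [pow_succ', slice_gen_mul]; simp only [ih]; simp [pre]

theorem slice_k (m n s : ℕ) : ∃ z : ℂ, slice P (kHom P).toLinearMap
    (gen P .a ^ m * gen P .c ^ n * gen P .σ ^ s)
      = z • (gen P .a ^ m * gen P .c ^ n * gen P .σ ^ s) := by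
  induction m with
  | zero =>
    simp only [pow_zero, one_mul]
    induction n with
    | zero => exact ⟨_, by simpa using slice_sigma P _ s⟩
    | succ n ih =>
      obtain ⟨z, hz⟩ := ih
      exact ⟨-P.t⁻¹ * z, by
        rw [pow_succ', mul_assoc, slice_gen_mul]
        simp only [pre_k, prePar_k, slice_smul, hz, zero_smul, mul_zero, zero_add,
          mul_smul_comm, smul_smul, slice_zero]⟩
  | succ m ih =>
    obtain ⟨z, hz⟩ := ih
    exact ⟨P.t * z, by
      rw [pow_succ', mul_assoc, mul_assoc, slice_gen_mul, ← mul_assoc _ _ (gen P .σ ^ s)]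
      simp [pre_k, prePar_k, hz, smul_smul]⟩

theorem slice_e_zero (n s : ℕ) :
    slice P (eFun P) (gen P .c ^ n * gen P .σ ^ s) = 0 := by
  have hs : eFun P (gen P .σ ^ s) = 0 := by
    induction s with
    | zero => simp [eFun_one]
    | succ s ih => rw [pow_succ', eFun_mul, ih]; simp [eFun_gen]
  induction n with
  | zero => simp [slice_sigma, hs]
  | succ n ih =>
    rw [pow_succ', mul_assoc, slice_gen_mul]
    simp [pre_e, prePar_e, ih]

theorem slice_e (m n s : ℕ) : ∃ z : ℂ, slice P (eFun P)
    (gen P .a ^ (m + 1) * gen P .c ^ n * gen P .σ ^ s)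
      = z • (gen P .a ^ m * gen P .c ^ (n + 1) * gen P .σ ^ s) := by
  have hc : ∀ m : ℕ, gen P .c * (gen P .a ^ m * gen P .c ^ n * gen P .σ ^ s)
      = (P.t⁻¹) ^ m • (gen P .a ^ m * gen P .c ^ (n + 1) * gen P .σ ^ s) := by
    intro m
    rw [← mul_assoc, ← mul_assoc, c_mul_a_pow, pow_succ' _ n]
    simp only [smul_mul_assoc, mul_assoc]
  have hm : ∀ m : ℕ, gen P .a ^ (m + 1) * gen P .c ^ n * gen P .σ ^ s
      = gen P .a * (gen P .a ^ m * gen P .c ^ n * gen P .σ ^ s) := by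
    intro m; simp only [pow_succ', mul_assoc]
  induction m with
  | zero =>
    refine ⟨eb P, ?_⟩
    have h0 := hc 0
    rw [hm, slice_gen_mul]
    simp only [pow_zero, one_mul, one_smul] at h0 ⊢
    simp [pre_e, prePar_e, slice_e_zero, h0]
  | succ m ih =>
    obtain ⟨z, hz⟩ := ih
    refine ⟨P.t * z + eb P * (P.t⁻¹) ^ (m + 1), ?_⟩
    rw [hm, slice_gen_mul]
    simp only [pre_e, prePar_e, slice_smul, hz, slice_counit, mul_smul_comm, hc, add_smul,
      smul_smul]
    congr 2
    simp only [pow_succ', mul_assoc]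

/-- `f k` as a function on `𝒜`. -/
noncomputable def fkFun : A P →ₗ[ℂ] ℂ := conv P (fFun P) (kHom P).toLinearMap

theorem prePar_fk_d : prePar P (fkFun P) .d = P.t⁻¹ • fkFun P := by
  ext u
  have h : fkFun P (par P u) = -fkFun P u := by
    simp only [fkFun, conv, coe_comp, Function.comp_apply, comulLin_par]
    generalize comulLin P u = T
    induction T with
    | zero => simp
    | add S T hS hT => simp only [map_add, hS, hT, neg_add]
    | tmul z w => simp [fFun_par, kHom_par]
  simp only [prePar, coe_comp, Function.comp_apply, mulLeft_apply, AlgHom.toLinearMap_apply]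
  rw [fkFun, conv_gen_mul]
  simp only [pre_f, prePar_f, pre_k]
  rw [fkFun] at h
  simp [h]

theorem pre_fk_c : pre P (fkFun P) .c = P.t • (counitHom P).toLinearMap := by
  ext u
  simp only [pre, coe_comp, Function.comp_apply, mulLeft_apply]
  rw [fkFun, conv_gen_mul]
  simp [pre_f, prePar_f, pre_k, conv_kinv_k]

theorem pre_fk_a : pre P (fkFun P) .a = P.t • fkFun P := by
  ext u
  simp only [pre, coe_comp, Function.comp_apply, mulLeft_apply]
  rw [fkFun, conv_gen_mul]
  simp [pre_f, prePar_f, pre_k]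

theorem prePar_fk_b : prePar P (fkFun P) .b = 0 := by
  ext u
  simp only [prePar, coe_comp, Function.comp_apply, mulLeft_apply, AlgHom.toLinearMap_apply]
  rw [fkFun, conv_gen_mul]
  simp [pre_f, prePar_f, pre_k]

theorem fk_sigma (s : ℕ) : fkFun P (gen P .σ ^ s) = 0 := by
  induction s with
  | zero => simp [fkFun, conv_one, fFun_one]
  | succ s ih =>
    rw [fkFun] at ih ⊢
    rw [pow_succ', conv_gen_mul]
    simp [pre_f, pre_k, ih]

theorem slice_fk_zero (m s : ℕ) :
    slice P (fkFun P) (gen P .a ^ m * gen P .σ ^ s) = 0 := by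
  induction m with
  | zero => simp [slice_sigma, fk_sigma]
  | succ m ih =>
    rw [pow_succ', mul_assoc, slice_gen_mul]
    simp [pre_fk_a, prePar_fk_b, ih]

theorem slice_fk (m n s : ℕ) : ∃ z : ℂ, slice P (fkFun P)
    (gen P .a ^ m * gen P .c ^ (n + 1) * gen P .σ ^ s)
      = z • (gen P .a ^ (m + 1) * gen P .c ^ n * gen P .σ ^ s) := by
  induction m with
  | succ m ih =>
    obtain ⟨z, hz⟩ := ih
    refine ⟨P.t * z, ?_⟩
    rw [pow_succ' _ m, mul_assoc, mul_assoc, slice_gen_mul, ← mul_assoc _ _ (gen P .σ ^ s)]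
    simp only [pre_fk_a, prePar_fk_b, slice_smul, slice_zero, hz, mul_smul_comm, smul_smul,
      mul_zero, add_zero]
    simp only [pow_succ' _ (m + 1), mul_assoc]
  | zero =>
    simp only [pow_zero, one_mul, zero_add, pow_one]
    induction n with
    | zero =>
      refine ⟨P.t, ?_⟩
      have h0 := slice_fk_zero P 0 s
      rw [pow_zero, one_mul] at h0
      rw [zero_add, pow_one, slice_gen_mul]
      simp [pre_fk_c, prePar_fk_d, h0]
    | succ n ih =>
      obtain ⟨z, hz⟩ := ih
      refine ⟨P.t + P.t⁻¹ * z * P.t⁻¹, ?_⟩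
      rw [pow_succ' _ (n + 1), mul_assoc, slice_gen_mul]
      simp only [pre_fk_c, prePar_fk_d, slice_smul, slice_counit, hz, mul_smul_comm, add_smul]
      rw [mul_assoc (gen P .a), ← mul_assoc (gen P .c), gen_ca, smul_mul_assoc, smul_smul,
        smul_smul, mul_assoc (gen P .a), ← mul_assoc (gen P .c), ← pow_succ', ← mul_assoc]

theorem pairing_e : (pairing P (ugen P .e)).ofConv = eFun P := by
  rw [pairing, liftU_ugen]

theorem pairing_fk : (pairing P (ugen P .f * ugen P .k)).ofConv = fkFun P := by
  rw [map_mul, pairing, liftU_ugen, liftU_ugen]; rfl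

theorem pairing_k_sub : (pairing P (ugen P .k - 1)).ofConv
    = (kHom P).toLinearMap - (counitHom P).toLinearMap := by
  rw [map_sub, map_one, pairing, liftU_ugen]; rfl

theorem exists_aCoeff (ℓ s : ℕ) (i : ℤ) : ∃ z : ℂ,
    rightAct P (ugen P .k - 1) (xi P ℓ i * gen P .σ ^ s) = z • (xi P ℓ i * gen P .σ ^ s) := by
  by_cases hi : i ∈ idx ℓ
  · obtain ⟨z, hz⟩ := slice_k P (ℓ - i).toNat (ℓ + i).toNat s
    refine ⟨z - 1, ?_⟩
    rw [rightAct_eq, pairing_k_sub, xi, if_pos hi, smul_mul_assoc, map_smul, slice_sub, hz,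
      slice_counit, sub_smul, one_smul, smul_sub, smul_comm z]
  · exact ⟨0, by rw [xi, if_neg hi]; simp⟩

theorem exists_bCoeff (ℓ s : ℕ) (i : ℤ) : ∃ z : ℂ,
    rightAct P (ugen P .e) (xi P ℓ i * gen P .σ ^ s) = z • (xi P ℓ (i + 1) * gen P .σ ^ s) := by
  by_cases hi : i ∈ idx ℓ
  · have hi' := Finset.mem_Icc.1 hi
    rw [rightAct_eq, pairing_e]
    by_cases hi1 : i = ℓ
    · refine ⟨0, ?_⟩
      have h0 : ((ℓ : ℤ) - i).toNat = 0 := by omega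
      rw [xi, if_pos hi, smul_mul_assoc, map_smul, h0, pow_zero, one_mul, slice_e_zero, smul_zero,
        zero_smul]
    · have hi2 : i + 1 ∈ idx ℓ := Finset.mem_Icc.2 (by omega)
      obtain ⟨z, hz⟩ := slice_e P (ℓ - (i + 1)).toNat (ℓ + i).toNat s
      have h1 : ((ℓ : ℤ) - (i + 1)).toNat + 1 = (ℓ - i).toNat := by omega
      have h2 : ((ℓ : ℤ) + i).toNat + 1 = (ℓ + (i + 1)).toNat := by omega
      rw [h1, h2] at hz
      refine ⟨xiNorm P ℓ (ℓ + i).toNat * z / xiNorm P ℓ (ℓ + (i + 1)).toNat, ?_⟩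
      rw [xi, if_pos hi, xi, if_pos hi2, smul_mul_assoc, map_smul, hz, smul_smul, smul_mul_assoc,
        smul_smul, div_mul_cancel₀ _ (xiNorm_ne P _ _)]
  · exact ⟨0, by rw [xi, if_neg hi]; simp⟩

theorem exists_cCoeff (ℓ s : ℕ) (i : ℤ) : ∃ z : ℂ,
    rightAct P (ugen P .f * ugen P .k) (xi P ℓ i * gen P .σ ^ s)
      = z • (xi P ℓ (i - 1) * gen P .σ ^ s) := by
  by_cases hi : i ∈ idx ℓ
  · have hi' := Finset.mem_Icc.1 hi
    rw [rightAct_eq, pairing_fk]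
    by_cases hi1 : i = -ℓ
    · refine ⟨0, ?_⟩
      have h0 : ((ℓ : ℤ) + i).toNat = 0 := by omega
      rw [xi, if_pos hi, smul_mul_assoc, map_smul, h0, pow_zero, mul_one, slice_fk_zero, smul_zero,
        zero_smul]
    · have hi2 : i - 1 ∈ idx ℓ := Finset.mem_Icc.2 (by omega)
      obtain ⟨z, hz⟩ := slice_fk P (ℓ - i).toNat (ℓ + (i - 1)).toNat s
      have h1 : ((ℓ : ℤ) + (i - 1)).toNat + 1 = (ℓ + i).toNat := by omega
      have h2 : ((ℓ : ℤ) - i).toNat + 1 = (ℓ - (i - 1)).toNat := by omega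
      rw [h1, h2] at hz
      refine ⟨xiNorm P ℓ (ℓ + i).toNat * z / xiNorm P ℓ (ℓ + (i - 1)).toNat, ?_⟩
      rw [xi, if_pos hi, xi, if_pos hi2, smul_mul_assoc, map_smul, hz, smul_smul, smul_mul_assoc,
        smul_smul, div_mul_cancel₀ _ (xiNorm_ne P _ _)]
  · exact ⟨0, by rw [xi, if_neg hi]; simp⟩

/-- `a_i`, defined by `R_{k-1}(ξ^{(ℓ)}_i σ^s) = a_i ξ^{(ℓ)}_i σ^s`, for `i ∈ I_ℓ`. -/
noncomputable def aCoeff (ℓ s : ℕ) (i : ℤ) : ℂ := (exists_aCoeff P ℓ s i).choose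

/-- `b_i`, defined by `R_e(ξ^{(ℓ)}_i σ^s) = b_i ξ^{(ℓ)}_{i+1} σ^s`, for `-ℓ ≤ i < ℓ`. -/
noncomputable def bCoeff (ℓ s : ℕ) (i : ℤ) : ℂ := (exists_bCoeff P ℓ s i).choose

/-- `c_i`, defined by `R_{fk}(ξ^{(ℓ)}_i σ^s) = c_i ξ^{(ℓ)}_{i-1} σ^s`, for `-ℓ < i ≤ ℓ`. -/
noncomputable def cCoeff (ℓ s : ℕ) (i : ℤ) : ℂ := (exists_cCoeff P ℓ s i).choose

/-- The coefficients `x_i` for `x_{αβ}`: zero if `ℓ + i` is odd, and for `i = -ℓ + 2k`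
`x_i = (-α β⁻¹)^k (∏_{j=0}^{k-1} b_{-ℓ+2j}) / (∏_{j=1}^{k} c_{-ℓ+2j})`; so `x_{-ℓ} = 1`. -/
noncomputable def coeffAB (α β : ℂ) (ℓ s : ℕ) (i : ℤ) : ℂ :=
  if Even ((ℓ : ℤ) + i) then
    (-(α * β⁻¹)) ^ ((ℓ + i).toNat / 2)
      * ((∏ j ∈ Finset.range ((ℓ + i).toNat / 2), bCoeff P ℓ s (-ℓ + 2 * j))
        / ∏ j ∈ Finset.Icc 1 ((ℓ + i).toNat / 2), cCoeff P ℓ s (-ℓ + 2 * j))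
  else 0

/-- The coefficients `x_i` for `x_{βγ}`: `x_0 = 1`, `x_i = 0` for `i > 0`, and for `i < 0`
`x_i = (-β γ⁻¹)^{-i} (∏_{j=i+1}^{0} c_j) / (∏_{j=i}^{-1} a_j)`. -/
noncomputable def coeffBG (β γ : ℂ) (ℓ s : ℕ) (i : ℤ) : ℂ :=
  if i = 0 then 1
  else if 0 < i then 0
  else (-(β * γ⁻¹)) ^ (-i).toNat
    * ((∏ j ∈ Finset.Icc (i + 1) 0, cCoeff P ℓ s j)
      / ∏ j ∈ Finset.Icc i (-1), aCoeff P ℓ s j)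

/-- The coefficients `x_i` for `x_{αγ}`: `x_i = 0` for `i < 0`, `x_0 = 1`, and for `i > 0`
`x_i = (-α γ⁻¹)^i (∏_{j=0}^{i-1} b_j) / (∏_{j=1}^{i} a_j)`. -/
noncomputable def coeffAG (α γ : ℂ) (ℓ s : ℕ) (i : ℤ) : ℂ :=
  if i < 0 then 0
  else if i = 0 then 1
  else (-(α * γ⁻¹)) ^ i.toNat
    * ((∏ j ∈ Finset.Icc 0 (i - 1), bCoeff P ℓ s j)
      / ∏ j ∈ Finset.Icc 1 i, aCoeff P ℓ s j)

/-- `∑_{i ∈ I_ℓ} x_i m^{(ℓ)}_{ij} σ^s`. -/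
noncomputable def invElem (x : ℤ → ℂ) (ℓ s : ℕ) (j : ℤ) : A P :=
  ∑ i ∈ idx ℓ, x i • (matrixElement P ℓ i j * gen P .σ ^ s)

end coefficients

end QOsp

/-!
The right action of `e`, `fk`, `k` on `𝒜` preserves, for each degree `N` and each `s`, the span of
the `N + 1` vectors `a^{N-n} c^n σ^s`. On these vectors `e` moves one step up and `fk` one step
down, with coefficients that are nonzero because `q` is not a root of unity, and `k` is diagonal
(`QOsp.isLadder_rung`). Hence these spans are simple modules (`IsLadder.isSimpleModule`), and
`α e + β fk + γ (k - 1)` acts on them by a tridiagonal matrix, whose kernel is found by solving a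
two-term recurrence. For `N = 2ℓ` the kernel is the line through `∑ x_i ξ^{(ℓ)}_i σ^s`, subject to
`ℓ + s` even if `γ ≠ 0`, and for odd `N` it vanishes.

To pass from these modules to all of `𝒜`, one uses the maps `u ↦ ∑ u₁ φ(u₂)` for linear functions
`φ` on `𝒜` (`QOsp.coslice`). By coassociativity they commute with the right action, and they send
`ξ^{(ℓ)}_i σ^s` to combinations of the matrix elements `m^{(ℓ)}_{ij} σ^s`; in particular they send
`∑ x_i ξ^{(ℓ)}_i σ^s` to combinations of the elements in the theorem, and a suitable `φ` produces
each of these elements. The images of the simple modules under these maps span `𝒜`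
(`QOsp.iSup_map_coslice`): starting from the `a^N σ^s`, right slices by `f` and the action of `e`
produce a spanning set of monomials. So `𝒜` is a quotient of a direct sum of simple modules. The
quotient map splits, and every invariant of `𝒜` is the image of invariants in the summands
(`mem_of_smul_eq_zero_of_iSup_map_simple`). The linear independence of the matrix elements is not
needed for this.

The invariants of `α e + β fk` form a subalgebra because `e` and `fk` both act as derivations
twisted by the same map `u ↦ R_k(par u)` (`QOsp.slice_e_mul`, `QOsp.slice_fk_mul`).
-/

/-! ### Kernels in sums of images of simple modules -/

/-- If `M` is the sum of the images of simple submodules `V i` under module endomorphisms `φ i`,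
then everything killed by a ring element `X` is a sum of images `φ i v` with `v ∈ V i` killed by
`X`: the direct sum of the `V i` is semisimple, so that the surjection onto `M` has a section, and
the section preserves the kernel of `X`. -/
theorem mem_of_smul_eq_zero_of_iSup_map_simple {R M ι : Type*} [Ring R] [AddCommGroup M]
    [Module R M] (V : ι → Submodule R M) [∀ i, IsSimpleModule R (V i)] (φ : ι → M →ₗ[R] M)
    (hV : ⨆ i, (V i).map (φ i) = ⊤) (X : R) (S : AddSubmonoid M)
    (hS : ∀ i, ∀ v ∈ V i, X • v = 0 → φ i v ∈ S) {u : M} (hu : X • u = 0) : u ∈ S := by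
  classical
  let Φ : (Π₀ i, V i) →ₗ[R] M := DFinsupp.lsum ℕ fun i => φ i ∘ₗ (V i).subtype
  have hΦ : Function.Surjective Φ := by
    rw [← LinearMap.range_eq_top, eq_top_iff, ← hV, iSup_le_iff]
    rintro i _ ⟨v, hv, rfl⟩
    exact ⟨DFinsupp.single i ⟨v, hv⟩, by simp [Φ]⟩
  obtain ⟨Ψ, hΨ⟩ := IsSemisimpleModule.lifting_property Φ hΦ LinearMap.id
  have h1 : Φ (Ψ u) = u := congrArg (fun g : M →ₗ[R] M => g u) hΨ
  have h2 : X • Ψ u = 0 := by rw [← map_smul, hu, map_zero]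
  have h3 : ∀ i, X • Ψ u i = 0 := fun i => congrArg (fun w : Π₀ i, V i => w i) h2
  rw [← h1, DFinsupp.lsum_apply_apply, DFinsupp.sumAddHom_apply]
  refine AddSubmonoid.sum_mem _ fun i _ => ?_
  exact hS i _ (Ψ u i).2 (congrArg Subtype.val (h3 i))

/-! ### Ladders -/

/-- A ladder of length `N + 1`: nonzero vectors `v 0, …, v N` that `E` moves up and `F` moves
down with nonzero coefficients `e n` and `f n`, and that `H` multiplies by `κ n`. Only the values
`v n` with `n ≤ N`, `e n` with `n < N`, `f n` with `1 ≤ n ≤ N` and `κ n` with `n ≤ N` matter. -/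
structure IsLadder {M : Type*} [AddCommGroup M] [Module ℂ M] (E F H : Module.End ℂ M) (N : ℕ)
    (v : ℕ → M) (e f κ : ℕ → ℂ) : Prop where
  raise : ∀ n < N, E (v n) = e n • v (n + 1)
  raise_top : E (v N) = 0
  lower : ∀ n < N, F (v (n + 1)) = f (n + 1) • v n
  lower_bot : F (v 0) = 0
  diag : ∀ n ≤ N, H (v n) = κ n • v n
  e_ne : ∀ n < N, e n ≠ 0
  f_ne : ∀ n < N, f (n + 1) ≠ 0
  bot_ne : v 0 ≠ 0

namespace IsLadder
variable {M : Type*} [AddCommGroup M] [Module ℂ M] {E F H : Module.End ℂ M} {N : ℕ}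
  {v : ℕ → M} {e f κ : ℕ → ℂ}

theorem lower_pow_self (h : IsLadder E F H N v e f κ) :
    ∀ n ≤ N, ∃ z : ℂ, z ≠ 0 ∧ (F ^ n) (v n) = z • v 0
  | 0, _ => ⟨1, one_ne_zero, by simp⟩
  | n + 1, hn => by
    obtain ⟨z, hz, h1⟩ := lower_pow_self h n (by omega)
    exact ⟨f (n + 1) * z, mul_ne_zero (h.f_ne n hn) hz, by
      rw [pow_succ, Module.End.mul_apply, h.lower n hn, map_smul, h1, smul_smul]⟩

theorem lower_pow_lt (h : IsLadder E F H N v e f κ) :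
    ∀ n ≤ N, ∀ i < n, (F ^ n) (v i) = 0
  | 0, _, i, hi => by omega
  | n + 1, hn, 0, _ => by rw [pow_succ, Module.End.mul_apply, h.lower_bot, map_zero]
  | n + 1, hn, i + 1, hi => by
    rw [pow_succ, Module.End.mul_apply, h.lower i (by omega), map_smul,
      lower_pow_lt h n (by omega) i (by omega), smul_zero]

/-- A nontrivial combination of the rungs is moved to a nonzero multiple of the bottom rung by the
power of `F` that belongs to its highest term. -/
theorem exists_lower_pow (h : IsLadder E F H N v e f κ) (y : ℕ → ℂ) {m : ℕ} (hm : m ≤ N)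
    (hy : y m ≠ 0) :
    ∃ (n : ℕ) (z : ℂ), z ≠ 0 ∧ (F ^ n) (∑ i ∈ Finset.range (N + 1), y i • v i) = z • v 0 := by
  classical
  set n := Nat.findGreatest (fun i => y i ≠ 0) N with hn
  have hnN : n ≤ N := Nat.findGreatest_le N
  have hyn : y n ≠ 0 := Nat.findGreatest_spec (P := fun i => y i ≠ 0) hm hy
  obtain ⟨z, hz, h1⟩ := h.lower_pow_self n hnN
  refine ⟨n, y n * z, mul_ne_zero hyn hz, ?_⟩
  rw [map_sum, Finset.sum_eq_single_of_mem n (Finset.mem_range.2 (by omega)), map_smul, h1,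
    smul_smul]
  intro i hi hin
  have hi' := Finset.mem_range.1 hi
  rcases lt_or_gt_of_ne hin with h2 | h2
  · rw [map_smul, h.lower_pow_lt n hnN i h2, smul_zero]
  · have h3 : ¬ y i ≠ 0 := Nat.findGreatest_is_greatest h2 (by omega)
    rw [not_not.1 h3, zero_smul, map_zero]

theorem eq_zero_of_sum_eq_zero (h : IsLadder E F H N v e f κ) (y : ℕ → ℂ)
    (hy : ∑ i ∈ Finset.range (N + 1), y i • v i = 0) : ∀ m ≤ N, y m = 0 := by
  intro m hm
  by_contra h0
  obtain ⟨n, z, hz, h1⟩ := h.exists_lower_pow y hm h0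
  rw [hy, map_zero] at h1
  exact smul_ne_zero hz h.bot_ne h1.symm

/-- The span of the rungs is stable under the algebra generated by `E`, `F`, `H`. -/
theorem adjoin_apply_mem (h : IsLadder E F H N v e f κ) {T : Module.End ℂ M}
    (hT : T ∈ Algebra.adjoin ℂ {E, F, H}) {w : M}
    (hw : w ∈ Submodule.span ℂ (v '' Set.Iic N)) :
    T w ∈ Submodule.span ℂ (v '' Set.Iic N) := by
  have key : ∀ G : Module.End ℂ M,
      (∀ n ≤ N, G (v n) ∈ Submodule.span ℂ (v '' Set.Iic N)) →
      ∀ w ∈ Submodule.span ℂ (v '' Set.Iic N), G w ∈ Submodule.span ℂ (v '' Set.Iic N) := by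
    intro G hG w hw
    have : Submodule.span ℂ (v '' Set.Iic N) ≤ (Submodule.span ℂ (v '' Set.Iic N)).comap G := by
      rw [Submodule.span_le]
      rintro _ ⟨n, hn, rfl⟩
      exact hG n hn
    exact this hw
  have hv : ∀ n ≤ N, v n ∈ Submodule.span ℂ (v '' Set.Iic N) := fun n hn =>
    Submodule.subset_span ⟨n, hn, rfl⟩
  induction hT using Algebra.adjoin_induction generalizing w with
  | mem G hG =>
    refine key G ?_ w hw
    rcases hG with rfl | rfl | rfl
    · intro n hn
      rcases hn.lt_or_eq with h1 | rfl
      · rw [h.raise n h1]; exact Submodule.smul_mem _ _ (hv _ h1)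
      · rw [h.raise_top]; exact Submodule.zero_mem _
    · intro n hn
      cases n with
      | zero => rw [h.lower_bot]; exact Submodule.zero_mem _
      | succ n => rw [h.lower n hn]; exact Submodule.smul_mem _ _ (hv _ (by omega))
    · intro n hn
      rw [h.diag n hn]; exact Submodule.smul_mem _ _ (hv n hn)
  | algebraMap z =>
    rw [Module.algebraMap_end_apply]; exact Submodule.smul_mem _ _ hw
  | add S T _ _ hS hT => exact Submodule.add_mem _ (hS hw) (hT hw)
  | mul S T _ _ hS hT => exact hS (hT hw)

theorem exists_coeff {w : M} (hw : w ∈ Submodule.span ℂ (v '' Set.Iic N)) :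
    ∃ y : ℕ → ℂ, w = ∑ i ∈ Finset.range (N + 1), y i • v i := by
  have h1 : v '' Set.Iic N = v '' (Finset.range (N + 1) : Set ℕ) := by
    congr 1; ext n; simp
  rw [h1] at hw
  obtain ⟨y, rfl⟩ := (Submodule.mem_span_image_finset_iff_exists_fun ℂ).1 hw
  refine ⟨fun i => if hi : i ∈ Finset.range (N + 1) then y ⟨i, hi⟩ else 0, ?_⟩
  rw [← Finset.sum_coe_sort (Finset.range (N + 1))]
  exact Finset.sum_congr rfl fun i _ => by beta_reduce; rw [dif_pos i.2]

/-- The submodule generated by the bottom rung over the algebra generated by `E`, `F`, `H` is the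
span of all rungs. -/
theorem mem_span_bot_iff (h : IsLadder E F H N v e f κ) {w : M} :
    w ∈ Submodule.span (Algebra.adjoin ℂ {E, F, H}) {v 0}
      ↔ w ∈ Submodule.span ℂ (v '' Set.Iic N) := by
  constructor
  · intro hw
    obtain ⟨T, rfl⟩ := Submodule.mem_span_singleton.1 hw
    exact h.adjoin_apply_mem T.2 (Submodule.subset_span ⟨0, Nat.zero_le N, rfl⟩)
  · have hE : E ∈ Algebra.adjoin ℂ {E, F, H} := Algebra.subset_adjoin (by simp)
    have hv : ∀ n ≤ N, v n ∈ Submodule.span (Algebra.adjoin ℂ {E, F, H}) {v 0} := by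
      intro n
      induction n with
      | zero => exact fun _ => Submodule.mem_span_singleton_self _
      | succ n ih =>
        intro hn
        have h1 := Submodule.smul_mem _ (⟨E, hE⟩ : Algebra.adjoin ℂ {E, F, H}) (ih (by omega))
        have h2 := Submodule.smul_of_tower_mem _ (e n)⁻¹ h1
        change (e n)⁻¹ • E (v n) ∈ _ at h2
        rwa [h.raise n hn, inv_smul_smul₀ (h.e_ne n hn)] at h2
    intro hw
    obtain ⟨y, rfl⟩ := exists_coeff hw
    refine Submodule.sum_mem _ fun i hi => Submodule.smul_of_tower_mem _ (y i) (hv i ?_)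
    have := Finset.mem_range.1 hi
    omega

/-- A ladder spans a simple module: `F` moves any nonzero vector down to the bottom rung, from
which `E` reaches all the others. -/
theorem isSimpleModule (h : IsLadder E F H N v e f κ) :
    IsSimpleModule (Algebra.adjoin ℂ {E, F, H})
      (Submodule.span (Algebra.adjoin ℂ {E, F, H}) {v 0}) := by
  rw [isSimpleModule_iff_isAtom]
  refine ⟨fun h0 => h.bot_ne (Submodule.span_singleton_eq_bot.1 h0), fun W hW => ?_⟩
  by_contra hW0
  obtain ⟨w, hwW, hw0⟩ := Submodule.exists_mem_ne_zero_of_ne_bot hW0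
  obtain ⟨y, rfl⟩ := exists_coeff ((h.mem_span_bot_iff).1 (hW.le hwW))
  have hex : ∃ m ≤ N, y m ≠ 0 := by
    by_contra hcon
    push Not at hcon
    refine hw0 (Finset.sum_eq_zero fun i hi => ?_)
    rw [hcon i (by have := Finset.mem_range.1 hi; omega), zero_smul]
  obtain ⟨m, hm, hym⟩ := hex
  obtain ⟨n, z, hz, h1⟩ := h.exists_lower_pow y hm hym
  have hF : F ∈ Algebra.adjoin ℂ {E, F, H} := Algebra.subset_adjoin (by simp)
  have h2 := Submodule.smul_mem _ ((⟨F, hF⟩ : Algebra.adjoin ℂ {E, F, H}) ^ n) hwW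
  have h3 := Submodule.smul_of_tower_mem _ z⁻¹ h2
  change z⁻¹ • (F ^ n) _ ∈ W at h3
  rw [h1, inv_smul_smul₀ hz] at h3
  exact hW.not_ge ((Submodule.span_singleton_le_iff_mem _ _).2 h3)

/-- The action of `α E + β F + γ H` in coordinates: a tridiagonal matrix. -/
theorem apply_sum (h : IsLadder E F H N v e f κ) (α β γ : ℂ) (y : ℕ → ℂ) :
    (α • E + β • F + γ • H) (∑ i ∈ Finset.range (N + 1), y i • v i)
      = ∑ m ∈ Finset.range (N + 1),
        (α * (if m = 0 then 0 else e (m - 1) * y (m - 1))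
          + β * (if m < N then f (m + 1) * y (m + 1) else 0) + γ * (κ m * y m)) • v m := by
  have hE : E (∑ i ∈ Finset.range (N + 1), y i • v i)
      = ∑ m ∈ Finset.range (N + 1), (if m = 0 then 0 else e (m - 1) * y (m - 1)) • v m := by
    rw [Finset.sum_range_succ, Finset.sum_range_succ' _ N, map_add, map_smul, h.raise_top, map_sum]
    simp only [smul_zero, add_zero, if_true, zero_smul]
    refine Finset.sum_congr rfl fun i hi => ?_
    rw [map_smul, h.raise i (Finset.mem_range.1 hi), smul_smul, mul_comm]
    simp
  have hF : F (∑ i ∈ Finset.range (N + 1), y i • v i)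
      = ∑ m ∈ Finset.range (N + 1), (if m < N then f (m + 1) * y (m + 1) else 0) • v m := by
    rw [Finset.sum_range_succ' _ N, Finset.sum_range_succ, map_add, map_smul, h.lower_bot, map_sum]
    simp only [smul_zero, add_zero, lt_irrefl, if_false, zero_smul]
    refine Finset.sum_congr rfl fun i hi => ?_
    have hi' := Finset.mem_range.1 hi
    rw [map_smul, h.lower i hi', smul_smul, mul_comm, if_pos hi']
  have hH : H (∑ i ∈ Finset.range (N + 1), y i • v i)
      = ∑ m ∈ Finset.range (N + 1), (κ m * y m) • v m := by
    rw [map_sum]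
    refine Finset.sum_congr rfl fun i hi => ?_
    rw [map_smul, h.diag i (by have := Finset.mem_range.1 hi; omega), smul_smul, mul_comm]
  simp only [LinearMap.add_apply, LinearMap.smul_apply, hE, hF, hH, Finset.smul_sum, smul_smul,
    ← Finset.sum_add_distrib, ← add_smul]

theorem apply_sum_eq_zero_iff (h : IsLadder E F H N v e f κ) (α β γ : ℂ) (y : ℕ → ℂ) :
    (α • E + β • F + γ • H) (∑ i ∈ Finset.range (N + 1), y i • v i) = 0
      ↔ ∀ m ≤ N, α * (if m = 0 then 0 else e (m - 1) * y (m - 1))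
          + β * (if m < N then f (m + 1) * y (m + 1) else 0) + γ * (κ m * y m) = 0 := by
  rw [h.apply_sum]
  constructor
  · exact h.eq_zero_of_sum_eq_zero _
  · intro hy
    refine Finset.sum_eq_zero fun i hi => ?_
    rw [hy i (by have := Finset.mem_range.1 hi; omega), zero_smul]

/-- A vector killed by `α E + β F` is determined by its lowest coefficient. -/
theorem coeff_eq_zero_of_EF (h : IsLadder E F H N v e f κ) {α β : ℂ} (hβ : β ≠ 0) {y : ℕ → ℂ}
    (hy : (α • E + β • F + (0 : ℂ) • H) (∑ i ∈ Finset.range (N + 1), y i • v i) = 0)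
    (h0 : y 0 = 0) : ∀ m ≤ N, y m = 0 := by
  rw [h.apply_sum_eq_zero_iff] at hy
  intro m
  induction m using Nat.twoStepInduction with
  | zero => exact fun _ => h0
  | one =>
    intro hm
    have h1 := hy 0 (by omega)
    have h2 := h.f_ne 0 hm
    simpa [show 0 < N from hm, hβ, h2] using h1
  | more m ih _ =>
    intro hm
    have h1 := hy (m + 1) (by omega)
    have h2 := h.f_ne (m + 1) (by omega)
    simpa [show m + 1 < N by omega, ih (by omega), hβ, h2] using h1

/-- For odd `N` the operator `α E + β F` is injective on the span of the rungs: going down from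
the top, the coefficients of even index vanish, and in particular the lowest one. -/
theorem coeff_eq_zero_of_EF_odd (h : IsLadder E F H N v e f κ) (hN : Odd N) {α β : ℂ}
    (hα : α ≠ 0) (hβ : β ≠ 0) {y : ℕ → ℂ}
    (hy : (α • E + β • F + (0 : ℂ) • H) (∑ i ∈ Finset.range (N + 1), y i • v i) = 0) :
    ∀ m ≤ N, y m = 0 := by
  refine h.coeff_eq_zero_of_EF hβ hy ?_
  rw [h.apply_sum_eq_zero_iff] at hy
  obtain ⟨r, rfl⟩ := hN
  have key : ∀ k ≤ r, y (2 * r - 2 * k) = 0 := by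
    intro k
    induction k with
    | zero =>
      intro _
      have h1 := hy (2 * r + 1) le_rfl
      have h2 := h.e_ne (2 * r) (by omega)
      simpa [hα, h2] using h1
    | succ k ih =>
      intro hk
      have h1 := hy (2 * r - 2 * (k + 1) + 1) (by omega)
      have h2 := h.e_ne (2 * r - 2 * (k + 1)) (by omega)
      have h3 := ih (by omega)
      rw [show 2 * r - 2 * k = 2 * r - 2 * (k + 1) + 1 + 1 by omega] at h3
      simpa [hα, h2, h3] using h1
  simpa using key r le_rfl

/-- A vector killed by `α E + γ H` is determined by its coefficients at the zeros of `κ`, since the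
matrix is triangular. -/
theorem coeff_eq_zero_of_EH (h : IsLadder E F H N v e f κ) {α γ : ℂ} (hγ : γ ≠ 0) {y : ℕ → ℂ}
    (hy : (α • E + (0 : ℂ) • F + γ • H) (∑ i ∈ Finset.range (N + 1), y i • v i) = 0)
    (h0 : ∀ m ≤ N, κ m = 0 → y m = 0) : ∀ m ≤ N, y m = 0 := by
  rw [h.apply_sum_eq_zero_iff] at hy
  intro m
  induction m with
  | zero =>
    intro hm
    by_cases hκ : κ 0 = 0
    · exact h0 0 hm hκ
    · simpa [hγ, hκ] using hy 0 hm
  | succ m ih =>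
    intro hm
    by_cases hκ : κ (m + 1) = 0
    · exact h0 _ hm hκ
    · simpa [hγ, hκ, ih (by omega)] using hy _ hm

theorem coeff_eq_zero_of_FH (h : IsLadder E F H N v e f κ) {β γ : ℂ} (hγ : γ ≠ 0) {y : ℕ → ℂ}
    (hy : ((0 : ℂ) • E + β • F + γ • H) (∑ i ∈ Finset.range (N + 1), y i • v i) = 0)
    (h0 : ∀ m ≤ N, κ m = 0 → y m = 0) : ∀ m ≤ N, y m = 0 := by
  rw [h.apply_sum_eq_zero_iff] at hy
  have key : ∀ k ≤ N, y (N - k) = 0 := by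
    intro k
    induction k with
    | zero =>
      intro _
      by_cases hκ : κ N = 0
      · exact h0 N le_rfl hκ
      · simpa [hγ, hκ] using hy N le_rfl
    | succ k ih =>
      intro hk
      have h1 := hy (N - (k + 1)) (by omega)
      have h2 := ih (by omega)
      rw [show N - k = N - (k + 1) + 1 by omega] at h2
      by_cases hκ : κ (N - (k + 1)) = 0
      · exact h0 _ (by omega) hκ
      · simpa [hγ, hκ, h2] using h1
  intro m hm
  simpa [show N - (N - m) = m by omega] using key (N - m) (by omega)

theorem ne_zero (h : IsLadder E F H N v e f κ) {n : ℕ} (hn : n ≤ N) : v n ≠ 0 := by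
  intro h0
  obtain ⟨z, hz, h1⟩ := h.lower_pow_self n hn
  rw [h0, map_zero] at h1
  exact smul_ne_zero hz h.bot_ne h1.symm

theorem exists_dual (h : IsLadder E F H N v e f κ) {m : ℕ} (hm : m ≤ N) :
    ∃ φ : M →ₗ[ℂ] ℂ, ∀ n ≤ N, φ (v n) = if n = m then 1 else 0 := by
  have hli : LinearIndependent ℂ fun i : Fin (N + 1) => v i := by
    rw [Fintype.linearIndependent_iff]
    intro g hg i
    have h1 := h.eq_zero_of_sum_eq_zero (fun n => if hn : n < N + 1 then g ⟨n, hn⟩ else 0) (by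
      rw [Finset.sum_range, ← hg]
      exact Finset.sum_congr rfl fun j _ => by rw [dif_pos j.2]) i (by omega)
    rwa [dif_pos i.2] at h1
  obtain ⟨g, hg⟩ := LinearMap.exists_leftInverse_of_injective
    (Fintype.linearCombination ℂ fun i : Fin (N + 1) => v i)
    (LinearMap.ker_eq_bot.2 hli.fintypeLinearCombination_injective)
  refine ⟨LinearMap.proj (⟨m, by omega⟩ : Fin (N + 1)) ∘ₗ g, fun n hn => ?_⟩
  have h1 : g (v n) = Pi.single (⟨n, by omega⟩ : Fin (N + 1)) (1 : ℂ) := by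
    have := congrArg (fun G => G (Pi.single (⟨n, by omega⟩ : Fin (N + 1)) (1 : ℂ))) hg
    simpa using this
  rw [LinearMap.comp_apply, h1, LinearMap.proj_apply, Pi.single_apply]
  simp [Fin.ext_iff, eq_comm]

/-- If `M` is the sum of the images of ladders under maps `φ i` that commute with `E`, `F`, `H`,
then the kernel of any operator `X` from the algebra generated by `E`, `F`, `H` consists of sums of
images of vectors in the ladders that are killed by `X`. -/
theorem mem_of_apply_eq_zero {ι : Type*} {N : ι → ℕ} {v : ι → ℕ → M} {e f κ : ι → ℕ → ℂ}
    (h : ∀ i, IsLadder E F H (N i) (v i) (e i) (f i) (κ i)) (φ : ι → M →ₗ[ℂ] M)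
    (hE : ∀ i u, φ i (E u) = E (φ i u)) (hF : ∀ i u, φ i (F u) = F (φ i u))
    (hH : ∀ i u, φ i (H u) = H (φ i u))
    (htop : ⨆ i, (Submodule.span ℂ (v i '' Set.Iic (N i))).map (φ i) = ⊤)
    {X : Module.End ℂ M} (hX : X ∈ Algebra.adjoin ℂ {E, F, H}) (S : Submodule ℂ M)
    (hS : ∀ i, ∀ w ∈ Submodule.span ℂ (v i '' Set.Iic (N i)), X w = 0 → φ i w ∈ S)
    {u : M} (hu : X u = 0) : u ∈ S := by
  have hcomm : ∀ i, ∀ T ∈ Algebra.adjoin ℂ {E, F, H}, ∀ u, φ i (T u) = T (φ i u) := by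
    intro i T hT
    induction hT using Algebra.adjoin_induction with
    | mem G hG =>
      rcases hG with rfl | rfl | rfl
      exacts [hE i, hF i, hH i]
    | algebraMap z => simp [Module.algebraMap_end_apply]
    | add S T _ _ hS hT => intro u; simp only [LinearMap.add_apply, map_add, hS, hT]
    | mul S T _ _ hS hT => intro u; simp only [Module.End.mul_apply, hS, hT]
  let R := Algebra.adjoin ℂ {E, F, H}
  let V : ι → Submodule R M := fun i => Submodule.span R {v i 0}
  let ψ : ι → M →ₗ[R] M := fun i =>
    { toFun := φ i
      map_add' := map_add _
      map_smul' := fun T u => hcomm i T T.2 u }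
  have : ∀ i, IsSimpleModule R (V i) := fun i => (h i).isSimpleModule
  have hV : ⨆ i, (V i).map (ψ i) = ⊤ := by
    rw [← Submodule.restrictScalars_eq_top_iff ℂ, eq_top_iff, ← htop, iSup_le_iff]
    rintro i _ ⟨w, hw, rfl⟩
    exact Submodule.mem_iSup_of_mem i ⟨w, ((h i).mem_span_bot_iff).2 hw, rfl⟩
  exact mem_of_smul_eq_zero_of_iSup_map_simple V ψ hV (⟨X, hX⟩ : R) S.toAddSubmonoid
    (fun i w hw hXw => hS i w (((h i).mem_span_bot_iff).1 hw) hXw) hu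

end IsLadder

namespace QOsp
variable (P : QParam)

/-! ### Commutation relations and a spanning set of the algebra -/

theorem sigma_mul_gen (g : AGen) :
    gen P .σ * gen P g = par P (gen P g) * gen P .σ := by
  have ht := P.t_ne_zero
  have e1 : gen P .c * (gen P .a * gen P .d) = P.t⁻¹ • (gen P .a * (gen P .c * gen P .d)) := by
    rw [← mul_assoc, gen_ca, smul_mul_assoc, mul_assoc]
  have e2 : gen P .b * (gen P .a * gen P .d) = P.t⁻¹ • (gen P .a * (gen P .b * gen P .d)) := by
    rw [← mul_assoc, gen_ba, smul_mul_assoc, mul_assoc]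
  have e3 : gen P .b * (gen P .a * gen P .c) = P.t⁻¹ • (gen P .a * (gen P .b * gen P .c)) := by
    rw [← mul_assoc, gen_ba, smul_mul_assoc, mul_assoc]
  have e4 : gen P .d * (gen P .a * gen P .d) = gen P .a * (gen P .d * gen P .d)
      - (P.t⁻¹ - P.t) • (gen P .b * (gen P .c * gen P .d)) := by
    rw [← mul_assoc, gen_da, sub_mul, smul_mul_assoc, mul_assoc, mul_assoc]
  have e5 : gen P .c * (gen P .b * gen P .c) = -(gen P .b * (gen P .c * gen P .c)) := by
    rw [← mul_assoc, gen_cb, neg_mul, mul_assoc]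
  have e6 : gen P .d * (gen P .b * gen P .c)
      = P.t⁻¹ ^ 2 • (gen P .b * (gen P .c * gen P .d)) := by
    rw [← mul_assoc, gen_db, neg_mul, smul_mul_assoc, mul_assoc, gen_dc, mul_neg, mul_smul_comm,
      smul_neg, neg_neg, smul_smul, sq]
  cases g
  case σ => simp
  all_goals
    simp only [par_a, par_b, par_c, par_d, ← gen_det, add_mul, mul_add, mul_assoc, smul_mul_assoc,
      mul_smul_comm, gen_da, gen_ca, gen_db, gen_dc, gen_cb, mul_sub, mul_neg, neg_mul, e1, e2, e3,
      e4, e5, e6, smul_neg]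
  all_goals match_scalars <;> field_simp <;> ring

theorem sigma_mul (u : A P) : gen P .σ * u = par P u * gen P .σ := by
  induction u using A_induction P with
  | one => simp
  | add u v hu hv => simp only [mul_add, hu, hv, map_add, add_mul]
  | smul z u hu => simp only [mul_smul_comm, hu, map_smul, smul_mul_assoc]
  | gen_mul g u hu => rw [← mul_assoc, sigma_mul_gen, mul_assoc, hu, ← mul_assoc, map_mul]

theorem sigma_pow_mod (s : ℕ) : gen P .σ ^ s = gen P .σ ^ (s % 2) := by
  conv_lhs => rw [← Nat.mod_add_div s 2, pow_add, pow_mul, sq, gen_sq, one_pow, mul_one]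

theorem b_mul_a_pow (n : ℕ) :
    gen P .b * gen P .a ^ n = (P.t⁻¹) ^ n • (gen P .a ^ n * gen P .b) := by
  induction n with
  | zero => simp
  | succ n ih =>
    rw [pow_succ, ← mul_assoc, ih, smul_mul_assoc, mul_assoc, gen_ba, mul_smul_comm, smul_smul,
      ← mul_assoc, pow_succ]

theorem b_mul_c_pow (n : ℕ) :
    gen P .b * gen P .c ^ n = (-1 : ℂ) ^ n • (gen P .c ^ n * gen P .b) := by
  induction n with
  | zero => simp
  | succ n ih =>
    rw [pow_succ, ← mul_assoc, ih, smul_mul_assoc, mul_assoc, gen_bc, mul_neg, ← mul_assoc,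
      pow_succ (-1 : ℂ), mul_neg_one, neg_smul, smul_neg]

theorem d_mul_c_pow (n : ℕ) :
    gen P .d * gen P .c ^ n = (-P.t⁻¹) ^ n • (gen P .c ^ n * gen P .d) := by
  induction n with
  | zero => simp
  | succ n ih =>
    rw [pow_succ, ← mul_assoc, ih, smul_mul_assoc, mul_assoc, gen_dc, mul_neg, mul_smul_comm,
      ← neg_smul, smul_smul, ← mul_assoc, pow_succ]

theorem d_mul_b_pow (n : ℕ) :
    gen P .d * gen P .b ^ n = (-P.t⁻¹) ^ n • (gen P .b ^ n * gen P .d) := by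
  induction n with
  | zero => simp
  | succ n ih =>
    rw [pow_succ, ← mul_assoc, ih, smul_mul_assoc, mul_assoc, gen_db, mul_neg, mul_smul_comm,
      ← neg_smul, smul_smul, ← mul_assoc, pow_succ]

theorem a_mul_c_pow (n : ℕ) :
    gen P .a * gen P .c ^ n = P.t ^ n • (gen P .c ^ n * gen P .a) := by
  induction n with
  | zero => simp
  | succ n ih =>
    rw [pow_succ, ← mul_assoc, ih, smul_mul_assoc, mul_assoc, gen_ac, mul_smul_comm, smul_smul,
      ← mul_assoc, pow_succ]

theorem a_mul_b_pow (n : ℕ) :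
    gen P .a * gen P .b ^ n = P.t ^ n • (gen P .b ^ n * gen P .a) := by
  induction n with
  | zero => simp
  | succ n ih =>
    rw [pow_succ, ← mul_assoc, ih, smul_mul_assoc, mul_assoc, gen_ab, mul_smul_comm, smul_smul,
      ← mul_assoc, pow_succ]

theorem gen_ad_eq : gen P .a * gen P .d = gen P .σ + P.t • (gen P .c * gen P .b) := by
  rw [← gen_det, gen_bc]; module

theorem gen_da_eq : gen P .d * gen P .a = gen P .σ + P.t⁻¹ • (gen P .c * gen P .b) := by
  rw [gen_da, gen_ad_eq, gen_bc]; module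

theorem c_mul_b_pow (n : ℕ) :
    gen P .c * gen P .b ^ n = (-1 : ℂ) ^ n • (gen P .b ^ n * gen P .c) := by
  induction n with
  | zero => simp
  | succ n ih =>
    rw [pow_succ, ← mul_assoc, ih, smul_mul_assoc, mul_assoc, gen_cb, mul_neg, ← mul_assoc,
      pow_succ (-1 : ℂ), mul_neg_one, neg_smul, smul_neg]

/-- A subspace that contains the monomials `a^x c^y b^z σ^s` and `c^y b^z d^w σ^s` is everything:
the span of these monomials is stable under left multiplication by the generators, since
`ad = σ + t cb` and `da = σ + t⁻¹ cb` remove products of `a` and `d`. -/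
theorem eq_top_of_monomials_mem (S : Submodule ℂ (A P))
    (h1 : ∀ x y z s : ℕ, gen P .a ^ x * (gen P .c ^ y * (gen P .b ^ z * gen P .σ ^ s)) ∈ S)
    (h2 : ∀ y z w s : ℕ, gen P .c ^ y * (gen P .b ^ z * (gen P .d ^ w * gen P .σ ^ s)) ∈ S) :
    S = ⊤ := by
  set B : Set (A P) :=
    {u | ∃ x y z s : ℕ, u = gen P .a ^ x * (gen P .c ^ y * (gen P .b ^ z * gen P .σ ^ s))}
    ∪ {u | ∃ y z w s : ℕ, u = gen P .c ^ y * (gen P .b ^ z * (gen P .d ^ w * gen P .σ ^ s))}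
    with hB
  have m1 : ∀ x y z s : ℕ, gen P .a ^ x * (gen P .c ^ y * (gen P .b ^ z * gen P .σ ^ s))
      ∈ Submodule.span ℂ B := fun x y z s => Submodule.subset_span (Or.inl ⟨x, y, z, s, rfl⟩)
  have m2 : ∀ y z w s : ℕ, gen P .c ^ y * (gen P .b ^ z * (gen P .d ^ w * gen P .σ ^ s))
      ∈ Submodule.span ℂ B := fun y z w s => Submodule.subset_span (Or.inr ⟨y, z, w, s, rfl⟩)
  have hBS : Submodule.span ℂ B ≤ S := by
    rw [Submodule.span_le]
    rintro _ (⟨x, y, z, s, rfl⟩ | ⟨y, z, w, s, rfl⟩)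
    · exact h1 x y z s
    · exact h2 y z w s
  have n1 : ∀ x y z s : ℕ, gen P .σ * (gen P .a ^ x * (gen P .c ^ y * (gen P .b ^ z *
      gen P .σ ^ s))) ∈ Submodule.span ℂ B := by
    intro x y z s
    have e : par P (gen P .a ^ x * (gen P .c ^ y * (gen P .b ^ z * gen P .σ ^ s)))
        = ((-1 : ℂ) ^ z * (-1) ^ y) •
          (gen P .a ^ x * (gen P .c ^ y * (gen P .b ^ z * gen P .σ ^ s))) := by
      simp only [map_mul, map_pow, par_a, par_b, par_c, par_σ, ← neg_one_smul ℂ (gen P .b),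
        ← neg_one_smul ℂ (gen P .c), smul_pow, smul_mul_assoc, mul_smul_comm, smul_smul]
    rw [sigma_mul, e, smul_mul_assoc]
    simp only [mul_assoc, ← pow_succ]
    exact Submodule.smul_mem _ _ (m1 _ _ _ _)
  have n2 : ∀ y z w s : ℕ, gen P .σ * (gen P .c ^ y * (gen P .b ^ z * (gen P .d ^ w *
      gen P .σ ^ s))) ∈ Submodule.span ℂ B := by
    intro y z w s
    have e : par P (gen P .c ^ y * (gen P .b ^ z * (gen P .d ^ w * gen P .σ ^ s)))
        = ((-1 : ℂ) ^ z * (-1) ^ y) •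
          (gen P .c ^ y * (gen P .b ^ z * (gen P .d ^ w * gen P .σ ^ s))) := by
      simp only [map_mul, map_pow, par_d, par_b, par_c, par_σ, ← neg_one_smul ℂ (gen P .b),
        ← neg_one_smul ℂ (gen P .c), smul_pow, smul_mul_assoc, mul_smul_comm, smul_smul]
    rw [sigma_mul, e, smul_mul_assoc]
    simp only [mul_assoc, ← pow_succ]
    exact Submodule.smul_mem _ _ (m2 _ _ _ _)
  have c1 : ∀ x y z s : ℕ, gen P .c * (gen P .a ^ x * (gen P .c ^ y * (gen P .b ^ z *
      gen P .σ ^ s))) ∈ Submodule.span ℂ B := by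
    intro x y z s
    rw [← mul_assoc, c_mul_a_pow, smul_mul_assoc, mul_assoc, ← mul_assoc (gen P .c), ← pow_succ']
    exact Submodule.smul_mem _ _ (m1 _ _ _ _)
  have b1 : ∀ x y z s : ℕ, gen P .b * (gen P .a ^ x * (gen P .c ^ y * (gen P .b ^ z *
      gen P .σ ^ s))) ∈ Submodule.span ℂ B := by
    intro x y z s
    rw [← mul_assoc, b_mul_a_pow, smul_mul_assoc, mul_assoc, ← mul_assoc (gen P .b), b_mul_c_pow,
      smul_mul_assoc, mul_assoc, ← mul_assoc (gen P .b), ← pow_succ', mul_smul_comm]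
    exact Submodule.smul_mem _ _ (Submodule.smul_mem _ _ (m1 _ _ _ _))
  have c2 : ∀ y z w s : ℕ, gen P .c * (gen P .c ^ y * (gen P .b ^ z * (gen P .d ^ w *
      gen P .σ ^ s))) ∈ Submodule.span ℂ B := by
    intro y z w s
    rw [← mul_assoc, ← pow_succ']
    exact m2 _ _ _ _
  have b2 : ∀ y z w s : ℕ, gen P .b * (gen P .c ^ y * (gen P .b ^ z * (gen P .d ^ w *
      gen P .σ ^ s))) ∈ Submodule.span ℂ B := by
    intro y z w s
    rw [← mul_assoc, b_mul_c_pow, smul_mul_assoc, mul_assoc, ← mul_assoc (gen P .b), ← pow_succ']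
    exact Submodule.smul_mem _ _ (m2 _ _ _ _)
  have lift : ∀ g : AGen, (∀ u ∈ B, gen P g * u ∈ Submodule.span ℂ B) →
      ∀ u ∈ Submodule.span ℂ B, gen P g * u ∈ Submodule.span ℂ B := by
    intro g hg u hu
    have : Submodule.span ℂ B ≤ (Submodule.span ℂ B).comap (LinearMap.mulLeft ℂ (gen P g)) :=
      Submodule.span_le.2 hg
    exact this hu
  have lc := lift .c (by
    rintro _ (⟨x, y, z, s, rfl⟩ | ⟨y, z, w, s, rfl⟩)
    · exact c1 _ _ _ _
    · exact c2 _ _ _ _)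
  have lb := lift .b (by
    rintro _ (⟨x, y, z, s, rfl⟩ | ⟨y, z, w, s, rfl⟩)
    · exact b1 _ _ _ _
    · exact b2 _ _ _ _)
  have la := lift .a (by
    rintro _ (⟨x, y, z, s, rfl⟩ | ⟨y, z, w, s, rfl⟩)
    · rw [← mul_assoc, ← pow_succ']
      exact m1 _ _ _ _
    · cases w with
      | zero =>
        rw [pow_zero, one_mul, ← pow_one (gen P .a)]
        exact m1 _ _ _ _
      | succ w =>
        rw [← mul_assoc, a_mul_c_pow, smul_mul_assoc, mul_assoc, ← mul_assoc (gen P .a),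
          a_mul_b_pow, smul_mul_assoc, mul_smul_comm, mul_assoc, pow_succ', mul_assoc,
          ← mul_assoc (gen P .a), gen_ad_eq, add_mul, smul_mul_assoc]
        refine Submodule.smul_mem _ _ (Submodule.smul_mem _ _ ?_)
        rw [sigma_mul, map_mul, map_pow, map_pow, par_d, par_σ, mul_assoc (gen P .d ^ w),
          ← pow_succ, mul_add, mul_add, mul_smul_comm, mul_smul_comm, mul_assoc (gen P .c),
          ← mul_assoc (gen P .b ^ z) (gen P .c)]
        refine Submodule.add_mem _ ?_ (Submodule.smul_mem _ _ ?_)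
        · exact m2 y z w (s + 1)
        · have e : gen P .b ^ z * gen P .c = (-1 : ℂ) ^ z • (gen P .c * gen P .b ^ z) := by
            rw [c_mul_b_pow, smul_smul, ← mul_pow]; simp
          rw [e, smul_mul_assoc, mul_smul_comm, mul_assoc, ← mul_assoc (gen P .b ^ z),
            ← mul_assoc (gen P .c ^ y), ← pow_succ, ← pow_succ]
          exact Submodule.smul_mem _ _ (m2 _ _ _ _))
  have ld := lift .d (by
    rintro _ (⟨x, y, z, s, rfl⟩ | ⟨y, z, w, s, rfl⟩)
    · cases x with
      | zero =>
        rw [pow_zero, one_mul, ← mul_assoc, d_mul_c_pow, smul_mul_assoc, mul_assoc,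
          ← mul_assoc (gen P .d), d_mul_b_pow, smul_mul_assoc, mul_smul_comm, mul_assoc]
        refine Submodule.smul_mem _ _ (Submodule.smul_mem _ _ ?_)
        simpa using m2 y z 1 s
      | succ x =>
        rw [pow_succ', mul_assoc, ← mul_assoc (gen P .d), gen_da_eq, add_mul, smul_mul_assoc,
          mul_assoc (gen P .c)]
        exact Submodule.add_mem _ (n1 _ _ _ _) (Submodule.smul_mem _ _ (lc _ (lb _ (m1 _ _ _ _))))
    · rw [← mul_assoc, d_mul_c_pow, smul_mul_assoc, mul_assoc,
          ← mul_assoc (gen P .d), d_mul_b_pow, smul_mul_assoc, mul_smul_comm, mul_assoc,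
          ← mul_assoc (gen P .d), ← pow_succ']
      exact Submodule.smul_mem _ _ (Submodule.smul_mem _ _ (m2 _ _ _ _)))
  have lσ := lift .σ (by
    rintro _ (⟨x, y, z, s, rfl⟩ | ⟨y, z, w, s, rfl⟩)
    · exact n1 _ _ _ _
    · exact n2 _ _ _ _)
  rw [eq_top_iff]
  rintro u -
  refine hBS ?_
  induction u using A_induction P with
  | one => simpa using m1 0 0 0 0
  | add u v hu hv => exact Submodule.add_mem _ hu hv
  | smul z u hu => exact Submodule.smul_mem _ _ hu
  | gen_mul g u hu =>
    cases g
    exacts [la _ hu, lb _ hu, lc _ hu, ld _ hu, lσ _ hu]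

end QOsp

namespace QOsp
variable (P : QParam)

open LinearMap

/-! ### Scalars -/

theorem t_sq_pow_ne_one (n : ℕ) (hn : 0 < n) : P.t ^ (2 * n) ≠ 1 := by
  intro h
  refine t_zpow_pow_ne P n hn ?_
  have e : P.t ^ (-2 : ℤ) = (P.t ^ 2)⁻¹ := by rw [zpow_neg]; rfl
  rw [e, inv_pow, ← pow_mul, h, inv_one]

theorem t_sub_inv_ne_zero : P.t - P.t⁻¹ ≠ 0 := by
  intro h
  refine t_sq_pow_ne_one P 1 one_pos ?_
  have ht := P.t_ne_zero
  field_simp at h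
  linear_combination h

theorem eb_ne_zero : eb P ≠ 0 := by
  refine div_ne_zero (t_sub_inv_ne_zero P) fun h => ?_
  have hq := P.q_ne_zero
  refine P.q_not_root 2 two_pos ?_
  field_simp at h
  linear_combination h

/-- The `q`-integer `[n] = (t^n - t^{-n}) / (t - t⁻¹)`. -/
noncomputable def qInt (n : ℕ) : ℂ := (P.t ^ n - (P.t⁻¹) ^ n) / (P.t - P.t⁻¹)

@[simp] theorem qInt_one : qInt P 1 = 1 := by
  rw [qInt, pow_one, pow_one, div_self (t_sub_inv_ne_zero P)]

theorem qInt_succ (n : ℕ) : qInt P (n + 1) = P.t * qInt P n + (P.t⁻¹) ^ n := by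
  rw [qInt, qInt, mul_div_assoc', div_add' _ _ _ (t_sub_inv_ne_zero P)]
  congr 1
  ring

theorem qInt_succ' (n : ℕ) : qInt P (n + 1) = P.t⁻¹ * qInt P n + P.t ^ n := by
  rw [qInt, qInt, mul_div_assoc', div_add' _ _ _ (t_sub_inv_ne_zero P)]
  congr 1
  ring

theorem qInt_add (m n : ℕ) : qInt P m + P.t ^ (m + n) * qInt P n = P.t ^ n * qInt P (m + n) := by
  have ht := P.t_ne_zero
  simp only [qInt, mul_div_assoc', ← add_div]
  congr 1
  simp only [inv_pow, pow_add]
  field_simp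
  ring

theorem qInt_ne_zero (n : ℕ) (hn : 0 < n) : qInt P n ≠ 0 := by
  refine div_ne_zero (fun h => t_sq_pow_ne_one P n hn ?_) (t_sub_inv_ne_zero P)
  have ht := P.t_ne_zero
  rw [inv_pow] at h
  field_simp at h
  rw [mul_comm, pow_mul]
  linear_combination h

/-! ### The right action on monomials -/

theorem slice_e_a (u : A P) : slice P (eFun P) (gen P .a * u)
    = P.t • (gen P .a * slice P (eFun P) u) + eb P • (gen P .c * u) := by
  rw [slice_gen_mul]; simp [pre_e, prePar_e]

theorem slice_e_b (u : A P) : slice P (eFun P) (gen P .b * u)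
    = -P.t • (gen P .b * slice P (eFun P) u) + eb P • (gen P .d * u) := by
  rw [slice_gen_mul]; simp only [pre_e, prePar_e, slice_smul, slice_counit, mul_smul_comm]

theorem slice_e_c (u : A P) : slice P (eFun P) (gen P .c * u)
    = P.t⁻¹ • (gen P .c * slice P (eFun P) u) := by
  rw [slice_gen_mul]; simp [pre_e, prePar_e]

theorem slice_e_d (u : A P) : slice P (eFun P) (gen P .d * u)
    = -P.t⁻¹ • (gen P .d * slice P (eFun P) u) := by
  rw [slice_gen_mul]
  simp only [pre_e, prePar_e, slice_smul, slice_zero, mul_zero, zero_add, mul_smul_comm]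

theorem slice_fk_a (u : A P) : slice P (fkFun P) (gen P .a * u)
    = P.t • (gen P .a * slice P (fkFun P) u) := by
  rw [slice_gen_mul]; simp [pre_fk_a, prePar_fk_b]

theorem slice_fk_c (u : A P) : slice P (fkFun P) (gen P .c * u)
    = P.t • (gen P .a * u) + P.t⁻¹ • (gen P .c * slice P (fkFun P) u) := by
  rw [slice_gen_mul]; simp [pre_fk_c, prePar_fk_d]

theorem slice_k_a (u : A P) : slice P (kHom P).toLinearMap (gen P .a * u)
    = P.t • (gen P .a * slice P (kHom P).toLinearMap u) := by
  rw [slice_gen_mul]; simp [pre_k, prePar_k]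

theorem slice_k_c (u : A P) : slice P (kHom P).toLinearMap (gen P .c * u)
    = -P.t⁻¹ • (gen P .c * slice P (kHom P).toLinearMap u) := by
  rw [slice_gen_mul]
  simp only [pre_k, prePar_k, slice_smul, zero_smul, slice_zero, mul_zero, zero_add, mul_smul_comm]

theorem slice_e_a_pow (m : ℕ) (u : A P) : slice P (eFun P) (gen P .a ^ (m + 1) * u)
    = P.t ^ (m + 1) • (gen P .a ^ (m + 1) * slice P (eFun P) u)
      + (eb P * qInt P (m + 1)) • (gen P .a ^ m * (gen P .c * u)) := by
  induction m with
  | zero => simp [slice_e_a]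
  | succ m ih =>
    rw [pow_succ' _ (m + 1), mul_assoc, slice_e_a, ih, ← mul_assoc (gen P .c), c_mul_a_pow,
      qInt_succ P (m + 1)]
    simp only [mul_add, mul_smul_comm, smul_mul_assoc, ← mul_assoc, ← pow_succ', smul_add,
      smul_smul]
    module

theorem slice_e_b_pow (m : ℕ) (u : A P) : slice P (eFun P) (gen P .b ^ (m + 1) * u)
    = (-P.t) ^ (m + 1) • (gen P .b ^ (m + 1) * slice P (eFun P) u)
      + (eb P * ((-1) ^ m * qInt P (m + 1))) • (gen P .b ^ m * (gen P .d * u)) := by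
  induction m with
  | zero =>
    rw [zero_add, pow_one, pow_one, slice_e_b, qInt_one]
    simp
  | succ m ih =>
    rw [pow_succ' _ (m + 1), mul_assoc, slice_e_b, ih, ← mul_assoc (gen P .d), d_mul_b_pow,
      qInt_succ P (m + 1), ← neg_one_mul P.t⁻¹, mul_pow]
    simp only [mul_add, mul_smul_comm, smul_mul_assoc, ← mul_assoc, ← pow_succ', smul_add,
      smul_smul]
    module

theorem slice_e_c_pow (m : ℕ) (u : A P) : slice P (eFun P) (gen P .c ^ m * u)
    = (P.t⁻¹) ^ m • (gen P .c ^ m * slice P (eFun P) u) := by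
  induction m with
  | zero => simp
  | succ m ih =>
    rw [pow_succ', mul_assoc, slice_e_c, ih, mul_smul_comm, smul_smul, ← mul_assoc, ← pow_succ',
      ← pow_succ']

theorem slice_e_d_pow (m : ℕ) (u : A P) : slice P (eFun P) (gen P .d ^ m * u)
    = (-P.t⁻¹) ^ m • (gen P .d ^ m * slice P (eFun P) u) := by
  induction m with
  | zero => simp
  | succ m ih =>
    rw [pow_succ', mul_assoc, slice_e_d, ih, mul_smul_comm, smul_smul, ← mul_assoc, ← pow_succ',
      ← pow_succ']

theorem slice_e_sigma_pow (s : ℕ) : slice P (eFun P) (gen P .σ ^ s) = 0 := by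
  simpa using slice_e_zero P 0 s

theorem slice_fk_a_pow (m : ℕ) (u : A P) : slice P (fkFun P) (gen P .a ^ m * u)
    = P.t ^ m • (gen P .a ^ m * slice P (fkFun P) u) := by
  induction m with
  | zero => simp
  | succ m ih =>
    rw [pow_succ', mul_assoc, slice_fk_a, ih, mul_smul_comm, smul_smul, ← mul_assoc, ← pow_succ',
      ← pow_succ']

theorem slice_fk_c_pow (m : ℕ) (u : A P) : slice P (fkFun P) (gen P .c ^ (m + 1) * u)
    = (P.t⁻¹) ^ (m + 1) • (gen P .c ^ (m + 1) * slice P (fkFun P) u)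
      + (P.t * (P.t⁻¹) ^ m * qInt P (m + 1)) • (gen P .a * (gen P .c ^ m * u)) := by
  have ht := P.t_ne_zero
  induction m with
  | zero => simp [slice_fk_c, add_comm]
  | succ m ih =>
    have e : gen P .c * (gen P .a * (gen P .c ^ m * u))
        = P.t⁻¹ • (gen P .a * (gen P .c ^ (m + 1) * u)) := by
      rw [← mul_assoc, gen_ca, smul_mul_assoc, mul_assoc, ← mul_assoc (gen P .c), ← pow_succ']
    rw [pow_succ' _ (m + 1), mul_assoc, slice_fk_c, ih, mul_add, mul_smul_comm, mul_smul_comm, e,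
      ← mul_assoc (gen P .c), qInt_succ' P (m + 1)]
    simp only [inv_pow]
    match_scalars <;> field_simp <;> ring

theorem slice_k_a_pow (m : ℕ) (u : A P) : slice P (kHom P).toLinearMap (gen P .a ^ m * u)
    = P.t ^ m • (gen P .a ^ m * slice P (kHom P).toLinearMap u) := by
  induction m with
  | zero => simp
  | succ m ih =>
    rw [pow_succ', mul_assoc, slice_k_a, ih, mul_smul_comm, smul_smul, ← mul_assoc, ← pow_succ',
      ← pow_succ']

theorem slice_k_c_pow (m : ℕ) (u : A P) : slice P (kHom P).toLinearMap (gen P .c ^ m * u)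
    = (-P.t⁻¹) ^ m • (gen P .c ^ m * slice P (kHom P).toLinearMap u) := by
  induction m with
  | zero => simp
  | succ m ih =>
    rw [pow_succ', mul_assoc, slice_k_c, ih, mul_smul_comm, smul_smul, ← mul_assoc, ← pow_succ',
      ← pow_succ']

/-- The basis vectors `a^{N-n} c^n σ^s` of the left subcomodule of degree `N`. -/
noncomputable def rung (N s n : ℕ) : A P := gen P .a ^ (N - n) * (gen P .c ^ n * gen P .σ ^ s)

theorem counit_rung_zero (N s : ℕ) : counitHom P (rung P N s 0) = 1 := by
  simp [rung]

/-- The bottom vector `a^N σ^s` is nonzero because the counit is `1` on it, and the coefficients are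
`q`-integers up to nonzero factors. -/
theorem isLadder_rung (N s : ℕ) :
    IsLadder (slice P (eFun P)) (slice P (fkFun P)) (slice P (kHom P).toLinearMap - 1) N
      (rung P N s) (fun n => eb P * qInt P (N - n))
      (fun n => P.t ^ (N - n) * (P.t * (P.t⁻¹) ^ (n - 1) * qInt P n))
      (fun n => P.t ^ (N - n) * ((-P.t⁻¹) ^ n * (-1) ^ s) - 1) where
  raise n hn := by
    obtain ⟨m, hm⟩ : ∃ m, N - n = m + 1 := ⟨N - n - 1, by omega⟩
    have hm' : N - (n + 1) = m := by omega
    simp only [rung, hm, hm', slice_e_a_pow, slice_e_c_pow, slice_e_sigma_pow, mul_zero, smul_zero,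
      zero_add]
    rw [← mul_assoc (gen P .c), ← pow_succ']
  raise_top := by
    simp [rung, slice_e_c_pow, slice_e_sigma_pow]
  lower n hn := by
    have h0 : slice P (fkFun P) (gen P .σ ^ s) = 0 := by simpa using slice_fk_zero P 0 s
    simp only [rung, slice_fk_a_pow, slice_fk_c_pow, h0, mul_zero, smul_zero, zero_add,
      mul_smul_comm, smul_smul, Nat.add_sub_cancel]
    rw [← mul_assoc (gen P .a ^ _) (gen P .a), ← pow_succ, show N - (n + 1) + 1 = N - n by omega]
  lower_bot := by
    simpa [rung] using slice_fk_zero P N s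
  diag n hn := by
    have h0 : kHom P (gen P .σ ^ s) = (-1) ^ s := by simp
    simp only [rung, LinearMap.sub_apply, Module.End.one_apply, slice_k_a_pow, slice_k_c_pow,
      slice_sigma, AlgHom.toLinearMap_apply, h0, mul_smul_comm, smul_smul, sub_smul, one_smul]
  e_ne n hn := mul_ne_zero (eb_ne_zero P) (qInt_ne_zero P _ (by omega))
  f_ne n hn := by
    have ht := P.t_ne_zero
    exact mul_ne_zero (pow_ne_zero _ ht) (mul_ne_zero (mul_ne_zero ht (pow_ne_zero _
      (inv_ne_zero ht))) (qInt_ne_zero P _ (by omega)))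
  bot_ne h := by
    have := counit_rung_zero P N s
    rw [h, map_zero] at this
    exact zero_ne_one this

/-! ### Right slices -/

/-- `∑ u₁ φ(u₂)` for a linear function `φ` on `𝒜`. -/
noncomputable def coslice (φ : A P →ₗ[ℂ] ℂ) : A P →ₗ[ℂ] A P :=
  (TensorProduct.rid ℂ (A P)).toLinearMap ∘ₗ lTensor (A P) φ ∘ₗ comulLin P

@[simp] theorem coslice_smul (z : ℂ) (φ : A P →ₗ[ℂ] ℂ) (u : A P) :
    coslice P (z • φ) u = z • coslice P φ u := by
  simp [coslice, lTensor_smul]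

@[simp] theorem coslice_zero (u : A P) : coslice P 0 u = 0 := by
  simp [coslice]

theorem coslice_counit (u : A P) : coslice P (counitHom P).toLinearMap u = u := by
  have h := Coalgebra.lTensor_counit_comul (R := ℂ) u
  change lTensor (A P) (counitHom P).toLinearMap (comulLin P u) = _ at h
  simp [coslice, h]

/-- Slices on the left and on the right commute, by coassociativity. -/
theorem coslice_slice (φ ψ : A P →ₗ[ℂ] ℂ) (u : A P) :
    coslice P ψ (slice P φ u) = slice P φ (coslice P ψ u) := by
  let g : A P ⊗[ℂ] (A P ⊗[ℂ] A P) →ₗ[ℂ] A P :=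
    (TensorProduct.lid ℂ (A P)).toLinearMap ∘ₗ TensorProduct.map φ
      ((TensorProduct.rid ℂ (A P)).toLinearMap ∘ₗ lTensor (A P) ψ)
  have h1 : ∀ T : A P ⊗[ℂ] A P,
      coslice P ψ ((TensorProduct.lid ℂ (A P)) (rTensor (A P) φ T))
        = g (lTensor (A P) (comulLin P) T) := by
    intro T
    induction T with
    | zero => simp
    | add S T hS hT => simp only [map_add, hS, hT]
    | tmul x y => simp [g, coslice]
  have h2 : ∀ T : A P ⊗[ℂ] A P,
      slice P φ ((TensorProduct.rid ℂ (A P)) (lTensor (A P) ψ T))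
        = g (TensorProduct.assoc ℂ _ _ _ (rTensor (A P) (comulLin P) T)) := by
    intro T
    induction T with
    | zero => simp
    | add S T hS hT => simp only [map_add, hS, hT]
    | tmul x y =>
      simp only [lTensor_tmul, rTensor_tmul, TensorProduct.rid_tmul, map_smul, slice, coe_comp,
        Function.comp_apply, LinearEquiv.coe_coe]
      generalize comulLin P x = T
      induction T with
      | zero => simp
      | add S T hS hT => simp only [map_add, smul_add, TensorProduct.add_tmul, hS, hT]
      | tmul z w => simp [g, smul_smul, mul_comm]
  have h3 := Coalgebra.coassoc_apply (R := ℂ) u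
  change TensorProduct.assoc ℂ _ _ _ (rTensor (A P) (comulLin P) (comulLin P u))
    = lTensor (A P) (comulLin P) (comulLin P u) at h3
  calc coslice P ψ (slice P φ u) = g (lTensor (A P) (comulLin P) (comulLin P u)) := h1 _
    _ = slice P φ (coslice P ψ u) := by rw [← h3]; exact (h2 _).symm

theorem coslice_gen_mul (φ : A P →ₗ[ℂ] ℂ) (g : AGen) (u : A P) :
    coslice P φ (gen P g * u) = match g with
      | .a => gen P .a * coslice P (pre P φ .a) u + gen P .b * par P (coslice P (pre P φ .c) u)
      | .b => gen P .a * par P (coslice P (pre P φ .b) u) + gen P .b * coslice P (pre P φ .d) u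
      | .c => gen P .c * coslice P (pre P φ .a) u + gen P .d * par P (coslice P (pre P φ .c) u)
      | .d => gen P .c * par P (coslice P (pre P φ .b) u) + gen P .d * coslice P (pre P φ .d) u
      | .σ => gen P .σ * coslice P (pre P φ .σ) u := by
  simp only [coslice, coe_comp, Function.comp_apply, comulLin_gen_mul]
  generalize comulLin P u = T
  induction T with
  | zero => cases g <;> simp
  | add S T hS hT =>
    simp only [map_add, hS, hT]
    cases g <;> simp only [mul_add] <;> abel
  | tmul z w => cases g <;> simp [comulOp, pre]

theorem coslice_sigma (φ : A P →ₗ[ℂ] ℂ) (s : ℕ) :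
    coslice P φ (gen P .σ ^ s) = φ (gen P .σ ^ s) • gen P .σ ^ s := by
  induction s generalizing φ with
  | zero => simp [coslice, comulLin_one]
  | succ s ih => rw [pow_succ', coslice_gen_mul]; simp only [ih]; simp [pre]

theorem coslice_kinv_monomial (m n s : ℕ) :
    coslice P (kinvHom P).toLinearMap (gen P .a ^ m * (gen P .b ^ n * gen P .σ ^ s))
      = ((P.t⁻¹) ^ m * (-P.t) ^ n * (-1) ^ s) •
        (gen P .a ^ m * (gen P .b ^ n * gen P .σ ^ s)) := by
  induction m with
  | zero =>
    simp only [pow_zero, one_mul]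
    induction n with
    | zero => simp [coslice_sigma]
    | succ n ih =>
      rw [pow_succ', mul_assoc, coslice_gen_mul]
      simp only [pre_kinv, coslice_smul, ih, zero_smul, coslice_zero, map_zero, mul_zero, zero_add,
        mul_smul_comm, smul_smul]
      rw [pow_succ', mul_assoc]
  | succ m ih =>
    rw [pow_succ', mul_assoc, coslice_gen_mul]
    simp only [pre_kinv, coslice_smul, ih, zero_smul, coslice_zero, map_zero, mul_zero, add_zero,
      mul_smul_comm, smul_smul]
    congr 1
    ring

theorem coslice_f_zero (n s : ℕ) :
    coslice P (fFun P) (gen P .b ^ n * gen P .σ ^ s) = 0 := by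
  have hs : fFun P (gen P .σ ^ s) = 0 := by
    induction s with
    | zero => simp [fFun_one]
    | succ s ih => rw [pow_succ', fFun_mul, ih]; simp [fFun_gen]
  induction n with
  | zero => simp [coslice_sigma, hs]
  | succ n ih =>
    rw [pow_succ', mul_assoc, coslice_gen_mul]
    simp [pre_f, ih]

theorem coslice_f_monomial (m n s : ℕ) :
    coslice P (fFun P) (gen P .a ^ (m + 1) * (gen P .b ^ n * gen P .σ ^ s))
      = ((-1) ^ s * P.t ^ n * ((P.t⁻¹) ^ m * qInt P (m + 1))) •
        (gen P .a ^ m * (gen P .b ^ (n + 1) * gen P .σ ^ s)) := by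
  have ht := P.t_ne_zero
  have hpar : ∀ m : ℕ, gen P .b * par P (gen P .a ^ m * (gen P .b ^ n * gen P .σ ^ s))
      = ((-1 : ℂ) ^ n * (P.t⁻¹) ^ m) • (gen P .a ^ m * (gen P .b ^ (n + 1) * gen P .σ ^ s)) := by
    intro m
    simp only [map_mul, map_pow, par_a, par_b, par_σ, ← neg_one_smul ℂ (gen P .b), smul_pow,
      smul_mul_assoc, mul_smul_comm]
    rw [← mul_assoc, b_mul_a_pow, smul_mul_assoc, smul_smul, mul_assoc, ← mul_assoc (gen P .b),
      ← pow_succ']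
  have hsign : (-P.t) ^ n = (-1) ^ n * P.t ^ n := by rw [← mul_pow, neg_one_mul]
  have hn : (-1 : ℂ) ^ n * (-1) ^ n = 1 := by rw [← mul_pow]; simp
  induction m with
  | zero =>
    have h := coslice_kinv_monomial P 0 n s
    rw [pow_zero, one_mul] at h
    have h' := hpar 0
    rw [pow_zero, one_mul] at h'
    rw [zero_add, pow_one, coslice_gen_mul]
    simp only [pre_f, coslice_smul, coslice_f_zero, h, map_smul, mul_smul_comm, h', smul_smul,
      smul_zero, mul_zero, zero_add, pow_zero, one_mul]
    rw [hsign, qInt_one]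
    congr 1
    linear_combination (P.t ^ n * (-1) ^ s) * hn
  | succ m ih =>
    rw [pow_succ' _ (m + 1), mul_assoc, coslice_gen_mul]
    simp only [pre_f, ih, coslice_kinv_monomial, map_smul, mul_smul_comm, hpar,
      smul_smul, one_smul]
    rw [hsign, ← mul_assoc (gen P .a), ← pow_succ', ← add_smul]
    congr 1
    rw [qInt_succ P (m + 1)]
    have e : P.t * P.t⁻¹ = 1 := mul_inv_cancel₀ ht
    linear_combination ((P.t⁻¹) ^ (m + 1) * P.t ^ n * (-1) ^ s * (P.t⁻¹) ^ (m + 1)) * hn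
      - ((-1) ^ s * P.t ^ n * (P.t⁻¹) ^ m * qInt P (m + 1)) * e

/-- A subspace that contains the `a^N σ^s` and is stable under the right action of `e` and under
right slices is everything. The right slice by `f` turns the factors `a` into `b`, and the action
of `e` then produces the remaining monomials, up to monomials reached before. -/
theorem eq_top_of_stable (S : Submodule ℂ (A P))
    (h0 : ∀ N s : ℕ, gen P .a ^ N * gen P .σ ^ s ∈ S)
    (he : ∀ u ∈ S, slice P (eFun P) u ∈ S)
    (hf : ∀ u ∈ S, coslice P (fFun P) u ∈ S) : S = ⊤ := by
  have ht := P.t_ne_zero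
  have hab : ∀ z x s : ℕ, gen P .a ^ x * (gen P .b ^ z * gen P .σ ^ s) ∈ S := by
    intro z
    induction z with
    | zero => intro x s; simpa using h0 x s
    | succ z ih =>
      intro x s
      have h1 := hf _ (ih (x + 1) s)
      rw [coslice_f_monomial] at h1
      refine (Submodule.smul_mem_iff _ ?_).1 h1
      exact mul_ne_zero (mul_ne_zero (pow_ne_zero _ (by simp)) (pow_ne_zero _ ht))
        (mul_ne_zero (pow_ne_zero _ (inv_ne_zero ht)) (qInt_ne_zero P _ (by omega)))
  -- `e` maps `a^{x+1} c^y b^z σ^s` to a nonzero multiple of `a^x c^{y+1} b^z σ^s` plus a multiple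
  -- of `a^x c^y b^{z-1} σ^{s+1}`, which is available by induction on `y`
  have hacb : ∀ y x z s : ℕ,
      gen P .a ^ x * (gen P .c ^ y * (gen P .b ^ z * gen P .σ ^ s)) ∈ S := by
    intro y
    induction y with
    | zero => intro x z s; simpa using hab z x s
    | succ y ih =>
      intro x z s
      have h1 := he _ (ih (x + 1) z s)
      rw [slice_e_a_pow, slice_e_c_pow, ← mul_assoc (gen P .c), ← pow_succ'] at h1
      cases z with
      | zero =>
        simp only [pow_zero, one_mul, slice_e_sigma_pow, mul_zero, smul_zero, zero_add] at h1 ⊢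
        exact (Submodule.smul_mem_iff _ (mul_ne_zero (eb_ne_zero P)
          (qInt_ne_zero P _ (by omega)))).1 h1
      | succ z =>
        have e1 : gen P .a ^ (x + 1) * (gen P .c ^ y * (gen P .b ^ z *
              (gen P .d * gen P .σ ^ s)))
            = ((-P.t) ^ y * (-P.t) ^ z) • ((-1 : ℂ) ^ z * (-1 : ℂ) ^ y) •
                (gen P .a ^ x * (gen P .c ^ y * (gen P .b ^ z * gen P .σ ^ (s + 1))))
              + ((-P.t) ^ y * (-P.t) ^ z * P.t * (-1) ^ y) •
                (gen P .a ^ x * (gen P .c ^ (y + 1) * (gen P .b ^ (z + 1) * gen P .σ ^ s))) := by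
          have eb : gen P .b ^ z * gen P .d = (-P.t) ^ z • (gen P .d * gen P .b ^ z) := by
            rw [d_mul_b_pow, smul_smul, ← mul_pow]; simp [ht]
          have ec : gen P .c ^ y * gen P .d = (-P.t) ^ y • (gen P .d * gen P .c ^ y) := by
            rw [d_mul_c_pow, smul_smul, ← mul_pow]; simp [ht]
          have es : par P (gen P .c ^ y * (gen P .b ^ z * gen P .σ ^ s))
              = ((-1 : ℂ) ^ z * (-1) ^ y) • (gen P .c ^ y * (gen P .b ^ z * gen P .σ ^ s)) := by
            simp only [map_mul, map_pow, par_b, par_c, par_σ, ← neg_one_smul ℂ (gen P .b),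
              ← neg_one_smul ℂ (gen P .c), smul_pow, smul_mul_assoc, mul_smul_comm, smul_smul]
          have e2 : gen P .c * (gen P .b * (gen P .c ^ y * (gen P .b ^ z * gen P .σ ^ s)))
              = (-1 : ℂ) ^ y • (gen P .c ^ (y + 1) * (gen P .b ^ (z + 1) * gen P .σ ^ s)) := by
            rw [← mul_assoc (gen P .b), b_mul_c_pow, smul_mul_assoc, mul_smul_comm, mul_assoc,
              ← mul_assoc (gen P .b), ← pow_succ', ← mul_assoc, ← pow_succ']
          calc gen P .a ^ (x + 1) * (gen P .c ^ y * (gen P .b ^ z * (gen P .d * gen P .σ ^ s)))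
              = gen P .a ^ (x + 1) * (gen P .c ^ y * ((gen P .b ^ z * gen P .d) *
                  gen P .σ ^ s)) := by rw [mul_assoc (gen P .b ^ z)]
            _ = (-P.t) ^ z • (gen P .a ^ (x + 1) * ((gen P .c ^ y * gen P .d) * (gen P .b ^ z *
                  gen P .σ ^ s))) := by
                rw [eb]; simp only [smul_mul_assoc, mul_smul_comm, mul_assoc]
            _ = ((-P.t) ^ y * (-P.t) ^ z) • (gen P .a ^ x * ((gen P .a * gen P .d) *
                  (gen P .c ^ y * (gen P .b ^ z * gen P .σ ^ s)))) := by
                rw [ec, pow_succ]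
                simp only [smul_mul_assoc, mul_smul_comm, mul_assoc, smul_smul]
                rw [mul_comm]
            _ = _ := by
                rw [gen_ad_eq, add_mul, sigma_mul, es, smul_mul_assoc, smul_mul_assoc, mul_assoc,
                  mul_assoc, ← pow_succ, mul_assoc (gen P .c), e2, mul_add, mul_smul_comm,
                  mul_smul_comm, mul_smul_comm]
                module
        rw [slice_e_b_pow, slice_e_sigma_pow, mul_zero, smul_zero, zero_add, mul_smul_comm,
          mul_smul_comm, mul_smul_comm, e1, smul_add, smul_add, smul_add, add_assoc] at h1
        have h2 : ∀ c : ℂ,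
            c • (gen P .a ^ x * (gen P .c ^ y * (gen P .b ^ z * gen P .σ ^ (s + 1)))) ∈ S :=
          fun c => Submodule.smul_mem _ _ (ih x z (s + 1))
        simp only [smul_smul] at h1
        have h3 := (Submodule.add_mem_iff_right _ (h2 _)).1 h1
        rw [← add_smul] at h3
        refine (Submodule.smul_mem_iff _ ?_).1 h3
        have hy : (-1 : ℂ) ^ y * (-1) ^ y = 1 := by rw [← mul_pow]; simp
        have hz : (-1 : ℂ) ^ z * (-1) ^ z = 1 := by rw [← mul_pow]; simp
        have hty : (P.t⁻¹) ^ y * P.t ^ y = 1 := by rw [← mul_pow, inv_mul_cancel₀ ht, one_pow]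
        -- the two contributions to the coefficient add up to a single `q`-integer
        have e3 : eb P * (qInt P (x + 1) + P.t ^ (x + 1 + (z + 1)) * qInt P (z + 1)) ≠ 0 := by
          rw [qInt_add]
          exact mul_ne_zero (eb_ne_zero P) (mul_ne_zero (pow_ne_zero _ ht)
            (qInt_ne_zero P _ (by omega)))
        convert e3 using 1
        rw [neg_pow P.t y, neg_pow P.t z]
        have e4 : P.t ^ (x + 1) * (P.t⁻¹ ^ y * (eb P * ((-1) ^ z * qInt P (z + 1)) *
            ((-1) ^ y * P.t ^ y * ((-1) ^ z * P.t ^ z) * P.t * (-1) ^ y)))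
            = (((-1) ^ y * (-1) ^ y) * ((-1) ^ z * (-1) ^ z) * (P.t⁻¹ ^ y * P.t ^ y)) *
              (eb P * P.t ^ (x + 1 + (z + 1)) * qInt P (z + 1)) := by ring
        rw [hy, hz, hty] at e4
        linear_combination e4
  refine eq_top_of_monomials_mem P S (fun x y z s => hacb y x z s) ?_
  -- without factors `a`, the action of `e` only turns one `b` into `d`
  have hcbd : ∀ w y z s : ℕ,
      gen P .c ^ y * (gen P .b ^ z * (gen P .d ^ w * gen P .σ ^ s)) ∈ S := by
    intro w
    induction w with
    | zero => intro y z s; simpa using hacb y 0 z s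
    | succ w ih =>
      intro y z s
      have h1 := he _ (ih y (z + 1) s)
      rw [slice_e_c_pow, slice_e_b_pow, slice_e_d_pow, slice_e_sigma_pow, mul_zero, smul_zero,
        mul_zero, smul_zero, zero_add, mul_smul_comm, smul_smul, ← mul_assoc (gen P .d),
        ← pow_succ'] at h1
      refine (Submodule.smul_mem_iff _ ?_).1 h1
      exact mul_ne_zero (pow_ne_zero _ (inv_ne_zero ht)) (mul_ne_zero (eb_ne_zero P)
        (mul_ne_zero (pow_ne_zero _ (by simp)) (qInt_ne_zero P _ (by omega))))
  exact fun y z w s => hcbd w y z s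

end QOsp

namespace QOsp
variable (P : QParam)

open LinearMap

/-! ### The algebra as a sum of images of ladders -/

/-- Right slices compose to the right slice by the convolution product, by coassociativity. -/
theorem coslice_coslice (φ ψ : A P →ₗ[ℂ] ℂ) (u : A P) :
    coslice P φ (coslice P ψ u) = coslice P (conv P φ ψ) u := by
  let g : A P ⊗[ℂ] (A P ⊗[ℂ] A P) →ₗ[ℂ] A P :=
    (TensorProduct.rid ℂ (A P)).toLinearMap ∘ₗ
      lTensor (A P) (mul' ℂ ℂ ∘ₗ TensorProduct.map φ ψ)
  have h1 : ∀ T : A P ⊗[ℂ] A P,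
      (TensorProduct.rid ℂ (A P)) (lTensor (A P) (conv P φ ψ) T)
        = g (lTensor (A P) (comulLin P) T) := by
    intro T
    induction T with
    | zero => simp
    | add S T hS hT => simp only [map_add, hS, hT]
    | tmul x y => simp [g, conv]
  have h2 : ∀ T : A P ⊗[ℂ] A P,
      coslice P φ ((TensorProduct.rid ℂ (A P)) (lTensor (A P) ψ T))
        = g (TensorProduct.assoc ℂ _ _ _ (rTensor (A P) (comulLin P) T)) := by
    intro T
    induction T with
    | zero => simp
    | add S T hS hT => simp only [map_add, hS, hT]
    | tmul x y =>
      simp only [lTensor_tmul, rTensor_tmul, TensorProduct.rid_tmul, map_smul, coslice, coe_comp,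
        Function.comp_apply, LinearEquiv.coe_coe]
      generalize comulLin P x = T
      induction T with
      | zero => simp
      | add S T hS hT => simp only [map_add, smul_add, TensorProduct.add_tmul, hS, hT]
      | tmul z w => simp [g, smul_smul, mul_comm]
  have h3 := Coalgebra.coassoc_apply (R := ℂ) u
  change TensorProduct.assoc ℂ _ _ _ (rTensor (A P) (comulLin P) (comulLin P u))
    = lTensor (A P) (comulLin P) (comulLin P u) at h3
  calc coslice P φ (coslice P ψ u)
      = g (TensorProduct.assoc ℂ _ _ _ (rTensor (A P) (comulLin P) (comulLin P u))) := h2 _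
    _ = coslice P (conv P φ ψ) u := by rw [h3]; exact (h1 _).symm

/-- `𝒜` is the sum of the right slices of the subcomodules with bases `a^{N-n} c^n σ^s`. -/
theorem iSup_map_coslice : ⨆ i : ℕ × Fin 2 × (A P →ₗ[ℂ] ℂ),
    (Submodule.span ℂ (rung P i.1 i.2.1 '' Set.Iic i.1)).map (coslice P i.2.2) = ⊤ := by
  set C := ⨆ i : ℕ × Fin 2 × (A P →ₗ[ℂ] ℂ),
    (Submodule.span ℂ (rung P i.1 i.2.1 '' Set.Iic i.1)).map (coslice P i.2.2) with hC
  have hmem : ∀ (N : ℕ) (s : Fin 2) (φ : A P →ₗ[ℂ] ℂ),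
      ∀ v ∈ Submodule.span ℂ (rung P N s '' Set.Iic N), coslice P φ v ∈ C := fun N s φ v hv =>
    Submodule.mem_iSup_of_mem (N, s, φ) ⟨v, hv, rfl⟩
  refine eq_top_of_stable P C (fun N s => ?_) (fun u hu => ?_) (fun u hu => ?_)
  · have h1 := hmem N ⟨s % 2, Nat.mod_lt _ two_pos⟩ (counitHom P).toLinearMap _
      (Submodule.subset_span ⟨0, Nat.zero_le N, rfl⟩)
    rw [coslice_counit] at h1
    rw [sigma_pow_mod]
    simpa [rung] using h1
  · have : C ≤ C.comap (slice P (eFun P)) := by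
      conv_lhs => rw [hC]
      rw [iSup_le_iff]
      rintro ⟨N, s, φ⟩ _ ⟨v, hv, rfl⟩
      rw [Submodule.mem_comap, ← coslice_slice]
      exact hmem N s φ _ ((isLadder_rung P N s).adjoin_apply_mem
        (Algebra.subset_adjoin (Set.mem_insert _ _)) hv)
    exact this hu
  · have : C ≤ C.comap (coslice P (fFun P)) := by
      conv_lhs => rw [hC]
      rw [iSup_le_iff]
      rintro ⟨N, s, φ⟩ _ ⟨v, hv, rfl⟩
      rw [Submodule.mem_comap, coslice_coslice]
      exact hmem N s _ v hv
    exact this hu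

/-! ### The normalised bases -/

/-- The vectors `ξ^{(ℓ)}_{n-ℓ} σ^s`, indexed by `0 ≤ n ≤ 2ℓ`. -/
noncomputable def xiRung (ℓ s n : ℕ) : A P := xi P ℓ ((n : ℤ) - ℓ) * gen P .σ ^ s

theorem xiRung_eq (ℓ s : ℕ) {n : ℕ} (hn : n ≤ 2 * ℓ) :
    xiRung P ℓ s n = xiNorm P ℓ n • rung P (2 * ℓ) s n := by
  have h1 : (n : ℤ) - ℓ ∈ idx ℓ := Finset.mem_Icc.2 (by omega)
  have h2 : ((ℓ : ℤ) - (n - ℓ)).toNat = 2 * ℓ - n := by omega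
  have h3 : ((ℓ : ℤ) + (n - ℓ)).toNat = n := by omega
  rw [xiRung, xi, if_pos h1, h2, h3, smul_mul_assoc, mul_assoc, rung]

theorem sum_idx {M : Type*} [AddCommMonoid M] (ℓ : ℕ) (g : ℤ → M) :
    ∑ i ∈ idx ℓ, g i = ∑ n ∈ Finset.range (2 * ℓ + 1), g ((n : ℤ) - ℓ) := by
  refine Finset.sum_bij' (fun i _ => (ℓ + i).toNat) (fun n _ => (n : ℤ) - ℓ) ?_ ?_ ?_ ?_ ?_
  · intro i hi
    have := Finset.mem_Icc.1 hi
    exact Finset.mem_range.2 (by omega)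
  · intro n hn
    have := Finset.mem_range.1 hn
    exact Finset.mem_Icc.2 (by omega)
  · intro i hi
    have := Finset.mem_Icc.1 hi
    omega
  · intro n hn
    omega
  · intro i hi
    have := Finset.mem_Icc.1 hi
    congr 1
    omega

/-- The coefficients `b_i` and `c_i` on the normalised bases are those of a ladder; they are nonzero
since the `ξ^{(ℓ)}_i σ^s` are nonzero multiples of the `a^{ℓ-i} c^{ℓ+i} σ^s`. -/
theorem isLadder_xiRung (ℓ s : ℕ) :
    IsLadder (slice P (eFun P)) (slice P (fkFun P)) (slice P (kHom P).toLinearMap - 1) (2 * ℓ)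
      (xiRung P ℓ s) (fun n => bCoeff P ℓ s ((n : ℤ) - ℓ)) (fun n => cCoeff P ℓ s ((n : ℤ) - ℓ))
      (fun n => aCoeff P ℓ s ((n : ℤ) - ℓ)) := by
  have hr := isLadder_rung P (2 * ℓ) s
  have hE : ∀ n : ℕ, slice P (eFun P) (xiRung P ℓ s n)
      = bCoeff P ℓ s ((n : ℤ) - ℓ) • xiRung P ℓ s (n + 1) := by
    intro n
    have h : rightAct P (ugen P .e) (xi P ℓ ((n : ℤ) - ℓ) * gen P .σ ^ s)
        = bCoeff P ℓ s ((n : ℤ) - ℓ) • (xi P ℓ ((n : ℤ) - ℓ + 1) * gen P .σ ^ s) :=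
      (exists_bCoeff P ℓ s ((n : ℤ) - ℓ)).choose_spec
    rw [rightAct_eq, pairing_e] at h
    rw [xiRung, h, xiRung, show (n : ℤ) - ℓ + 1 = ((n + 1 : ℕ) : ℤ) - ℓ by push_cast; ring]
  have hF : ∀ n : ℕ, slice P (fkFun P) (xiRung P ℓ s (n + 1))
      = cCoeff P ℓ s (((n + 1 : ℕ) : ℤ) - ℓ) • xiRung P ℓ s n := by
    intro n
    have h : rightAct P (ugen P .f * ugen P .k) (xi P ℓ (((n + 1 : ℕ) : ℤ) - ℓ) * gen P .σ ^ s)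
        = cCoeff P ℓ s (((n + 1 : ℕ) : ℤ) - ℓ) •
          (xi P ℓ (((n + 1 : ℕ) : ℤ) - ℓ - 1) * gen P .σ ^ s) :=
      (exists_cCoeff P ℓ s (((n + 1 : ℕ) : ℤ) - ℓ)).choose_spec
    rw [rightAct_eq, pairing_fk] at h
    rw [xiRung, h, xiRung, show ((n + 1 : ℕ) : ℤ) - ℓ - 1 = (n : ℤ) - ℓ by push_cast; ring]
  refine ⟨fun n _ => hE n, ?_, fun n _ => hF n, ?_, fun n _ => ?_, fun n hn h0 => ?_,
    fun n hn h0 => ?_, ?_⟩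
  · rw [xiRung_eq P ℓ s le_rfl, map_smul, hr.raise_top, smul_zero]
  · rw [xiRung_eq P ℓ s (Nat.zero_le _), map_smul, hr.lower_bot, smul_zero]
  · have h : rightAct P (ugen P .k - 1) (xi P ℓ ((n : ℤ) - ℓ) * gen P .σ ^ s)
        = aCoeff P ℓ s ((n : ℤ) - ℓ) • (xi P ℓ ((n : ℤ) - ℓ) * gen P .σ ^ s) :=
      (exists_aCoeff P ℓ s ((n : ℤ) - ℓ)).choose_spec
    rw [rightAct_eq, pairing_k_sub, slice_sub, slice_counit] at h
    exact h
  · have h := hE n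
    rw [h0, zero_smul, xiRung_eq P ℓ s hn.le, map_smul, hr.raise n hn] at h
    exact smul_ne_zero (xiNorm_ne P _ _) (smul_ne_zero (hr.e_ne n hn) (hr.ne_zero hn)) h
  · have h := hF n
    rw [h0, zero_smul, xiRung_eq P ℓ s hn, map_smul, hr.lower n hn] at h
    exact smul_ne_zero (xiNorm_ne P _ _) (smul_ne_zero (hr.f_ne n hn) (hr.ne_zero hn.le)) h
  · rw [xiRung_eq P ℓ s (Nat.zero_le _)]
    exact smul_ne_zero (xiNorm_ne P _ _) hr.bot_ne

/-- The eigenvalues of `k` on a ladder are `±t^{N-2n}`. As `t²` is not a root of unity, `1` occurs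
only in the middle, `N = 2n`. -/
theorem kEigenvalue_eq_one_iff {N n : ℕ} (s : ℕ) (hn : n ≤ N) :
    P.t ^ (N - n) * ((-P.t⁻¹) ^ n * (-1) ^ s) = 1 ↔ N = 2 * n ∧ Even (n + s) := by
  have ht := P.t_ne_zero
  have hform : P.t ^ (N - n) * ((-P.t⁻¹) ^ n * (-1) ^ s) * P.t ^ n
      = (-1) ^ (n + s) * P.t ^ (N - n) := by
    have e : (P.t⁻¹) ^ n * P.t ^ n = 1 := by rw [← mul_pow, inv_mul_cancel₀ ht, one_pow]
    rw [neg_pow P.t⁻¹, pow_add]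
    linear_combination (P.t ^ (N - n) * (-1) ^ n * (-1) ^ s) * e
  constructor
  · intro h
    rw [h, one_mul] at hform
    have hN : N - n = n := by
      have hsq : P.t ^ (2 * n) = P.t ^ (2 * (N - n)) := by
        rw [mul_comm 2 n, pow_mul, hform, mul_pow, ← pow_mul (-1 : ℂ), mul_comm (n + s) 2,
          pow_mul (-1 : ℂ), neg_one_sq, one_pow, one_mul, ← pow_mul, mul_comm 2 (N - n)]
      rcases lt_trichotomy (N - n) n with h1 | h1 | h1
      · exfalso
        refine t_sq_pow_ne_one P (n - (N - n)) (by omega) ?_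
        rw [show 2 * n = 2 * (n - (N - n)) + 2 * (N - n) by omega, pow_add] at hsq
        exact mul_right_cancel₀ (pow_ne_zero _ ht) (hsq.trans (one_mul _).symm)
      · exact h1
      · exfalso
        refine t_sq_pow_ne_one P ((N - n) - n) (by omega) ?_
        rw [show 2 * (N - n) = 2 * ((N - n) - n) + 2 * n by omega, pow_add] at hsq
        exact mul_right_cancel₀ (pow_ne_zero _ ht) (hsq.symm.trans (one_mul _).symm)
    refine ⟨by omega, ?_⟩
    rw [hN] at hform
    have h1 : (-1 : ℂ) ^ (n + s) = 1 :=
      mul_right_cancel₀ (pow_ne_zero n ht) (hform.symm.trans (one_mul _).symm)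
    rcases Nat.even_or_odd (n + s) with h2 | h2
    · exact h2
    · rw [h2.neg_one_pow] at h1; norm_num at h1
  · rintro ⟨h1, h2⟩
    have hN : N - n = n := by omega
    rw [h2.neg_one_pow, one_mul] at hform
    refine mul_right_cancel₀ (pow_ne_zero n ht) (hform.trans ?_)
    rw [hN, one_mul]

theorem aCoeff_eq_zero_iff (ℓ s : ℕ) {n : ℕ} (hn : n ≤ 2 * ℓ) :
    aCoeff P ℓ s ((n : ℤ) - ℓ) = 0 ↔ n = ℓ ∧ Even (ℓ + s) := by
  have h1 := (isLadder_xiRung P ℓ s).diag n hn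
  have h2 := (isLadder_rung P (2 * ℓ) s).diag n hn
  have h3 : (aCoeff P ℓ s ((n : ℤ) - ℓ)) • xiRung P ℓ s n
      = (P.t ^ (2 * ℓ - n) * ((-P.t⁻¹) ^ n * (-1) ^ s) - 1) • xiRung P ℓ s n := by
    rw [← h1, xiRung_eq P ℓ s hn, map_smul, h2, smul_comm]
  have h4 := smul_left_injective ℂ ((isLadder_xiRung P ℓ s).ne_zero hn) h3
  rw [h4, sub_eq_zero, kEigenvalue_eq_one_iff P s hn]
  constructor
  · rintro ⟨h5, h6⟩
    have : n = ℓ := by omega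
    exact ⟨this, this ▸ h6⟩
  · rintro ⟨rfl, h6⟩
    exact ⟨rfl, h6⟩

/-! ### Matrix elements and right slices -/

theorem comulLin_mul_sigma_pow (u : A P) (s : ℕ) : comulLin P (u * gen P .σ ^ s)
    = TensorProduct.map (mulRight ℂ (gen P .σ ^ s)) (mulRight ℂ (gen P .σ ^ s))
        (comulLin P u) := by
  induction u using A_induction P with
  | one =>
    rw [one_mul, comulLin_one]
    induction s with
    | zero => simp [comulLin_one]
    | succ s ih => rw [pow_succ', comulLin_gen_mul, ih]; simp [comulOp]
  | add u v hu hv => simp only [add_mul, map_add, hu, hv]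
  | smul z u hu => simp only [smul_mul_assoc, map_smul, hu]
  | gen_mul g u hu =>
    rw [mul_assoc, comulLin_gen_mul, comulLin_gen_mul, hu]
    generalize comulLin P u = T
    induction T with
    | zero => simp
    | add S T hS hT => simp only [map_add, hS, hT]
    | tmul x y => cases g <;> simp [comulOp, mul_assoc]

theorem coslice_xi_mul_sigma_pow (φ : A P →ₗ[ℂ] ℂ) (ℓ s : ℕ) (i : ℤ) :
    coslice P φ (xi P ℓ i * gen P .σ ^ s)
      = ∑ j ∈ idx ℓ, φ (xi P ℓ j * gen P .σ ^ s) • (matrixElement P ℓ i j * gen P .σ ^ s) := by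
  have h : comulLin P (xi P ℓ i) = ∑ j ∈ idx ℓ, matrixElement P ℓ i j ⊗ₜ[ℂ] xi P ℓ j :=
    (exists_matrixElement P ℓ i).choose_spec
  simp only [coslice, coe_comp, Function.comp_apply, comulLin_mul_sigma_pow, h, map_sum,
    TensorProduct.map_tmul, mulRight_apply, lTensor_tmul, LinearEquiv.coe_coe,
    TensorProduct.rid_tmul]

theorem coslice_sum_xiRung (φ : A P →ₗ[ℂ] ℂ) (ℓ s : ℕ) (x : ℤ → ℂ) :
    coslice P φ (∑ n ∈ Finset.range (2 * ℓ + 1), x ((n : ℤ) - ℓ) • xiRung P ℓ s n)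
      = ∑ j ∈ idx ℓ, φ (xi P ℓ j * gen P .σ ^ s) • invElem P x ℓ s j := by
  simp only [xiRung]
  rw [← sum_idx ℓ fun i => x i • (xi P ℓ i * gen P .σ ^ s)]
  simp only [map_sum, map_smul, coslice_xi_mul_sigma_pow, invElem, Finset.smul_sum]
  rw [Finset.sum_comm]
  exact Finset.sum_congr rfl fun j _ => Finset.sum_congr rfl fun i _ => smul_comm _ _ _

/-- The linear function dual to `ξ^{(ℓ)}_j σ^s` recovers the elements of the theorem as right
slices. -/
theorem exists_coslice_eq_invElem (ℓ s : ℕ) {j : ℤ} (hj : j ∈ idx ℓ) :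
    ∃ φ : A P →ₗ[ℂ] ℂ, ∀ x : ℤ → ℂ,
      coslice P φ (∑ n ∈ Finset.range (2 * ℓ + 1), x ((n : ℤ) - ℓ) • xiRung P ℓ s n)
        = invElem P x ℓ s j := by
  have hj' := Finset.mem_Icc.1 hj
  obtain ⟨φ, hφ⟩ := (isLadder_xiRung P ℓ s).exists_dual (m := (ℓ + j).toNat) (by omega)
  refine ⟨φ, fun x => ?_⟩
  have h1 : ∀ i ∈ idx ℓ, φ (xi P ℓ i * gen P .σ ^ s) = if i = j then 1 else 0 := by
    intro i hi
    have hi' := Finset.mem_Icc.1 hi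
    have h2 := hφ (ℓ + i).toNat (by omega)
    rw [xiRung, show (((ℓ + i).toNat : ℕ) : ℤ) - ℓ = i by omega] at h2
    rw [h2]
    exact if_congr (by omega) rfl rfl
  rw [coslice_sum_xiRung, Finset.sum_eq_single_of_mem j hj, h1 j hj, if_pos rfl, one_smul]
  intro i hi hij
  rw [h1 i hi, if_neg hij, zero_smul]

/-! ### Invariants -/

theorem rightAct_xElem (α β γ : ℂ) : rightAct P (xElem P α β γ)
    = α • slice P (eFun P) + β • slice P (fkFun P)
      + γ • (slice P (kHom P).toLinearMap - 1) := by
  ext u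
  have h : (pairing P (xElem P α β γ)).ofConv
      = α • eFun P + β • fkFun P + γ • ((kHom P).toLinearMap - (counitHom P).toLinearMap) := by
    rw [← pairing_e, ← pairing_fk, ← pairing_k_sub]
    simp only [xElem, map_add, map_smul]
    rfl
  rw [rightAct_eq, h]
  have hadd : ∀ φ ψ : A P →ₗ[ℂ] ℂ, slice P (φ + ψ) u = slice P φ u + slice P ψ u := by
    intro φ ψ; simp [slice, rTensor_add]
  simp only [hadd, slice_smul, slice_sub, slice_counit, LinearMap.add_apply, LinearMap.smul_apply,
    LinearMap.sub_apply, Module.End.one_apply]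

theorem mem_rightInvariants_xElem (α β γ : ℂ) (u : A P) :
    u ∈ rightInvariants P (xElem P α β γ) ↔
      (α • slice P (eFun P) + β • slice P (fkFun P)
        + γ • (slice P (kHom P).toLinearMap - 1)) u = 0 := by
  have h : counitU P (xElem P α β γ) = 0 := by
    have hg : ∀ g : UGen, counitU P (ugen P g) = match g with
      | .e => 0 | .f => 0 | .k => 1 | .kinv => 1 := by
      intro g
      have := liftU_ugen P (B := ℂ) (fun g => match g with
        | .e => 0 | .f => 0 | .k => 1 | .kinv => 1)
        (by simp) (by simp) (by simp) (by simp) (by simp) g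
      exact this
    simp [xElem, hg]
  rw [rightInvariants, h, zero_smul, sub_zero, LinearMap.mem_ker, rightAct_xElem]

/-- If, for admissible `(ℓ, s)`, the invariants in the span of the `ξ^{(ℓ)}_i σ^s` are the
multiples of `∑ x_i ξ^{(ℓ)}_i σ^s`, and all other ladders contain no invariants, then the
invariants in `𝒜` are spanned by the corresponding combinations of matrix elements. -/
theorem rightInvariants_eq_span (α β γ : ℂ) (x : ℕ → ℕ → ℤ → ℂ) (S : ℕ → ℕ → Prop)
    (hinv : ∀ ℓ s, S ℓ s → (α • slice P (eFun P) + β • slice P (fkFun P)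
      + γ • (slice P (kHom P).toLinearMap - 1))
        (∑ n ∈ Finset.range (2 * ℓ + 1), x ℓ s ((n : ℤ) - ℓ) • xiRung P ℓ s n) = 0)
    (huniq : ∀ ℓ s, ∀ y : ℕ → ℂ, (α • slice P (eFun P) + β • slice P (fkFun P)
      + γ • (slice P (kHom P).toLinearMap - 1))
        (∑ n ∈ Finset.range (2 * ℓ + 1), y n • xiRung P ℓ s n) = 0 →
      (S ℓ s ∧ ∃ z : ℂ, ∀ n ≤ 2 * ℓ, y n = z * x ℓ s ((n : ℤ) - ℓ)) ∨ ∀ n ≤ 2 * ℓ, y n = 0)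
    (hodd : ∀ N s, Odd N → ∀ y : ℕ → ℂ, (α • slice P (eFun P) + β • slice P (fkFun P)
      + γ • (slice P (kHom P).toLinearMap - 1))
        (∑ n ∈ Finset.range (N + 1), y n • rung P N s n) = 0 → ∀ n ≤ N, y n = 0) :
    rightInvariants P (xElem P α β γ)
      = Submodule.span ℂ {w | ∃ (ℓ s : ℕ) (j : ℤ), s < 2 ∧ S ℓ s ∧ j ∈ idx ℓ ∧
          w = invElem P (x ℓ s) ℓ s j} := by
  have hX : α • slice P (eFun P) + β • slice P (fkFun P)
      + γ • (slice P (kHom P).toLinearMap - 1) ∈ Algebra.adjoin ℂ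
        {slice P (eFun P), slice P (fkFun P), slice P (kHom P).toLinearMap - 1} := by
    refine add_mem (add_mem ?_ ?_) ?_ <;>
    exact Subalgebra.smul_mem _ (Algebra.subset_adjoin (by
      simp only [Set.mem_insert_iff, Set.mem_singleton_iff, true_or, or_true])) _
  have hkey : ∀ φ u, coslice P φ ((slice P (kHom P).toLinearMap - 1) u)
      = (slice P (kHom P).toLinearMap - 1) (coslice P φ u) := fun φ u => by
    simp only [LinearMap.sub_apply, map_sub, coslice_slice, Module.End.one_apply]
  refine le_antisymm (fun u hu => ?_) ?_
  · rw [mem_rightInvariants_xElem] at hu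
    refine IsLadder.mem_of_apply_eq_zero
      (fun i : ℕ × Fin 2 × (A P →ₗ[ℂ] ℂ) => isLadder_rung P i.1 i.2.1) (fun i => coslice P i.2.2)
      (fun i => coslice_slice P _ _) (fun i => coslice_slice P _ _) (fun i => hkey _)
      (iSup_map_coslice P) hX _ ?_ hu
    rintro ⟨N, ⟨s, hs⟩, φ⟩ w hw hy
    obtain ⟨y, rfl⟩ := IsLadder.exists_coeff hw
    dsimp only at hy ⊢
    have hzero : (∀ n ≤ N, y n = 0) → ∑ n ∈ Finset.range (N + 1), y n • rung P N s n = 0 :=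
      fun h => Finset.sum_eq_zero fun i hi => by
        rw [h i (by have := Finset.mem_range.1 hi; omega), zero_smul]
    rcases Nat.even_or_odd' N with ⟨ℓ, rfl | rfl⟩
    · have hy' : ∑ n ∈ Finset.range (2 * ℓ + 1), y n • rung P (2 * ℓ) s n
          = ∑ n ∈ Finset.range (2 * ℓ + 1), (y n / xiNorm P ℓ n) • xiRung P ℓ s n := by
        refine Finset.sum_congr rfl fun n hn => ?_
        have hn' := Finset.mem_range.1 hn
        rw [xiRung_eq P ℓ s (by omega), smul_smul, div_mul_cancel₀ _ (xiNorm_ne P _ _)]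
      rw [hy'] at hy ⊢
      rcases huniq ℓ s _ hy with ⟨hS, z, hz⟩ | h0
      · have h1 : ∑ n ∈ Finset.range (2 * ℓ + 1), (y n / xiNorm P ℓ n) • xiRung P ℓ s n
            = z • ∑ n ∈ Finset.range (2 * ℓ + 1), x ℓ s ((n : ℤ) - ℓ) • xiRung P ℓ s n := by
          rw [Finset.smul_sum]
          refine Finset.sum_congr rfl fun n hn => ?_
          have hn' := Finset.mem_range.1 hn
          rw [hz n (by omega), smul_smul]
        rw [h1, map_smul, coslice_sum_xiRung]
        exact Submodule.smul_mem _ _ (Submodule.sum_mem _ fun j hj => Submodule.smul_mem _ _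
          (Submodule.subset_span ⟨ℓ, s, j, hs, hS, hj, rfl⟩))
      · have h1 : ∑ n ∈ Finset.range (2 * ℓ + 1), (y n / xiNorm P ℓ n) • xiRung P ℓ s n = 0 :=
          Finset.sum_eq_zero fun i hi => by
            rw [h0 i (by have := Finset.mem_range.1 hi; omega), zero_smul]
        rw [h1, map_zero]
        exact Submodule.zero_mem _
    · rw [hzero (hodd _ s (odd_two_mul_add_one ℓ) y hy), map_zero]
      exact Submodule.zero_mem _
  · rw [Submodule.span_le]
    rintro _ ⟨ℓ, s, j, hs, hS, hj, rfl⟩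
    obtain ⟨φ, hφ⟩ := exists_coslice_eq_invElem P ℓ s hj
    rw [SetLike.mem_coe, mem_rightInvariants_xElem, ← hφ]
    have h1 := congrArg (coslice P φ) (hinv ℓ s hS)
    simpa only [LinearMap.add_apply, LinearMap.smul_apply, map_add, map_smul, coslice_slice, hkey,
      map_zero] using h1

end QOsp

namespace QOsp
variable (P : QParam)

open LinearMap

/-! ### Invariant vectors in the ladders -/

theorem coeffAB_even (α β : ℂ) (ℓ s k : ℕ) : coeffAB P α β ℓ s (((2 * k : ℕ) : ℤ) - ℓ)
    = (-(α * β⁻¹)) ^ k * ((∏ j ∈ Finset.range k, bCoeff P ℓ s (-ℓ + 2 * j))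
        / ∏ j ∈ Finset.Icc 1 k, cCoeff P ℓ s (-ℓ + 2 * j)) := by
  have h1 : (ℓ : ℤ) + (((2 * k : ℕ) : ℤ) - ℓ) = ((2 * k : ℕ) : ℤ) := by ring
  rw [coeffAB, h1, if_pos (by exact_mod_cast even_two_mul k), Int.toNat_natCast,
    Nat.mul_div_cancel_left k two_pos]

theorem coeffAB_odd (α β : ℂ) (ℓ s : ℕ) {n : ℕ} (hn : Odd n) :
    coeffAB P α β ℓ s ((n : ℤ) - ℓ) = 0 := by
  rw [coeffAB, if_neg]
  rw [add_sub_cancel, Int.even_coe_nat]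
  exact Nat.not_even_iff_odd.2 hn

theorem coeffAB_bot (α β : ℂ) (ℓ s : ℕ) : coeffAB P α β ℓ s (((0 : ℕ) : ℤ) - ℓ) = 1 := by
  simpa using coeffAB_even P α β ℓ s 0

theorem coeffAB_succ (α : ℂ) {β : ℂ} (hβ : β ≠ 0) (ℓ s : ℕ) {k : ℕ} (hk : k < ℓ) :
    β * (cCoeff P ℓ s (((2 * (k + 1) : ℕ) : ℤ) - ℓ)
        * coeffAB P α β ℓ s (((2 * (k + 1) : ℕ) : ℤ) - ℓ))
      = -(α * (bCoeff P ℓ s (((2 * k : ℕ) : ℤ) - ℓ) * coeffAB P α β ℓ s (((2 * k : ℕ) : ℤ) - ℓ))) := by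
  have hc : cCoeff P ℓ s (((2 * (k + 1) : ℕ) : ℤ) - ℓ) ≠ 0 :=
    (isLadder_xiRung P ℓ s).f_ne (2 * k + 1) (by omega)
  rw [coeffAB_even, coeffAB_even, Finset.prod_range_succ, Finset.prod_Icc_succ_top (by omega),
    show (-ℓ + 2 * (k : ℤ)) = ((2 * k : ℕ) : ℤ) - ℓ by push_cast; ring,
    show (-ℓ + 2 * ((k + 1 : ℕ) : ℤ)) = ((2 * (k + 1) : ℕ) : ℤ) - ℓ by push_cast; ring, pow_succ,
    mul_div_mul_comm]
  field_simp

theorem apply_sum_coeffAB (α : ℂ) {β : ℂ} (hβ : β ≠ 0) (ℓ s : ℕ) :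
    (α • slice P (eFun P) + β • slice P (fkFun P)
      + (0 : ℂ) • (slice P (kHom P).toLinearMap - 1))
        (∑ n ∈ Finset.range (2 * ℓ + 1), coeffAB P α β ℓ s ((n : ℤ) - ℓ) • xiRung P ℓ s n) = 0 := by
  rw [(isLadder_xiRung P ℓ s).apply_sum_eq_zero_iff α β 0
    fun n : ℕ => coeffAB P α β ℓ s ((n : ℤ) - ℓ)]
  intro m hm
  rcases Nat.even_or_odd' m with ⟨k, rfl | rfl⟩
  · rw [coeffAB_odd P α β ℓ s (odd_two_mul_add_one k)]
    rcases Nat.eq_zero_or_pos k with rfl | hk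
    · simp
    · rw [coeffAB_odd P α β ℓ s (n := 2 * k - 1) ⟨k - 1, by omega⟩]
      simp
  · have h1 := coeffAB_succ P α hβ ℓ s (k := k) (by omega)
    rw [if_neg (by omega), if_pos (by omega), Nat.add_sub_cancel]
    rw [show 2 * k + 1 + 1 = 2 * (k + 1) by ring]
    linear_combination h1

theorem prod_Icc_eq_mul_left (g : ℤ → ℂ) {a b : ℤ} (h : a ≤ b) :
    ∏ j ∈ Finset.Icc a b, g j = g a * ∏ j ∈ Finset.Icc (a + 1) b, g j := by
  rw [← Finset.insert_Icc_add_one_left_eq_Icc h, Finset.prod_insert (by simp)]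

theorem prod_Icc_eq_mul_right (g : ℤ → ℂ) {a b : ℤ} (h : a ≤ b) :
    ∏ j ∈ Finset.Icc a b, g j = (∏ j ∈ Finset.Icc a (b - 1), g j) * g b := by
  rw [← Finset.insert_Icc_sub_one_right_eq_Icc h, Finset.prod_insert (by simp), mul_comm]

theorem coeffAG_of_nonneg (α γ : ℂ) (ℓ s : ℕ) {i : ℤ} (hi : 0 ≤ i) :
    coeffAG P α γ ℓ s i = (-(α * γ⁻¹)) ^ i.toNat * ((∏ j ∈ Finset.Icc 0 (i - 1), bCoeff P ℓ s j)
      / ∏ j ∈ Finset.Icc 1 i, aCoeff P ℓ s j) := by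
  rw [coeffAG, if_neg hi.not_gt]
  split_ifs with h
  · subst h; simp
  · rfl

theorem coeffAG_succ (α : ℂ) {γ : ℂ} (hγ : γ ≠ 0) (ℓ s : ℕ) {i : ℤ} (hi : 0 ≤ i)
    (ha : aCoeff P ℓ s (i + 1) ≠ 0) :
    γ * (aCoeff P ℓ s (i + 1) * coeffAG P α γ ℓ s (i + 1))
      = -(α * (bCoeff P ℓ s i * coeffAG P α γ ℓ s i)) := by
  rw [coeffAG_of_nonneg P α γ ℓ s hi, coeffAG_of_nonneg P α γ ℓ s (i := i + 1) (by omega),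
    prod_Icc_eq_mul_right _ (show (1 : ℤ) ≤ i + 1 by omega), add_sub_cancel_right,
    prod_Icc_eq_mul_right _ hi, show (i + 1).toNat = i.toNat + 1 by omega, pow_succ,
    mul_div_mul_comm]
  field_simp

theorem apply_sum_coeffAG (α : ℂ) {γ : ℂ} (hγ : γ ≠ 0) {ℓ s : ℕ} (hs : Even (ℓ + s)) :
    (α • slice P (eFun P) + (0 : ℂ) • slice P (fkFun P)
      + γ • (slice P (kHom P).toLinearMap - 1))
        (∑ n ∈ Finset.range (2 * ℓ + 1), coeffAG P α γ ℓ s ((n : ℤ) - ℓ) • xiRung P ℓ s n) = 0 := by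
  rw [(isLadder_xiRung P ℓ s).apply_sum_eq_zero_iff α 0 γ
    fun n : ℕ => coeffAG P α γ ℓ s ((n : ℤ) - ℓ)]
  intro m hm
  have hneg : ∀ n : ℕ, n < ℓ → coeffAG P α γ ℓ s ((n : ℤ) - ℓ) = 0 := fun n hn => by
    rw [coeffAG, if_pos (by omega)]
  have hpred : m ≤ ℓ →
      (if m = 0 then 0 else bCoeff P ℓ s (((m - 1 : ℕ) : ℤ) - ℓ)
        * coeffAG P α γ ℓ s (((m - 1 : ℕ) : ℤ) - ℓ)) = 0 := by
    intro h
    split_ifs with h0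
    · rfl
    · rw [hneg _ (by omega), mul_zero]
  rcases lt_trichotomy m ℓ with h | h | h
  · rw [hpred h.le, hneg m h]; simp
  · rw [hpred h.le, (aCoeff_eq_zero_iff P ℓ s hm).2 ⟨h, hs⟩]; simp
  · have ha : aCoeff P ℓ s ((m : ℤ) - ℓ) ≠ 0 := fun h0 =>
      h.ne' ((aCoeff_eq_zero_iff P ℓ s hm).1 h0).1
    have e : (m : ℤ) - ℓ = ((m - 1 : ℕ) : ℤ) - ℓ + 1 := by omega
    rw [e] at ha
    have h1 := coeffAG_succ P α hγ ℓ s (by omega) ha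
    rw [if_neg (by omega), e, h1]
    ring

theorem coeffBG_of_nonpos (β γ : ℂ) (ℓ s : ℕ) {i : ℤ} (hi : i ≤ 0) :
    coeffBG P β γ ℓ s i = (-(β * γ⁻¹)) ^ (-i).toNat * ((∏ j ∈ Finset.Icc (i + 1) 0, cCoeff P ℓ s j)
      / ∏ j ∈ Finset.Icc i (-1), aCoeff P ℓ s j) := by
  rw [coeffBG]
  split_ifs with h h'
  · subst h; simp
  · omega
  · rfl

theorem coeffBG_pred (β : ℂ) {γ : ℂ} (hγ : γ ≠ 0) (ℓ s : ℕ) {i : ℤ} (hi : i < 0)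
    (ha : aCoeff P ℓ s i ≠ 0) :
    γ * (aCoeff P ℓ s i * coeffBG P β γ ℓ s i)
      = -(β * (cCoeff P ℓ s (i + 1) * coeffBG P β γ ℓ s (i + 1))) := by
  rw [coeffBG_of_nonpos P β γ ℓ s hi.le, coeffBG_of_nonpos P β γ ℓ s (i := i + 1) (by omega),
    prod_Icc_eq_mul_left _ (show i ≤ -1 by omega),
    prod_Icc_eq_mul_left _ (show i + 1 ≤ 0 by omega),
    show (-i).toNat = (-(i + 1)).toNat + 1 by omega, pow_succ, mul_div_mul_comm]
  field_simp

theorem apply_sum_coeffBG (β : ℂ) {γ : ℂ} (hγ : γ ≠ 0) {ℓ s : ℕ} (hs : Even (ℓ + s)) :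
    ((0 : ℂ) • slice P (eFun P) + β • slice P (fkFun P)
      + γ • (slice P (kHom P).toLinearMap - 1))
        (∑ n ∈ Finset.range (2 * ℓ + 1), coeffBG P β γ ℓ s ((n : ℤ) - ℓ) • xiRung P ℓ s n) = 0 := by
  rw [(isLadder_xiRung P ℓ s).apply_sum_eq_zero_iff 0 β γ
    fun n : ℕ => coeffBG P β γ ℓ s ((n : ℤ) - ℓ)]
  intro m hm
  have hpos : ∀ n : ℕ, ℓ < n → coeffBG P β γ ℓ s ((n : ℤ) - ℓ) = 0 := fun n hn => by
    rw [coeffBG, if_neg (by omega), if_pos (by omega)]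
  rcases lt_trichotomy m ℓ with h | h | h
  · have ha : aCoeff P ℓ s ((m : ℤ) - ℓ) ≠ 0 := fun h0 =>
      h.ne ((aCoeff_eq_zero_iff P ℓ s hm).1 h0).1
    have h1 := coeffBG_pred P β hγ ℓ s (by omega) ha
    have e : (m : ℤ) - ℓ + 1 = ((m + 1 : ℕ) : ℤ) - ℓ := by push_cast; ring
    rw [e] at h1
    rw [if_pos (show m < 2 * ℓ by omega), h1]
    ring
  · rw [hpos (m + 1) (by omega), (aCoeff_eq_zero_iff P ℓ s hm).2 ⟨h, hs⟩]; simp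
  · rw [hpos m h, hpos (m + 1) (by omega)]; simp

theorem apply_sum_sub {M : Type*} [AddCommGroup M] [Module ℂ M] (X : Module.End ℂ M) (v : ℕ → M)
    (I : Finset ℕ) (y x : ℕ → ℂ) (z : ℂ) (hy : X (∑ n ∈ I, y n • v n) = 0)
    (hx : X (∑ n ∈ I, x n • v n) = 0) : X (∑ n ∈ I, (y n - z * x n) • v n) = 0 := by
  have h : ∑ n ∈ I, (y n - z * x n) • v n = ∑ n ∈ I, y n • v n - z • ∑ n ∈ I, x n • v n := by
    simp only [sub_smul, mul_smul, Finset.sum_sub_distrib, Finset.smul_sum]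
  rw [h, map_sub, map_smul, hy, hx, smul_zero, sub_zero]

theorem rightInvariants_EF {α β : ℂ} (hα : α ≠ 0) (hβ : β ≠ 0) :
    rightInvariants P (xElem P α β 0)
      = Submodule.span ℂ {w | ∃ (ℓ s : ℕ) (j : ℤ), s < 2 ∧ True ∧ j ∈ idx ℓ ∧
          w = invElem P (coeffAB P α β ℓ s) ℓ s j} := by
  refine rightInvariants_eq_span P α β 0 (coeffAB P α β) (fun _ _ => True)
    (fun ℓ s _ => apply_sum_coeffAB P α hβ ℓ s) (fun ℓ s y hy => Or.inl ⟨trivial, y 0, ?_⟩)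
    (fun N s hN y hy => (isLadder_rung P N s).coeff_eq_zero_of_EF_odd hN hα hβ hy)
  intro n hn
  have h1 := (isLadder_xiRung P ℓ s).coeff_eq_zero_of_EF hβ
    (apply_sum_sub _ _ _ y _ (y 0) hy (apply_sum_coeffAB P α hβ ℓ s))
    (by rw [coeffAB_bot, mul_one, sub_self]) n hn
  exact sub_eq_zero.1 h1

theorem rightInvariants_EH (α : ℂ) {γ : ℂ} (hγ : γ ≠ 0) :
    rightInvariants P (xElem P α 0 γ)
      = Submodule.span ℂ {w | ∃ (ℓ s : ℕ) (j : ℤ), s < 2 ∧ Even (ℓ + s) ∧ j ∈ idx ℓ ∧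
          w = invElem P (coeffAG P α γ ℓ s) ℓ s j} := by
  refine rightInvariants_eq_span P α 0 γ (coeffAG P α γ) (fun ℓ s => Even (ℓ + s))
    (fun ℓ s hs => apply_sum_coeffAG P α hγ hs) (fun ℓ s y hy => ?_) (fun N s hN y hy => ?_)
  · by_cases hs : Even (ℓ + s)
    · refine Or.inl ⟨hs, y ℓ, fun n hn => ?_⟩
      have h1 := (isLadder_xiRung P ℓ s).coeff_eq_zero_of_EH hγ
        (apply_sum_sub _ _ _ y _ (y ℓ) hy (apply_sum_coeffAG P α hγ hs))
        (fun m hm h0 => by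
          obtain rfl := ((aCoeff_eq_zero_iff P ℓ s hm).1 h0).1
          simp [coeffAG]) n hn
      exact sub_eq_zero.1 h1
    · exact Or.inr ((isLadder_xiRung P ℓ s).coeff_eq_zero_of_EH hγ hy fun m hm h0 =>
        absurd ((aCoeff_eq_zero_iff P ℓ s hm).1 h0).2 hs)
  · refine (isLadder_rung P N s).coeff_eq_zero_of_EH hγ hy fun m hm h0 => ?_
    have h1 := ((kEigenvalue_eq_one_iff P s hm).1 (sub_eq_zero.1 h0)).1
    exact absurd hN (by rw [h1, Nat.not_odd_iff_even]; exact even_two_mul m)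

theorem rightInvariants_FH (β : ℂ) {γ : ℂ} (hγ : γ ≠ 0) :
    rightInvariants P (xElem P 0 β γ)
      = Submodule.span ℂ {w | ∃ (ℓ s : ℕ) (j : ℤ), s < 2 ∧ Even (ℓ + s) ∧ j ∈ idx ℓ ∧
          w = invElem P (coeffBG P β γ ℓ s) ℓ s j} := by
  refine rightInvariants_eq_span P 0 β γ (coeffBG P β γ) (fun ℓ s => Even (ℓ + s))
    (fun ℓ s hs => apply_sum_coeffBG P β hγ hs) (fun ℓ s y hy => ?_) (fun N s hN y hy => ?_)
  · by_cases hs : Even (ℓ + s)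
    · refine Or.inl ⟨hs, y ℓ, fun n hn => ?_⟩
      have h1 := (isLadder_xiRung P ℓ s).coeff_eq_zero_of_FH hγ
        (apply_sum_sub _ _ _ y _ (y ℓ) hy (apply_sum_coeffBG P β hγ hs))
        (fun m hm h0 => by
          obtain rfl := ((aCoeff_eq_zero_iff P ℓ s hm).1 h0).1
          simp [coeffBG]) n hn
      exact sub_eq_zero.1 h1
    · exact Or.inr ((isLadder_xiRung P ℓ s).coeff_eq_zero_of_FH hγ hy fun m hm h0 =>
        absurd ((aCoeff_eq_zero_iff P ℓ s hm).1 h0).2 hs)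
  · refine (isLadder_rung P N s).coeff_eq_zero_of_FH hγ hy fun m hm h0 => ?_
    have h1 := ((kEigenvalue_eq_one_iff P s hm).1 (sub_eq_zero.1 h0)).1
    exact absurd hN (by rw [h1, Nat.not_odd_iff_even]; exact even_two_mul m)

/-! ### Products of invariants -/

theorem slice_k_par_gen_mul (g : AGen) (u : A P) :
    slice P (kHom P).toLinearMap (par P (gen P g * u))
      = (match g with | .a => P.t | .b => -P.t | .c => P.t⁻¹ | .d => -P.t⁻¹ | .σ => -1 : ℂ) •
        (gen P g * slice P (kHom P).toLinearMap (par P u)) := by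
  rw [map_mul]
  cases g <;> simp only [par_a, par_b, par_c, par_d, par_σ, neg_mul, map_neg] <;>
    rw [slice_gen_mul] <;>
    simp only [pre_k, prePar_k, slice_smul, zero_smul, slice_zero, mul_zero, add_zero, zero_add,
      mul_smul_comm] <;> module

/-- The action of `e` is a twisted derivation. -/
theorem slice_e_mul (u v : A P) : slice P (eFun P) (u * v)
    = slice P (eFun P) u * v
      + slice P (kHom P).toLinearMap (par P u) * slice P (eFun P) v := by
  induction u using A_induction P with
  | one => simp [slice_one, eFun_one]
  | add u u' hu hu' => simp only [add_mul, map_add, hu, hu']; abel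
  | smul z u hu => simp only [smul_mul_assoc, map_smul, hu, smul_add]
  | gen_mul g u hu =>
    rw [mul_assoc, slice_k_par_gen_mul]
    cases g
    · simp only [slice_e_a, hu, mul_add, add_mul, smul_mul_assoc, mul_assoc]; module
    · simp only [slice_e_b, hu, mul_add, add_mul, smul_mul_assoc, mul_assoc]; module
    · simp only [slice_e_c, hu, mul_add, smul_mul_assoc, mul_assoc]; module
    · simp only [slice_e_d, hu, mul_add, smul_mul_assoc, mul_assoc]; module
    · have hσ : ∀ w : A P, slice P (eFun P) (gen P .σ * w)
          = (-1 : ℂ) • (gen P .σ * slice P (eFun P) w) := by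
        intro w
        rw [slice_gen_mul]
        simp only [pre_e, slice_smul, mul_smul_comm]
      simp only [hσ, hu, mul_add, smul_mul_assoc, mul_assoc]; module

theorem fkFun_par (u : A P) : fkFun P (par P u) = -fkFun P u := by
  simp only [fkFun, conv, coe_comp, Function.comp_apply, comulLin_par]
  generalize comulLin P u = T
  induction T with
  | zero => simp
  | add S T hS hT => simp only [map_add, hS, hT, neg_add]
  | tmul z w => simp [fFun_par, kHom_par]

theorem prePar_fk_a : prePar P (fkFun P) .a = (-P.t) • fkFun P := by
  ext u
  have h := LinearMap.congr_fun (pre_fk_a P) (par P u)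
  simp only [pre, coe_comp, Function.comp_apply, LinearMap.smul_apply, fkFun_par] at h
  simpa [prePar] using h

theorem prePar_fk_c : prePar P (fkFun P) .c = P.t • (counitHom P).toLinearMap := by
  ext u
  have h := LinearMap.congr_fun (pre_fk_c P) (par P u)
  simpa [prePar, pre] using h

theorem pre_fk_b : pre P (fkFun P) .b = 0 := by
  ext u
  simp only [pre, coe_comp, Function.comp_apply, mulLeft_apply]
  rw [fkFun, conv_gen_mul]
  simp [pre_f, prePar_f, pre_k]

theorem pre_fk_d : pre P (fkFun P) .d = (-P.t⁻¹) • fkFun P := by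
  ext u
  simp only [pre, coe_comp, Function.comp_apply, mulLeft_apply]
  rw [fkFun, conv_gen_mul]
  simp [pre_f, prePar_f, pre_k]

theorem pre_fk_σ : pre P (fkFun P) .σ = (-1 : ℂ) • fkFun P := by
  ext u
  simp only [pre, coe_comp, Function.comp_apply, mulLeft_apply]
  rw [fkFun, conv_gen_mul]
  simp [pre_f, pre_k]

/-- The action of `fk` is a twisted derivation. -/
theorem slice_fk_mul (u v : A P) : slice P (fkFun P) (u * v)
    = slice P (fkFun P) u * v
      + slice P (kHom P).toLinearMap (par P u) * slice P (fkFun P) v := by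
  induction u using A_induction P with
  | one =>
    have h : fkFun P 1 = 0 := by simpa using fk_sigma P 0
    simp [slice_one, h]
  | add u u' hu hu' => simp only [add_mul, map_add, hu, hu']; abel
  | smul z u hu => simp only [smul_mul_assoc, map_smul, hu, smul_add]
  | gen_mul g u hu =>
    rw [mul_assoc, slice_k_par_gen_mul]
    cases g
    · simp only [slice_fk_a, hu, mul_add, smul_mul_assoc, mul_assoc]; module
    · have hb : ∀ w : A P, slice P (fkFun P) (gen P .b * w)
          = (-P.t) • (gen P .b * slice P (fkFun P) w) := by
        intro w
        rw [slice_gen_mul]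
        simp only [prePar_fk_a, pre_fk_b, slice_smul, slice_zero, mul_zero, add_zero,
          mul_smul_comm]
      simp only [hb, hu, mul_add, smul_mul_assoc, mul_assoc]; module
    · simp only [slice_fk_c, hu, mul_add, add_mul, smul_mul_assoc, mul_assoc]; module
    · have hd : ∀ w : A P, slice P (fkFun P) (gen P .d * w)
          = P.t • (gen P .b * w) + (-P.t⁻¹) • (gen P .d * slice P (fkFun P) w) := by
        intro w
        rw [slice_gen_mul]
        simp only [prePar_fk_c, pre_fk_d, slice_smul, slice_counit, mul_smul_comm]
      simp only [hd, hu, mul_add, add_mul, smul_mul_assoc, mul_assoc]; module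
    · have hσ : ∀ w : A P, slice P (fkFun P) (gen P .σ * w)
          = (-1 : ℂ) • (gen P .σ * slice P (fkFun P) w) := by
        intro w
        rw [slice_gen_mul]
        simp only [pre_fk_σ, slice_smul, mul_smul_comm]
      simp only [hσ, hu, mul_add, smul_mul_assoc, mul_assoc]; module

theorem exists_subalgebra_eq_rightInvariants (α β : ℂ) : ∃ B : Subalgebra ℂ (A P),
    Subalgebra.toSubmodule B = rightInvariants P (xElem P α β 0) := by
  set X := α • slice P (eFun P) + β • slice P (fkFun P)
    + (0 : ℂ) • (slice P (kHom P).toLinearMap - 1) with hX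
  have hmul : ∀ u v, X (u * v) = X u * v + slice P (kHom P).toLinearMap (par P u) * X v := by
    intro u v
    simp only [hX, zero_smul, add_zero, LinearMap.add_apply, LinearMap.smul_apply, slice_e_mul,
      slice_fk_mul, add_mul, mul_add, smul_mul_assoc, mul_smul_comm]
    module
  have hone : X 1 = 0 := by
    have h1 := hmul 1 1
    simpa [slice_one] using h1
  have hmem := mem_rightInvariants_xElem P α β 0
  refine ⟨(rightInvariants P (xElem P α β 0)).toSubalgebra ((hmem 1).2 hone)
    (fun u v hu hv => (hmem _).2 ?_), Submodule.toSubalgebra_toSubmodule ..⟩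
  have hu' : X u = 0 := (hmem u).1 hu
  have hv' : X v = 0 := (hmem v).1 hv
  change X (u * v) = 0
  rw [hmul, hu', hv', zero_mul, mul_zero, add_zero]

end QOsp

theorem theorem3p5 (P : QParam) (α β γ : ℂ) (hα : α ≠ 0) (hβ : β ≠ 0) (hγ : γ ≠ 0) :
    ((∃ B : Subalgebra ℂ (QOsp.A P),
        Subalgebra.toSubmodule B = QOsp.rightInvariants P (QOsp.xElem P α β 0)) ∧
      QOsp.rightInvariants P (QOsp.xElem P α β 0)
        = Submodule.span ℂ {w | ∃ (ℓ s : ℕ) (j : ℤ), s < 2 ∧ j ∈ QOsp.idx ℓ ∧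
            w = QOsp.invElem P (QOsp.coeffAB P α β ℓ s) ℓ s j}) ∧
    QOsp.rightInvariants P (QOsp.xElem P α 0 γ)
        = Submodule.span ℂ {w | ∃ (ℓ s : ℕ) (j : ℤ), s < 2 ∧ Even (ℓ + s) ∧ j ∈ QOsp.idx ℓ ∧
            w = QOsp.invElem P (QOsp.coeffAG P α γ ℓ s) ℓ s j} ∧
    QOsp.rightInvariants P (QOsp.xElem P 0 β γ)
        = Submodule.span ℂ {w | ∃ (ℓ s : ℕ) (j : ℤ), s < 2 ∧ Even (ℓ + s) ∧ j ∈ QOsp.idx ℓ ∧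
            w = QOsp.invElem P (QOsp.coeffBG P β γ ℓ s) ℓ s j} := by
  refine ⟨⟨QOsp.exists_subalgebra_eq_rightInvariants P α β, ?_⟩, QOsp.rightInvariants_EH P α hγ,
    QOsp.rightInvariants_FH P β hγ⟩
  rw [QOsp.rightInvariants_EF P hα hβ]
  simp only [true_and]
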